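/- **Lemma 4.5.** Conventions. Let $N$ be a closed oriented graph manifold whose JSJ decomposition consists of two pieces $\Sigma_1,\Sigma_2$ and $d\ge 1$ tori $T_1,\dots,T_d$, each shared by both pieces (a *$d$-multiple edges graph manifold*). Suppose that $N$ is coordinated and has *Property I*, that is: 1. for $i=1,2$, $\Sigma_i$ is the product $F_i\times S^1$, where $F_i$ is a compact connected oriented surface of genus $g(F_i)\ge 2$ with $d$ boundary circles, and the product orientation is that of $N$. Each boundary torus of $\Sigma_i$ then has the oriented basis $(s,h)$ of its first homology, where $s$ is the oriented boundary circle of $F_i$ and $h$ is the oriented fibre $S^1$; 2. the gluing homeomorphisms $\tau_j$ of $T_j$, from the boundary torus $T_{j,-}\subset\partial\Sigma_1$ to the boundary torus $T_{j,+}\subset\partial\Sigma_2$ ($j=1,\dots,d$), all have the same gluing matrix $A$: $\ (\tau_j)_*(s_-,h_-)=(s_+,h_+)A$, where $A$ is an integral $2\times 2$ matrix. Here $\det A=-1$, because $N$ is oriented. (That the $T_j$ are the JSJ tori of $N$ means, for such pieces, that $\tau_j$ never carries the fibre of $\Sigma_1$ to the fibre of $\Sigma_2$ up to isotopy in the torus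 and orientation.) Statement. Let $N$ be a $d$-multiple edges graph manifold with Property I, and suppose that $g(F_i)=a_i d+b_i$ for some positive integers $a_i,b_i$, for $i=1,2$. Then $N$ dominates a $\widetilde{\mathrm{PSL}}(2,\mathbf R)$-manifold: there are a closed orientable 3-manifold $M$ that admits a Seifert fibration with nonzero Euler number and with base orbifold of negative Euler characteristic, and a continuous map $f\colon N\to M$ of nonzero degree. -/

import Mathlib

noncomputable section

namespace GraphMfd

/-! ### Compact surfaces as polygons with identified sides -/

/-- Centre of the `j`-th of the `d` holes cut out of the unit disc; the centres lie on the real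
axis, in `(-1/2, 1/2)`, at mutual distance at least `1 / d`. -/
def holeCenter (d : ℕ) (j : Fin d) : ℂ := (((2 * (j : ℝ) + 1 - d) / (2 * d) : ℝ) : ℂ)

/-- Common radius of the holes. -/
def holeRadius (d : ℕ) : ℝ := 1 / (4 * d)

/-- The closed unit disc with `d` disjoint open round discs removed. -/
def HoledDisc (d : ℕ) : Type :=
  {z : ℂ // ‖z‖ ≤ 1 ∧ ∀ j : Fin d, holeRadius d ≤ ‖z - holeCenter d j‖}

instance (d : ℕ) : TopologicalSpace (HoledDisc d) :=
  inferInstanceAs (TopologicalSpace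
    {z : ℂ // ‖z‖ ≤ 1 ∧ ∀ j : Fin d, holeRadius d ≤ ‖z - holeCenter d j‖})

theorem holeRadius_nonneg (d : ℕ) : 0 ≤ holeRadius d := by
  unfold holeRadius; positivity

theorem norm_holeCenter_add_le (d : ℕ) (j : Fin d) :
    ‖holeCenter d j‖ + holeRadius d ≤ 1 / 2 := by
  have hj : ((j : ℕ) : ℝ) + 1 ≤ d := by exact_mod_cast j.isLt
  have hj0 : (0 : ℝ) ≤ (j : ℕ) := Nat.cast_nonneg _
  have hd : (0 : ℝ) < d := by linarith
  unfold holeCenter holeRadius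
  rw [Complex.norm_real, Real.norm_eq_abs, abs_div, abs_of_pos (by linarith : (0 : ℝ) < 2 * d)]
  have h : |2 * ((j : ℕ) : ℝ) + 1 - d| ≤ d - 1 := abs_le.mpr ⟨by linarith, by linarith⟩
  calc |2 * ((j : ℕ) : ℝ) + 1 - d| / (2 * d) + 1 / (4 * d)
      ≤ (d - 1) / (2 * d) + 1 / (4 * d) := by gcongr
    _ ≤ 1 / 2 := by
      rw [div_add_div _ _ (by positivity) (by positivity),
        div_le_div_iff₀ (by positivity) (by norm_num)]
      nlinarith

theorem dist_holeCenter (d : ℕ) {i j : Fin d} (h : i ≠ j) :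
    4 * holeRadius d ≤ ‖holeCenter d i - holeCenter d j‖ := by
  have hd : (0 : ℝ) < d := by exact_mod_cast i.pos
  have hij : (1 : ℝ) ≤ |((i : ℕ) : ℝ) - ((j : ℕ) : ℝ)| := by
    have h1 : ((i : ℕ) : ℤ) - ((j : ℕ) : ℤ) ≠ 0 := by
      intro h0
      exact h (Fin.ext (by omega))
    have h2 : (1 : ℤ) ≤ |((i : ℕ) : ℤ) - ((j : ℕ) : ℤ)| := Int.one_le_abs h1
    exact_mod_cast h2
  have e : holeCenter d i - holeCenter d j
      = (((((i : ℕ) : ℝ) - ((j : ℕ) : ℝ)) / d : ℝ) : ℂ) := by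
    unfold holeCenter
    rw [← Complex.ofReal_sub]
    congr 1
    field_simp
    ring
  rw [e, Complex.norm_real, Real.norm_eq_abs, abs_div, abs_of_pos hd]
  unfold holeRadius
  rw [show 4 * (1 / (4 * (d : ℝ))) = 1 / d by field_simp]
  gcongr

/-- The boundary circle of the `j`-th hole, run through clockwise, that is, with the orientation
it has as part of the boundary of the holed disc. -/
def rim (d : ℕ) (j : Fin d) (u : Circle) : HoledDisc d :=
  ⟨holeCenter d j + holeRadius d * ((u⁻¹ : Circle) : ℂ), by
    have hr : ‖(holeRadius d : ℂ) * ((u⁻¹ : Circle) : ℂ)‖ = holeRadius d := by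
      rw [norm_mul, Circle.norm_coe, mul_one, Complex.norm_real, Real.norm_eq_abs,
        abs_of_nonneg (holeRadius_nonneg d)]
    refine ⟨?_, fun i => ?_⟩
    · have h1 := norm_add_le (holeCenter d j) ((holeRadius d : ℂ) * ((u⁻¹ : Circle) : ℂ))
      have h2 := norm_holeCenter_add_le d j
      linarith
    · by_cases h : j = i
      · subst h
        rw [add_sub_cancel_left, hr]
      · have h1 := dist_holeCenter d h
        have h2 := norm_sub_le (holeCenter d j + (holeRadius d : ℂ) * ((u⁻¹ : Circle) : ℂ)
          - holeCenter d i) ((holeRadius d : ℂ) * ((u⁻¹ : Circle) : ℂ))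
        rw [show holeCenter d j + (holeRadius d : ℂ) * ((u⁻¹ : Circle) : ℂ) - holeCenter d i
          - (holeRadius d : ℂ) * ((u⁻¹ : Circle) : ℂ) = holeCenter d j - holeCenter d i by ring,
          hr] at h2
        have h3 := holeRadius_nonneg d
        linarith⟩

/-- The point `exp (2 π i x / n)` of the outer circle, regarded as the boundary of a polygon with
`n` sides: the side number `k` is `{outer d n x | k ≤ x ≤ k + 1}`. -/
def outer (d n : ℕ) (x : ℝ) : HoledDisc d :=
  ⟨(Circle.exp (2 * Real.pi * x / n) : ℂ), by
    refine ⟨(Circle.norm_coe _).le, fun j => ?_⟩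
    have h1 := norm_sub_norm_le ((Circle.exp (2 * Real.pi * x / n) : Circle) : ℂ) (holeCenter d j)
    have h2 := norm_holeCenter_add_le d j
    have h3 := norm_nonneg (holeCenter d j)
    rw [Circle.norm_coe] at h1
    linarith⟩

/-- Topological types of closed connected surfaces: the orientable surface of genus `g`, and the
connected sum of `k` projective planes. -/
inductive SurfaceType : Type
  | orientable (g : ℕ) : SurfaceType
  | nonorientable (k : ℕ) : SurfaceType

/-- Number of sides of the polygon from which the surface is made. -/
def SurfaceType.sides : SurfaceType → ℕ
  | .orientable g => 4 * g + 2
  | .nonorientable k => 2 * k + 2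

/-- Euler characteristic of the closed surface. -/
def SurfaceType.euler : SurfaceType → ℤ
  | .orientable g => 2 - 2 * g
  | .nonorientable k => 2 - k

/-- Side pairings of the polygon with boundary word `[a₁,b₁]⋯[a_g,b_g] c c⁻¹` in the orientable
case and `a₁a₁⋯a_ka_k c c⁻¹` in the other one (the pair `c c⁻¹` makes the sphere no exception).
`SidePair S x y ε` means that the boundary points with the parameters `x` and `y` are identified;
`ε` is `true` for the pairings that reverse the orientation of the surface. -/
inductive SidePair : SurfaceType → ℝ → ℝ → Bool → Prop
  | a (g : ℕ) (m : Fin g) (t : ℝ) (h0 : 0 ≤ t) (h1 : t ≤ 1) :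
      SidePair (.orientable g) (4 * (m : ℝ) + t) (4 * (m : ℝ) + 3 - t) false
  | b (g : ℕ) (m : Fin g) (t : ℝ) (h0 : 0 ≤ t) (h1 : t ≤ 1) :
      SidePair (.orientable g) (4 * (m : ℝ) + 1 + t) (4 * (m : ℝ) + 4 - t) false
  | c (g : ℕ) (t : ℝ) (h0 : 0 ≤ t) (h1 : t ≤ 1) :
      SidePair (.orientable g) (4 * (g : ℝ) + t) (4 * (g : ℝ) + 2 - t) false
  | crosscap (k : ℕ) (m : Fin k) (t : ℝ) (h0 : 0 ≤ t) (h1 : t ≤ 1) :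
      SidePair (.nonorientable k) (2 * (m : ℝ) + t) (2 * (m : ℝ) + 1 + t) true
  | c' (k : ℕ) (t : ℝ) (h0 : 0 ≤ t) (h1 : t ≤ 1) :
      SidePair (.nonorientable k) (2 * (k : ℝ) + t) (2 * (k : ℝ) + 2 - t) false

/-- The compact connected oriented surface of genus `g` with `d` boundary circles: the holed disc,
with the sides of its outer polygon identified in pairs. -/
def Surface (g d : ℕ) : Type :=
  Quot fun z w : HoledDisc d => ∃ x y : ℝ, ∃ ε : Bool, SidePair (.orientable g) x y ε ∧
    z = outer d (SurfaceType.orientable g).sides x ∧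
    w = outer d (SurfaceType.orientable g).sides y

instance (g d : ℕ) : TopologicalSpace (Surface g d) :=
  inferInstanceAs (TopologicalSpace (Quot _))

/-- The `j`-th boundary circle of the surface, with its boundary orientation. -/
def Surface.bdry (g d : ℕ) (j : Fin d) (u : Circle) : Surface g d := Quot.mk _ (rim d j u)

/-! ### Tori and gluing matrices -/

/-- The torus. Its first homology has the basis `(s, h)`, given by the two coordinate circles. -/
abbrev Torus : Type := Circle × Circle

/-- The curve `s`. -/
def sCurve : C(Circle, Torus) := ⟨fun u => (u, 1), by fun_prop⟩

/-- The curve `h`. -/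
def hCurve : C(Circle, Torus) := ⟨fun v => (1, v), by fun_prop⟩

/-- The curve `h` run through backwards. -/
def hCurveRev : C(Circle, Torus) := ⟨fun v => (1, v⁻¹), by fun_prop⟩

/-- The linear self-map of the torus with matrix `A`: in homology,
`s ↦ A₀₀ s + A₁₀ h` and `h ↦ A₀₁ s + A₁₁ h`. -/
def linearMap (A : Matrix (Fin 2) (Fin 2) ℤ) : C(Torus, Torus) :=
  ⟨fun x => (x.1 ^ A 0 0 * x.2 ^ A 0 1, x.1 ^ A 1 0 * x.2 ^ A 1 1), by fun_prop⟩

/-- `φ (s, h) = (s, h) A` in the first homology of the torus. As the fundamental group of the torus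
is abelian, equality of homology classes of curves is free homotopy. -/
def HasGluingMatrix (φ : Torus ≃ₜ Torus) (A : Matrix (Fin 2) (Fin 2) ℤ) : Prop :=
  (ContinuousMap.comp (φ : C(Torus, Torus)) sCurve).Homotopic ((linearMap A).comp sCurve) ∧
  (ContinuousMap.comp (φ : C(Torus, Torus)) hCurve).Homotopic ((linearMap A).comp hCurve)

/-- `φ` carries the unoriented fibre `h`, up to homotopy in the torus, to the fibre `h`. -/
def FibresMatch (φ : Torus ≃ₜ Torus) : Prop :=
  (ContinuousMap.comp (φ : C(Torus, Torus)) hCurve).Homotopic hCurve ∨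
  (ContinuousMap.comp (φ : C(Torus, Torus)) hCurve).Homotopic hCurveRev

/-! ### Multiple edges graph manifolds with product pieces -/

/-- The space obtained from `F₁ × S¹` and `F₂ × S¹`, where `Fᵢ` is the surface of genus `gᵢ` with
`d` boundary circles, by gluing the `j`-th boundary torus of the first to the `σ j`-th boundary
torus of the second by the homeomorphism `φ j`. -/
def Glued (g₁ g₂ d : ℕ) (σ : Equiv.Perm (Fin d)) (φ : Fin d → (Torus ≃ₜ Torus)) : Type :=
  Quot fun p q : (Surface g₁ d × Circle) ⊕ (Surface g₂ d × Circle) =>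
    ∃ (j : Fin d) (x : Torus), p = Sum.inl (Surface.bdry g₁ d j x.1, x.2) ∧
      q = Sum.inr (Surface.bdry g₂ d (σ j) (φ j x).1, (φ j x).2)

instance (g₁ g₂ d : ℕ) (σ : Equiv.Perm (Fin d)) (φ : Fin d → (Torus ≃ₜ Torus)) :
    TopologicalSpace (Glued g₁ g₂ d σ φ) :=
  inferInstanceAs (TopologicalSpace (Quot _))

/-- A coordinated `d`-multiple edges graph manifold `N` whose two JSJ pieces are the products
`Fᵢ × S¹`, with `Fᵢ` an oriented surface of genus `gᵢ ≥ 2` (and `d` boundary circles, one for each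
JSJ torus). The edges are directed from the first piece to the second. -/
structure MultipleEdges (N : Type) [TopologicalSpace N] (d g₁ g₂ : ℕ) where
  /-- the dual graph is connected, so it has an edge -/
  pos : 0 < d
  genus_one : 2 ≤ g₁
  genus_two : 2 ≤ g₂
  /-- which boundary tori are glued -/
  σ : Equiv.Perm (Fin d)
  /-- the sewing maps of the tori -/
  φ : Fin d → (Torus ≃ₜ Torus)
  /-- the gluing matrices of the tori -/
  A : Fin d → Matrix (Fin 2) (Fin 2) ℤ
  hasMatrix : ∀ j, HasGluingMatrix (φ j) (A j)
  /-- the sewing maps reverse the boundary orientations, so that the product orientations of the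
  pieces fit together to an orientation of `N` -/
  det : ∀ j, (A j).det = -1
  /-- the tori are the JSJ tori: the Seifert fibrations of the two pieces, which are unique up to
  isotopy, do not match along any of them -/
  not_match : ∀ j, ¬ FibresMatch (φ j)
  homeo : N ≃ₜ Glued g₁ g₂ d σ φ

/-- All the gluing matrices are equal. The rest of Property I, product pieces with base of genus at
least two, is part of `MultipleEdges`. -/
def MultipleEdges.PropertyI {N : Type} [TopologicalSpace N] {d g₁ g₂ : ℕ}
    (G : MultipleEdges N d g₁ g₂) : Prop :=
  ∀ i j : Fin d, G.A i = G.A j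

/-! ### Closed oriented Seifert manifolds -/

/-- Seifert invariants of a closed oriented Seifert manifold: the underlying surface of the base
orbifold and `n` coprime pairs `(α, β)`, `α > 0` (with `α = 1` allowed). The pair is the first
column of an integral matrix `B` of determinant one; the second column is a choice of a longitude
of the solid torus, which does not affect the manifold. -/
structure SeifertData where
  base : SurfaceType
  n : ℕ
  B : Fin n → Matrix.SpecialLinearGroup (Fin 2) ℤ
  pos : ∀ k, 0 < (B k).1 0 0

/-- Multiplicity of the `k`-th fibre. -/
def SeifertData.α (D : SeifertData) (k : Fin D.n) : ℤ := (D.B k).1 0 0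

def SeifertData.β (D : SeifertData) (k : Fin D.n) : ℤ := (D.B k).1 1 0

/-- Euler number of the Seifert fibration. -/
def SeifertData.eulerNumber (D : SeifertData) : ℚ := -∑ k, (D.β k : ℚ) / D.α k

/-- Euler characteristic of the base orbifold. -/
def SeifertData.baseEuler (D : SeifertData) : ℚ := D.base.euler - ∑ k, (1 - 1 / (D.α k : ℚ))

/-- The closed unit disc. -/
abbrev Disc : Type := {z : ℂ // ‖z‖ ≤ 1}

/-- The boundary circle of the disc. -/
def Disc.bdry (u : Circle) : Disc := ⟨u, (Circle.norm_coe u).le⟩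

/-- The identifications that make the Seifert manifold out of (holed disc) × S¹ and `n` solid tori.
`side`: the sides of the polygon times `S¹` are identified so as to give the circle bundle with
oriented total space and a section over the surface with `n` holes (the fibre is reflected
exactly at the pairings that reverse the orientation of the base). `fill`: the `k`-th solid torus is
attached to the `k`-th boundary torus so that its meridian becomes `α s + β h`. -/
inductive SeifertRel (D : SeifertData) :
    (HoledDisc D.n × Circle) ⊕ (Fin D.n × Disc × Circle) →
    (HoledDisc D.n × Circle) ⊕ (Fin D.n × Disc × Circle) → Prop
  | side (x y : ℝ) (ε : Bool) (h : SidePair D.base x y ε) (v : Circle) :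
      SeifertRel D (Sum.inl (outer D.n D.base.sides x, v))
        (Sum.inl (outer D.n D.base.sides y, if ε then v⁻¹ else v))
  | fill (k : Fin D.n) (x : Torus) :
      SeifertRel D (Sum.inr (k, Disc.bdry x.1, x.2))
        (Sum.inl (rim D.n k (linearMap (D.B k).1 x).1, (linearMap (D.B k).1 x).2))

/-- The closed oriented Seifert manifold with the given invariants. -/
def SeifertManifold (D : SeifertData) : Type := Quot (SeifertRel D)

instance (D : SeifertData) : TopologicalSpace (SeifertManifold D) :=
  inferInstanceAs (TopologicalSpace (Quot _))

/-- A closed orientable manifold that supports the `PSL~(2,ℝ)` geometry: it has a Seifert fibration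
with nonzero Euler number and base orbifold of negative Euler characteristic. -/
def SupportsPSLTilde (M : Type) [TopologicalSpace M] : Prop :=
  ∃ D : SeifertData, Nonempty (M ≃ₜ SeifertManifold D) ∧ D.eulerNumber ≠ 0 ∧ D.baseEuler < 0

/-! ### Degree -/

/-- A map between closed connected orientable 3-manifolds has nonzero degree: it is not the zero map
on the third integral singular homology, which is infinite cyclic for both of them. -/
def NonzeroDegree {N M : Type} [TopologicalSpace N] [TopologicalSpace M] (f : C(N, M)) : Prop :=
  ((AlgebraicTopology.singularHomologyFunctor (ModuleCat.{0} ℤ) 3).obj (ModuleCat.of ℤ ℤ)).map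
    (TopCat.ofHom f) ≠ 0

end GraphMfd

end

/-! The target is the circle bundle `Bundle β` of Euler number `-β` over the surface of genus two,
for a suitable β ≠ 0. On Fᵢ × S¹ the map covers a map from Fᵢ to the surface of genus two: the inner
disc with all its holes goes to one point, the handles beyond the second are pinched, and the degree
δᵢ is 0, 1 or -1. Each boundary torus then lies over that point, and it is sent to the fibre by (u,
v) ↦ u^kᵢ v^mᵢ up to homotopy. Winding kᵢ around each of d holes, which are run through clockwise,
forces winding -d kᵢ along the outer circle. The fibre coordinate closes up over the sides of the
polygon if this number is β δᵢ (`exists_windingMap`, `exists_pieceMap`).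

The two pieces fit along a torus if (k₁, m₁) = (k₂, m₂) A. As all gluing matrices are equal, the
same exponents serve for every torus. A sewing map is only homotopic to the linear map of A; the
difference is a pair of real angle functions (`HasGluingMatrix.exists_angles`), which the map on the
first piece absorbs near its holes.

The degree is detected by a further map from the bundle to the Heisenberg nilmanifold
(`exists_bundle_nil`) and an explicit polynomial group cocycle for its volume
(`volCochain_cocycle`). A fundamental cycle of N consists of the chains Fᵢ × S¹ and of correcting
chains in the tori, which exist because det A = -1 (`push_homeo_torusChain`, `bdryOp_cycle`).
Contracting the volume cocycle with the central direction gives the coboundary of a height cochain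
(`eval_prismTwo`). So Fᵢ × S¹ contributes mᵢ times the height of ∂Fᵢ, that is mᵢ d kᵢ
(`eval_piece`), while the correcting chains land in a single fibre and contribute nothing
(`volCochain_fibre`).

It remains to make m₁k₁ + m₂k₂ nonzero (`exists_windings`). If A₁₀ ≠ 0, it is A₁₀ times the form
A₁₁δ₁² + 2δ₁δ₂ - A₀₀δ₂², which is nonzero at some admissible (δ₁, δ₂) thanks to its mixed term. If
A₁₀ = 0, it can be made ±A₀₁, and A₀₁ ≠ 0 because the fibres do not match
(`MultipleEdges.entry_ne_zero`). -/

noncomputable section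

namespace GraphMfd

open CategoryTheory AlgebraicTopology

/-! ### Singular chains and cochains, and their comparison with singular homology -/

/-- The standard topological simplex. -/
abbrev Simp (n : ℕ) : Type := stdSimplex ℝ (Fin (n + 1))

/-- Integral singular chains. -/
abbrev Chain (n : ℕ) (Y : Type) [TopologicalSpace Y] : Type := C(Simp n, Y) →₀ ℤ

/-- The inclusion of the `i`-th face of the standard simplex. -/
def faceIncl (n : ℕ) (i : Fin (n + 2)) : C(Simp n, Simp (n + 1)) :=
  ⟨stdSimplex.map i.succAbove, stdSimplex.continuous_map _⟩

variable {X Y Z : Type} [TopologicalSpace X] [TopologicalSpace Y] [TopologicalSpace Z]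

/-- The boundary of a singular simplex. -/
def simplexBdry (n : ℕ) (σ : C(Simp (n + 1), Y)) : Chain n Y :=
  ∑ i : Fin (n + 2), (-1 : ℤ) ^ (i : ℕ) • Finsupp.single (σ.comp (faceIncl n i)) 1

/-- The boundary operator. -/
def bdryOp (n : ℕ) (Y : Type) [TopologicalSpace Y] : Chain (n + 1) Y →ₗ[ℤ] Chain n Y :=
  Finsupp.linearCombination ℤ (simplexBdry n)

/-- The chain map induced by a continuous map. -/
def push (n : ℕ) (f : C(Y, Z)) : Chain n Y →ₗ[ℤ] Chain n Z :=
  Finsupp.lmapDomain ℤ ℤ fun σ => f.comp σ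

@[simp] theorem bdryOp_single (n : ℕ) (σ : C(Simp (n + 1), Y)) :
    bdryOp n Y (Finsupp.single σ 1) = simplexBdry n σ := by
  simp [bdryOp]

@[simp] theorem push_single (n : ℕ) (f : C(Y, Z)) (σ : C(Simp n, Y)) (a : ℤ) :
    push n f (Finsupp.single σ a) = Finsupp.single (f.comp σ) a := by
  simp [push, Finsupp.lmapDomain_apply, Finsupp.mapDomain_single]

theorem linearCombination_single_one {R α M : Type*} [Semiring R] [AddCommMonoid M] [Module R M]
    (v : α → M) (a : α) : Finsupp.linearCombination R v (Finsupp.single a 1) = v a := by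
  simp

theorem chain_ext {n : ℕ} {M : Type*} [AddCommGroup M] [Module ℤ M] {F G : Chain n Y →ₗ[ℤ] M}
    (h : ∀ σ, F (Finsupp.single σ 1) = G (Finsupp.single σ 1)) : F = G :=
  Finsupp.lhom_ext' fun σ => LinearMap.ext_ring (h σ)

theorem bdryOp_push (n : ℕ) (f : C(Y, Z)) (c : Chain (n + 1) Y) :
    bdryOp n Z (push (n + 1) f c) = push n f (bdryOp n Y c) := by
  have : (bdryOp n Z).comp (push (n + 1) f) = (push n f).comp (bdryOp n Y) := by
    refine chain_ext fun σ => ?_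
    simp only [LinearMap.comp_apply, push_single, bdryOp_single, simplexBdry, map_sum, map_zsmul]
    rfl
  exact LinearMap.congr_fun this c

theorem push_push (n : ℕ) (g : C(Y, Z)) (f : C(X, Y)) (c : Chain n X) :
    push n g (push n f c) = push n (g.comp f) c := by
  have : (push n g).comp (push n f) = push n (g.comp f) := by
    refine chain_ext fun σ => ?_
    simp only [LinearMap.comp_apply, push_single]
    rfl
  exact LinearMap.congr_fun this c

/-- A singular simplex as a simplex of the singular simplicial set. -/
def toSing (n : ℕ) (σ : C(Simp n, Y)) :
    (TopCat.toSSet.obj (TopCat.of Y)).obj (Opposite.op (SimplexCategory.mk n)) :=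
  ((TopCat.of Y).toSSetObjEquiv (Opposite.op (SimplexCategory.mk n))).symm σ

theorem toSing_surjective (n : ℕ) : Function.Surjective (toSing (Y := Y) n) :=
  ((TopCat.of Y).toSSetObjEquiv (Opposite.op (SimplexCategory.mk n))).symm.surjective

theorem toSing_face (n : ℕ) (σ : C(Simp (n + 1), Y)) (i : Fin (n + 2)) :
    SimplicialObject.δ (TopCat.toSSet.obj (TopCat.of Y)) i (toSing (n + 1) σ)
      = toSing n (σ.comp (faceIncl n i)) := by
  rfl

/-- Concrete chains as elements of Mathlib's singular chain complex. -/
def toComplex (n : ℕ) (Y : Type) [TopologicalSpace Y] :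
    Chain n Y →ₗ[ℤ] ((TopCat.toSSet.obj (TopCat.of Y)).chainComplex (ModuleCat.of ℤ ℤ)).X n :=
  Finsupp.linearCombination ℤ fun σ =>
    ((TopCat.toSSet.obj (TopCat.of Y)).ιChainComplex (R := ModuleCat.of ℤ ℤ) (toSing n σ)).hom
      (1 : ℤ)

theorem toComplex_single (n : ℕ) (σ : C(Simp n, Y)) :
    toComplex n Y (Finsupp.single σ 1) =
    ((TopCat.toSSet.obj (TopCat.of Y)).ιChainComplex (R := ModuleCat.of ℤ ℤ) (toSing n σ)).hom
      (1 : ℤ) := by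
  exact linearCombination_single_one _ _

/-- It is enough that `toComplex` is a chain map compatible with `push` and with evaluation of
cochains: concrete cycles only have to be carried into the abstract complex, never back. -/
theorem toComplex_bdryOp (n : ℕ) (c : Chain (n + 1) Y) :
    toComplex n Y (bdryOp n Y c) =
      (((TopCat.toSSet.obj (TopCat.of Y)).chainComplex (ModuleCat.of ℤ ℤ)).d (n + 1) n).hom
        (toComplex (n + 1) Y c) := by
  have : (toComplex n Y).comp (bdryOp n Y) =
      (((TopCat.toSSet.obj (TopCat.of Y)).chainComplex (ModuleCat.of ℤ ℤ)).d (n + 1) n).hom.comp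
        (toComplex (n + 1) Y) := by
    refine chain_ext (Y := Y) (M := ((TopCat.toSSet.obj (TopCat.of Y)).chainComplex
      (ModuleCat.of ℤ ℤ)).X n) fun σ => ?_
    have h := congrArg (fun q => q.hom (1 : ℤ))
      (SSet.ιChainComplex_d (TopCat.toSSet.obj (TopCat.of Y)) (ModuleCat.of ℤ ℤ) (toSing (n + 1) σ))
    simp only [LinearMap.comp_apply, bdryOp_single, simplexBdry, map_sum, map_zsmul,
      toComplex_single]
    refine Eq.trans ?_ h.symm
    simp only [ModuleCat.hom_sum, LinearMap.sum_apply, ModuleCat.hom_zsmul, toSing_face]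
    rfl
  exact LinearMap.congr_fun this c

theorem toComplex_push (n : ℕ) (f : C(Y, Z)) (c : Chain n Y) :
    toComplex n Z (push n f c) =
      ((SSet.chainComplexMap (TopCat.toSSet.map (TopCat.ofHom f)) (ModuleCat.of ℤ ℤ)).f n).hom
        (toComplex n Y c) := by
  have : (toComplex n Z).comp (push n f) =
      ((SSet.chainComplexMap (TopCat.toSSet.map (TopCat.ofHom f)) (ModuleCat.of ℤ ℤ)).f n).hom.comp
        (toComplex n Y) := by
    refine chain_ext (Y := Y) (M := ((TopCat.toSSet.obj (TopCat.of Z)).chainComplex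
      (ModuleCat.of ℤ ℤ)).X n) fun σ => ?_
    have h := congrArg (fun q => ModuleCat.Hom.hom q (1 : ℤ))
      (SSet.ι_chainComplexMap_f _ _ (TopCat.toSSet.map (TopCat.ofHom f)) (ModuleCat.of ℤ ℤ)
        (toSing n σ))
    simp only [LinearMap.comp_apply, push_single, toComplex_single]
    exact h.symm
  exact LinearMap.congr_fun this c

/-- A real singular cochain. -/
abbrev Cochain (n : ℕ) (Y : Type) [TopologicalSpace Y] : Type := C(Simp n, Y) → ℝ

/-- Evaluation of a cochain on chains. -/
def evalCochain {n : ℕ} (ψ : Cochain n Y) : Chain n Y →ₗ[ℤ] ℝ := Finsupp.linearCombination ℤ ψ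

@[simp] theorem evalCochain_single {n : ℕ} (ψ : Cochain n Y) (σ : C(Simp n, Y)) :
    evalCochain ψ (Finsupp.single σ 1) = ψ σ := by
  simp [evalCochain]

theorem evalCochain_push {n : ℕ} (ψ : Cochain n Z) (f : C(Y, Z)) (c : Chain n Y) :
    evalCochain ψ (push n f c) = evalCochain (fun σ => ψ (f.comp σ)) c := by
  have : (evalCochain ψ).comp (push n f) = evalCochain (fun σ => ψ (f.comp σ)) := by
    refine chain_ext fun σ => ?_
    simp
  exact LinearMap.congr_fun this c

/-- A real cochain as a morphism out of Mathlib's singular chains. -/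
def cochainHom {n : ℕ} (ψ : Cochain n Y) :
    ((TopCat.toSSet.obj (TopCat.of Y)).chainComplex (ModuleCat.of ℤ ℤ)).X n ⟶ ModuleCat.of ℤ ℝ :=
  Limits.Cofan.IsColimit.desc
    ((TopCat.toSSet.obj (TopCat.of Y)).isColimitChainComplexXCofan (ModuleCat.of ℤ ℤ) n)
    fun x => ModuleCat.ofHom (LinearMap.toSpanSingleton ℤ ℝ
      (ψ ((TopCat.of Y).toSSetObjEquiv (Opposite.op (SimplexCategory.mk n)) x)))

theorem cochainHom_toComplex {n : ℕ} (ψ : Cochain n Y) (c : Chain n Y) :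
    (cochainHom ψ).hom (toComplex n Y c) = evalCochain ψ c := by
  have : (cochainHom ψ).hom.comp (toComplex n Y) = evalCochain ψ := by
    refine chain_ext fun σ => ?_
    have h := congrArg (fun q => q.hom (1 : ℤ)) (Limits.Cofan.IsColimit.fac
      ((TopCat.toSSet.obj (TopCat.of Y)).isColimitChainComplexXCofan (ModuleCat.of ℤ ℤ) n)
      (fun x => ModuleCat.ofHom (LinearMap.toSpanSingleton ℤ ℝ
        (ψ ((TopCat.of Y).toSSetObjEquiv (Opposite.op (SimplexCategory.mk n)) x)))) (toSing n σ))
    simp only [LinearMap.comp_apply, evalCochain_single, toComplex_single]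
    refine h.trans ?_
    simp only [ModuleCat.hom_ofHom, LinearMap.toSpanSingleton_apply, one_smul]
    exact congrArg ψ (Equiv.apply_symm_apply _ _)
  exact LinearMap.congr_fun this c

/-- A map is nonzero on the third homology if some real cocycle on the target does not vanish on
the image of some cycle. -/
theorem nonzeroDegree_of_cocycle (f : C(Y, Z)) (z : Chain 3 Y) (hz : bdryOp 2 Y z = 0)
    (ψ : Cochain 3 Z) (hψ : ∀ τ : C(Simp 4, Z), evalCochain ψ (simplexBdry 3 τ) = 0)
    (h : evalCochain ψ (push 3 f z) ≠ 0) : NonzeroDegree f := by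
  intro hf
  apply h
  let KY := (TopCat.toSSet.obj (TopCat.of Y)).chainComplex (ModuleCat.of ℤ ℤ)
  let KZ := (TopCat.toSSet.obj (TopCat.of Z)).chainComplex (ModuleCat.of ℤ ℤ)
  let F : KY ⟶ KZ := SSet.chainComplexMap (TopCat.toSSet.map (TopCat.ofHom f)) (ModuleCat.of ℤ ℤ)
  have hF : HomologicalComplex.homologyMap F 3 = 0 := hf
  let k : ModuleCat.of ℤ ℤ ⟶ KY.X 3 :=
    ModuleCat.ofHom (LinearMap.toSpanSingleton ℤ _ (toComplex 3 Y z))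
  have hk : k ≫ KY.d 3 2 = 0 := by
    refine ModuleCat.hom_ext (LinearMap.ext_ring ?_)
    have := toComplex_bdryOp 2 z
    rw [hz, map_zero] at this
    refine Eq.trans ?_ this.symm
    exact congrArg (KY.d 3 2).hom (LinearMap.toSpanSingleton_apply_one _ _ _)
  have hd : KZ.d 4 3 ≫ cochainHom ψ = 0 := by
    refine SSet.chainComplex_hom_ext fun x => ?_
    obtain ⟨τ, rfl⟩ := toSing_surjective 4 x
    ext
    have h1 := toComplex_bdryOp 3 (Finsupp.single τ 1)
    rw [toComplex_single, bdryOp_single] at h1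
    have h2 := cochainHom_toComplex ψ (simplexBdry 3 τ)
    rw [hψ, h1] at h2
    exact h2
  -- Evaluating ψ on the image of z factors as class of z, induced map on H₃, then ψ on chains
  -- modulo boundaries; the factor in the middle is zero by assumption.
  have key : KY.liftCycles k 2 (by simp) hk ≫ KY.homologyπ 3 ≫ HomologicalComplex.homologyMap F 3 ≫
      KZ.homologyι 3 ≫ KZ.descOpcycles (cochainHom ψ) 4 (by simp) hd = k ≫ F.f 3 ≫ cochainHom ψ := by
    rw [HomologicalComplex.homologyπ_naturality_assoc, HomologicalComplex.homology_π_ι_assoc]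
    simp
  rw [hF] at key
  simp only [Limits.zero_comp, Limits.comp_zero] at key
  have h3 := congrArg (fun q => q.hom (1 : ℤ)) key
  rw [← cochainHom_toComplex, toComplex_push]
  refine Eq.trans ?_ h3.symm
  exact congrArg (fun q => (cochainHom ψ).hom ((F.f 3).hom q)) (LinearMap.toSpanSingleton_apply_one ℤ (KY.X 3) _).symm

end GraphMfd
end

noncomputable section

namespace GraphMfd

/-! ### Affine singular simplices in convex sets -/

section Affine

variable {X Y Z : Type} [TopologicalSpace X] [TopologicalSpace Y] [TopologicalSpace Z]
variable {E E' : Type*} [NormedAddCommGroup E] [NormedSpace ℝ E] [NormedAddCommGroup E']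
  [NormedSpace ℝ E'] {K : Set E} {K' : Set E'} {n : ℕ}

/-- The point of a convex set with given barycentric coordinates. -/
def comb (hK : Convex ℝ K) (v : Fin (n + 1) → K) (p : Simp n) : K :=
  ⟨∑ i, p i • (v i : E), hK.sum_mem (fun i _ => p.2.1 i) p.2.2 fun i _ => (v i).2⟩

theorem coe_comb (hK : Convex ℝ K) (v : Fin (n + 1) → K) (p : Simp n) :
    (comb hK v p : E) = ∑ i, p i • (v i : E) := rfl

theorem continuous_comb (hK : Convex ℝ K) (v : Fin (n + 1) → K) : Continuous (comb hK v) := by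
  refine Continuous.subtype_mk (continuous_finsetSum _ fun i _ => ?_) _
  exact ((continuous_apply i).comp continuous_subtype_val).smul continuous_const

/-- The singular simplex obtained by restricting a map on a convex set to the affine simplex with
given vertices. -/
def aff (hK : Convex ℝ K) (Φ : C(K, Y)) (v : Fin (n + 1) → K) : C(Simp n, Y) :=
  Φ.comp ⟨comb hK v, continuous_comb hK v⟩

theorem aff_apply (hK : Convex ℝ K) (Φ : C(K, Y)) (v : Fin (n + 1) → K) (p : Simp n) :
    aff hK Φ v p = Φ (comb hK v p) := rfl

theorem comp_aff (hK : Convex ℝ K) (Φ : C(K, Y)) (v : Fin (n + 1) → K) (g : C(Y, Z)) :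
    g.comp (aff hK Φ v) = aff hK (g.comp Φ) v := rfl

theorem aff_face (hK : Convex ℝ K) (Φ : C(K, Y)) (v : Fin (n + 2) → K) (i : Fin (n + 2)) :
    (aff hK Φ v).comp (faceIncl n i) = aff hK Φ (v ∘ i.succAbove) := by
  ext p
  change Φ _ = Φ _
  congr 1
  apply Subtype.ext
  simp only [coe_comb, faceIncl, ContinuousMap.coe_mk, stdSimplex.map_coe, Function.comp]
  rw [Fin.sum_univ_succAbove _ i]
  simp [FunOnFinite.linearMap_apply_apply, Finset.sum_filter]

/-- Maps that preserve affine combinations. -/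
def PreservesComb (hK' : Convex ℝ K') (hK : Convex ℝ K) (L : K' → K) : Prop :=
  ∀ (m : ℕ) (v : Fin (m + 1) → K') (p : Simp m), L (comb hK' v p) = comb hK (L ∘ v) p

/-- Used for lattice translations and integral linear maps of the plane: they carry affine simplices
to affine simplices, so the relations in the torus are equalities of singular simplices, not merely
homologies. -/
theorem aff_reparam (hK' : Convex ℝ K') (hK : Convex ℝ K) {L : K' → K}
    (hL : PreservesComb hK' hK L) {Φ' : C(K', Y)} {Φ : C(K, Y)} (h : ∀ x, Φ' x = Φ (L x))
    (v : Fin (n + 1) → K') : aff hK' Φ' v = aff hK Φ (L ∘ v) := by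
  ext p
  rw [aff_apply, aff_apply, h, hL]

theorem PreservesComb.of_linearMap (hK' : Convex ℝ K') (hK : Convex ℝ K) {L : K' → K}
    (l : E' →ₗ[ℝ] E) (b : E) (hl : ∀ x : K', (L x : E) = l x + b) : PreservesComb hK' hK L := by
  intro m v p
  apply Subtype.ext
  rw [hl, coe_comb, coe_comb, map_sum]
  have hp : ∑ i, p i = 1 := p.2.2
  simp only [Function.comp, hl, smul_add, Finset.sum_add_distrib, map_smul, ← Finset.sum_smul, hp,
    one_smul]

theorem simplexBdry_one (σ : C(Simp 2, Y)) :
    simplexBdry 1 σ = Finsupp.single (σ.comp (faceIncl 1 0)) 1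
      - Finsupp.single (σ.comp (faceIncl 1 1)) 1 + Finsupp.single (σ.comp (faceIncl 1 2)) 1 := by
  refine (Fin.sum_univ_three _).trans ?_
  simp [sub_eq_add_neg]

theorem simplexBdry_two (σ : C(Simp 3, Y)) :
    simplexBdry 2 σ = Finsupp.single (σ.comp (faceIncl 2 0)) 1
      - Finsupp.single (σ.comp (faceIncl 2 1)) 1 + Finsupp.single (σ.comp (faceIncl 2 2)) 1
      - Finsupp.single (σ.comp (faceIncl 2 3)) 1 := by
  refine (Fin.sum_univ_four _).trans ?_
  simp [sub_eq_add_neg, Odd.neg_one_pow (show Odd 3 by decide)]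

theorem vec_three_comp_succAbove {α : Type*} (a b c : α) :
    ![a, b, c] ∘ (0 : Fin 3).succAbove = ![b, c] ∧
    ![a, b, c] ∘ (1 : Fin 3).succAbove = ![a, c] ∧
    ![a, b, c] ∘ (2 : Fin 3).succAbove = ![a, b] := by
  refine ⟨?_, ?_, ?_⟩ <;> (ext i; fin_cases i <;> rfl)

theorem vec_four_comp_succAbove {α : Type*} (a b c d : α) :
    ![a, b, c, d] ∘ (0 : Fin 4).succAbove = ![b, c, d] ∧
    ![a, b, c, d] ∘ (1 : Fin 4).succAbove = ![a, c, d] ∧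
    ![a, b, c, d] ∘ (2 : Fin 4).succAbove = ![a, b, d] ∧
    ![a, b, c, d] ∘ (3 : Fin 4).succAbove = ![a, b, c] := by
  refine ⟨?_, ?_, ?_, ?_⟩ <;> (ext i; fin_cases i <;> rfl)

theorem simplexBdry_aff_one (hK : Convex ℝ K) (Φ : C(K, Y)) (x y z : K) :
    simplexBdry 1 (aff hK Φ ![x, y, z]) = Finsupp.single (aff hK Φ ![y, z]) 1
      - Finsupp.single (aff hK Φ ![x, z]) 1 + Finsupp.single (aff hK Φ ![x, y]) 1 := by
  obtain ⟨h0, h1, h2⟩ := vec_three_comp_succAbove x y z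
  rw [simplexBdry_one, aff_face, aff_face, aff_face, h0, h1, h2]

theorem simplexBdry_aff_two (hK : Convex ℝ K) (Φ : C(K, Y)) (x y z w : K) :
    simplexBdry 2 (aff hK Φ ![x, y, z, w]) = Finsupp.single (aff hK Φ ![y, z, w]) 1
      - Finsupp.single (aff hK Φ ![x, z, w]) 1 + Finsupp.single (aff hK Φ ![x, y, w]) 1
      - Finsupp.single (aff hK Φ ![x, y, z]) 1 := by
  obtain ⟨h0, h1, h2, h3⟩ := vec_four_comp_succAbove x y z w
  rw [simplexBdry_two, aff_face, aff_face, aff_face, aff_face, h0, h1, h2, h3]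

/-! ### The prism operator -/

/-- The prism over the standard simplex, infinitely extended in the vertical direction. -/
def prismSet (n : ℕ) : Set ((Fin (n + 1) → ℝ) × ℝ) := stdSimplex ℝ (Fin (n + 1)) ×ˢ Set.univ

theorem prismSet_convex (n : ℕ) : Convex ℝ (prismSet n) :=
  (convex_stdSimplex ℝ _).prod convex_univ

/-- The point of the prism over a point of the simplex. -/
def prismPt {n : ℕ} (p : Simp n) (s : ℝ) : prismSet n := ⟨(p, s), p.2, trivial⟩

/-- The vertex of the prism over a vertex of the simplex, at a given height. -/
def prismVertex {n : ℕ} (i : Fin (n + 1)) (s : ℝ) : prismSet n := prismPt (stdSimplex.vertex i) s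

/-- The map on the prism over a singular simplex given by a homotopy. -/
def prismMap (H : C(Y × ℝ, Z)) {n : ℕ} (σ : C(Simp n, Y)) : C(prismSet n, Z) :=
  ⟨fun q => H (σ ⟨q.1.1, q.2.1⟩, q.1.2), by fun_prop⟩

theorem prismMap_pt (H : C(Y × ℝ, Z)) (σ : C(Simp n, Y)) (p : Simp n) (s : ℝ) :
    prismMap H σ (prismPt p s) = H (σ p, s) := rfl

theorem comb_prismVertex {m n : ℕ} (f : Fin (m + 1) → Fin (n + 1)) (t : Fin (m + 1) → ℝ)
    (p : Simp m) : comb (prismSet_convex n) (fun i => prismVertex (f i) (t i)) p =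
      prismPt (stdSimplex.map f p) (∑ i, p i * t i) := by
  apply Subtype.ext
  rw [coe_comb]
  refine Prod.ext ?_ ?_
  · simp only [Prod.fst_sum, prismVertex, prismPt, Prod.smul_fst]
    ext j
    simp [FunOnFinite.linearMap_apply_apply, Finset.sum_filter, Pi.single_apply, eq_comm]
  · simp [Prod.snd_sum, prismVertex, prismPt]

/-- The affine simplex with the given vertices in the prism over a singular simplex. -/
def prismSimplex (H : C(Y × ℝ, Z)) {m n : ℕ} (σ : C(Simp n, Y)) (f : Fin (m + 1) → Fin (n + 1))
    (t : Fin (m + 1) → ℝ) : C(Simp m, Z) :=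
  aff (prismSet_convex n) (prismMap H σ) fun i => prismVertex (f i) (t i)

theorem prismSimplex_apply (H : C(Y × ℝ, Z)) {m n : ℕ} (σ : C(Simp n, Y))
    (f : Fin (m + 1) → Fin (n + 1)) (t : Fin (m + 1) → ℝ) (p : Simp m) :
    prismSimplex H σ f t p = H (σ (stdSimplex.map f p), ∑ i, p i * t i) := by
  rw [prismSimplex, aff_apply, comb_prismVertex, prismMap_pt]

theorem prismSimplex_face (H : C(Y × ℝ, Z)) {m n : ℕ} (σ : C(Simp (n + 1), Y)) (i : Fin (n + 2))
    (f : Fin (m + 1) → Fin (n + 1)) (t : Fin (m + 1) → ℝ) :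
    prismSimplex H (σ.comp (faceIncl n i)) f t = prismSimplex H σ (i.succAbove ∘ f) t := by
  ext p
  simp only [prismSimplex_apply]
  simp [faceIncl, stdSimplex.map_comp_apply]

theorem prismSimplex_const (H : C(Y × ℝ, Z)) (σ : C(Simp n, Y)) (s : ℝ) :
    prismSimplex H σ id (fun _ => s) = (H.comp ⟨fun y => (y, s), by fun_prop⟩).comp σ := by
  ext p
  rw [prismSimplex_apply, ← Finset.sum_mul, show ∑ i, p i = 1 from p.2.2]
  simp

/-- The prism operator on one-chains. -/
def prismOne (H : C(Y × ℝ, Z)) : Chain 1 Y →ₗ[ℤ] Chain 2 Z :=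
  Finsupp.linearCombination ℤ fun σ =>
    Finsupp.single (prismSimplex H σ ![0, 0, 1] ![0, 1, 1]) 1
      - Finsupp.single (prismSimplex H σ ![0, 1, 1] ![0, 0, 1]) 1

/-- The prism operator on two-chains. -/
def prismTwo (H : C(Y × ℝ, Z)) : Chain 2 Y →ₗ[ℤ] Chain 3 Z :=
  Finsupp.linearCombination ℤ fun σ =>
    Finsupp.single (prismSimplex H σ ![0, 0, 1, 2] ![0, 1, 1, 1]) 1
      - Finsupp.single (prismSimplex H σ ![0, 1, 1, 2] ![0, 0, 1, 1]) 1
      + Finsupp.single (prismSimplex H σ ![0, 1, 2, 2] ![0, 0, 0, 1]) 1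

theorem prismSimplex_sub_face (H : C(Y × ℝ, Z)) {m n : ℕ} (σ : C(Simp n, Y))
    (f : Fin (m + 2) → Fin (n + 1)) (t : Fin (m + 2) → ℝ) (i : Fin (m + 2)) :
    (prismSimplex H σ f t).comp (faceIncl m i) =
      prismSimplex H σ (f ∘ i.succAbove) (t ∘ i.succAbove) :=
  aff_face _ _ _ _

theorem simplexBdry_prismSimplex (H : C(Y × ℝ, Z)) {n : ℕ} (σ : C(Simp n, Y))
    (a b c d : Fin (n + 1)) (s t u w : ℝ) :
    simplexBdry 2 (prismSimplex H σ ![a, b, c, d] ![s, t, u, w]) =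
      Finsupp.single (prismSimplex H σ ![b, c, d] ![t, u, w]) 1
      - Finsupp.single (prismSimplex H σ ![a, c, d] ![s, u, w]) 1
      + Finsupp.single (prismSimplex H σ ![a, b, d] ![s, t, w]) 1
      - Finsupp.single (prismSimplex H σ ![a, b, c] ![s, t, u]) 1 := by
  obtain ⟨h0, h1, h2, h3⟩ := vec_four_comp_succAbove a b c d
  obtain ⟨k0, k1, k2, k3⟩ := vec_four_comp_succAbove s t u w
  rw [simplexBdry_two, prismSimplex_sub_face, prismSimplex_sub_face, prismSimplex_sub_face,
    prismSimplex_sub_face, h0, h1, h2, h3, k0, k1, k2, k3]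

/-- The three tetrahedra triangulate the prism over a triangle. Their common faces cancel, the top
and bottom remain, and the lateral faces form the prism over the boundary. -/
theorem bdryOp_prismTwo (H : C(Y × ℝ, Z)) (c : Chain 2 Y) :
    bdryOp 2 Z (prismTwo H c) + prismOne H (bdryOp 1 Y c) =
      push 2 (H.comp ⟨fun y => (y, 1), by fun_prop⟩) c
        - push 2 (H.comp ⟨fun y => (y, 0), by fun_prop⟩) c := by
  have : (bdryOp 2 Z).comp (prismTwo H) + (prismOne H).comp (bdryOp 1 Y) =
      push 2 (H.comp ⟨fun y => (y, 1), by fun_prop⟩)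
        - push 2 (H.comp ⟨fun y => (y, 0), by fun_prop⟩) := by
    refine chain_ext fun σ => ?_
    have hs : (0 : Fin 3).succAbove ∘ ![0, 0, 1] = ![1, 1, 2] ∧
        (0 : Fin 3).succAbove ∘ ![0, 1, 1] = ![1, 2, 2] ∧
        (1 : Fin 3).succAbove ∘ ![0, 0, 1] = ![0, 0, 2] ∧
        (1 : Fin 3).succAbove ∘ ![0, 1, 1] = ![0, 2, 2] ∧
        (2 : Fin 3).succAbove ∘ ![0, 0, 1] = ![0, 0, 1] ∧
        (2 : Fin 3).succAbove ∘ ![0, 1, 1] = ![0, 1, 1] := by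
      refine ⟨?_, ?_, ?_, ?_, ?_, ?_⟩ <;> (ext i; fin_cases i <;> rfl)
    have e1 := prismSimplex_const H σ 1
    have e0 := prismSimplex_const H σ 0
    rw [show (id : Fin 3 → Fin 3) = ![0, 1, 2] by ext i; fin_cases i <;> rfl] at e0 e1
    rw [show (fun _ : Fin 3 => (1 : ℝ)) = ![1, 1, 1] by ext i; fin_cases i <;> rfl] at e1
    rw [show (fun _ : Fin 3 => (0 : ℝ)) = ![0, 0, 0] by ext i; fin_cases i <;> rfl] at e0
    obtain ⟨a0, a1, a2, a3, a4, a5⟩ := hs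
    simp only [LinearMap.add_apply, LinearMap.comp_apply, LinearMap.sub_apply, push_single,
      ← e0, ← e1, bdryOp_single, prismTwo, linearCombination_single_one, map_add, map_sub,
      simplexBdry_one, simplexBdry_prismSimplex,
      prismOne, prismSimplex_face, a0, a1, a2, a3, a4, a5]
    abel
  exact LinearMap.congr_fun this c

theorem push_prismOne (H : C(Y × ℝ, Z)) {W : Type} [TopologicalSpace W] (G : C(X × ℝ, W))
    (f : C(X, Y)) (g : C(W, Z)) (h : ∀ x s, H (f x, s) = g (G (x, s))) (c : Chain 1 X) :
    prismOne H (push 1 f c) = push 2 g (prismOne G c) := by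
  have : (prismOne H).comp (push 1 f) = (push 2 g).comp (prismOne G) := by
    refine chain_ext fun σ => ?_
    have : ∀ (f' : Fin 3 → Fin 2) t, prismSimplex H (f.comp σ) f' t =
        g.comp (prismSimplex G σ f' t) := by
      intro f' t
      ext p
      simp [prismSimplex_apply, h]
    simp only [LinearMap.comp_apply, push_single, prismOne, linearCombination_single_one, map_sub,
      this]
  exact LinearMap.congr_fun this c

end Affine
end GraphMfd
end

noncomputable section

namespace GraphMfd

/-! ### Paths modulo boundaries of two-chains -/

section Segments

variable {X Y Z : Type} [TopologicalSpace X] [TopologicalSpace Y] [TopologicalSpace Z]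
variable {E E' : Type*} [NormedAddCommGroup E] [NormedSpace ℝ E] [NormedAddCommGroup E']
  [NormedSpace ℝ E'] {K : Set E} {K' : Set E'} {n : ℕ}

/-- Chains modulo boundaries. -/
abbrev ChainMod (n : ℕ) (Y : Type) [TopologicalSpace Y] : Type :=
  Chain n Y ⧸ LinearMap.range (bdryOp n Y)

/-- The class of a chain modulo boundaries. -/
def cls (n : ℕ) (Y : Type) [TopologicalSpace Y] : Chain n Y →ₗ[ℤ] ChainMod n Y :=
  (LinearMap.range (bdryOp n Y)).mkQ

theorem cls_eq_zero_iff {c : Chain n Y} : cls n Y c = 0 ↔ ∃ b, bdryOp n Y b = c := by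
  simp [cls]

theorem cls_simplexBdry (σ : C(Simp (n + 1), Y)) : cls n Y (simplexBdry n σ) = 0 :=
  cls_eq_zero_iff.2 ⟨Finsupp.single σ 1, bdryOp_single n σ⟩

/-- The class of the singular segment obtained by restricting a map on a convex set. -/
def seg (hK : Convex ℝ K) (Φ : C(K, Y)) (x y : K) : ChainMod 1 Y :=
  cls 1 Y (Finsupp.single (aff hK Φ ![x, y]) 1)

/-- The affine triangle x, y, z lies in the convex set and bounds the difference. Hence a closed
polygon in a convex set is zero modulo boundaries. -/
theorem seg_add (hK : Convex ℝ K) (Φ : C(K, Y)) (x y z : K) :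
    seg hK Φ x y + seg hK Φ y z = seg hK Φ x z := by
  have h := cls_simplexBdry (aff hK Φ ![x, y, z])
  rw [simplexBdry_aff_one, map_add, map_sub] at h
  simp only [seg]
  rw [sub_add_eq_add_sub, sub_eq_zero] at h
  rw [add_comm, h]

@[simp] theorem seg_self (hK : Convex ℝ K) (Φ : C(K, Y)) (x : K) : seg hK Φ x x = 0 := by
  have := seg_add hK Φ x x x
  simpa using this

theorem seg_symm (hK : Convex ℝ K) (Φ : C(K, Y)) (x y : K) : seg hK Φ y x = -seg hK Φ x y := by
  have := seg_add hK Φ x y x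
  rw [seg_self] at this
  exact (neg_eq_of_add_eq_zero_right this).symm

theorem coe_comb_pair (hK : Convex ℝ K) (x y : K) (p : Simp 1) :
    (comb hK ![x, y] p : E) = (1 - p 1) • (x : E) + p 1 • (y : E) := by
  have hp : p 0 + p 1 = 1 := by
    have := p.2.2
    rwa [Fin.sum_univ_two] at this
  rw [coe_comb, Fin.sum_univ_two, ← hp]
  simp

theorem seg_congr (hK' : Convex ℝ K') (hK : Convex ℝ K) {Φ' : C(K', Y)} {Φ : C(K, Y)}
    {x' y' : K'} {x y : K}
    (h : ∀ p : Simp 1, Φ' (comb hK' ![x', y'] p) = Φ (comb hK ![x, y] p)) :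
    seg hK' Φ' x' y' = seg hK Φ x y := by
  rw [seg, seg]
  congr 2
  ext p
  exact h p

theorem seg_eq_zero (hK : Convex ℝ K) {Φ : C(K, Y)} {x y : K}
    (h : ∀ p : Simp 1, Φ (comb hK ![x, y] p) = Φ x) : seg hK Φ x y = 0 := by
  rw [← seg_self hK Φ x]
  refine seg_congr hK hK fun p => ?_
  rw [h]
  congr 1
  apply Subtype.ext
  rw [coe_comb_pair, ← add_smul]
  simp

/-- The unit square. -/
def unitSquare : Set (ℝ × ℝ) := Set.Icc 0 1 ×ˢ Set.Icc 0 1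

theorem unitSquare_convex : Convex ℝ unitSquare := (convex_Icc 0 1).prod (convex_Icc 0 1)

theorem Simp.coord_mem_Icc (p : Simp n) (i : Fin (n + 1)) : p i ∈ Set.Icc (0 : ℝ) 1 :=
  ⟨p.2.1 i, stdSimplex.le_one p i⟩

/-- The straight-line homotopy from the curve to its chord is a map on the unit square that is
constant on the two vertical sides. Going from one corner to the opposite one either way round gives
the two classes. -/
theorem seg_curve (hK' : Convex ℝ K') (hK : Convex ℝ K) (Φ : C(K, Y)) (α : C(K', K)) (x y : K') :
    seg hK' (Φ.comp α) x y = seg hK Φ (α x) (α y) := by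
  let A : unitSquare → K' := fun q => ⟨(1 - q.1.1) • (x : E') + q.1.1 • (y : E'),
    hK' x.2 y.2 (by linarith [q.2.1.2]) q.2.1.1 (by ring)⟩
  let B : unitSquare → K := fun q => ⟨(1 - q.1.1) • (α x : E) + q.1.1 • (α y : E),
    hK (α x).2 (α y).2 (by linarith [q.2.1.2]) q.2.1.1 (by ring)⟩
  have hA : Continuous A := by
    refine Continuous.subtype_mk ?_ _
    fun_prop
  let Γ : C(unitSquare, K) := ⟨fun q => ⟨(1 - q.1.2) • (α (A q) : E) + q.1.2 • (B q : E),
    hK (α (A q)).2 (B q).2 (by linarith [q.2.2.2]) q.2.2.1 (by ring)⟩, by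
      refine Continuous.subtype_mk ?_ _
      have h1 : Continuous fun q => (α (A q) : E) :=
        continuous_subtype_val.comp (α.continuous.comp hA)
      have h2 : Continuous fun q => (B q : E) := by
        simp only [B]
        fun_prop
      fun_prop⟩
  let v : (a b : Set.Icc (0 : ℝ) 1) → unitSquare := fun a b => ⟨(a, b), a.2, b.2⟩
  have h1 := seg_add unitSquare_convex (Φ.comp Γ) (v 0 0) (v 1 0) (v 1 1)
  have h2 := seg_add unitSquare_convex (Φ.comp Γ) (v 0 0) (v 0 1) (v 1 1)
  have e1 : seg unitSquare_convex (Φ.comp Γ) (v 0 0) (v 1 0) = seg hK' (Φ.comp α) x y := by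
    refine seg_congr _ _ fun p => ?_
    have : Γ (comb unitSquare_convex ![v 0 0, v 1 0] p) = α (comb hK' ![x, y] p) := by
      have hA' : A (comb unitSquare_convex ![v 0 0, v 1 0] p) = comb hK' ![x, y] p := by
        apply Subtype.ext
        simp only [A, coe_comb_pair]
        simp [v]
      apply Subtype.ext
      simp only [Γ, ContinuousMap.coe_mk, hA']
      simp [coe_comb_pair, v]
    exact congrArg Φ this
  have e2 : seg unitSquare_convex (Φ.comp Γ) (v 0 1) (v 1 1) = seg hK Φ (α x) (α y) := by
    refine seg_congr _ _ fun p => ?_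
    refine congrArg Φ (Subtype.ext ?_)
    simp [Γ, B, coe_comb_pair, v]
  have e3 : seg unitSquare_convex (Φ.comp Γ) (v 0 0) (v 0 1) = 0 := by
    refine seg_eq_zero _ fun p => congrArg Φ (Subtype.ext ?_)
    have hA' : A (comb unitSquare_convex ![v 0 0, v 0 1] p) = x := by
      apply Subtype.ext
      simp only [A, coe_comb_pair]
      simp [v]
    have hA'' : A (v 0 0) = x := Subtype.ext (by simp [A, v])
    simp only [Γ, ContinuousMap.coe_mk, hA', hA'']
    simp [B, coe_comb_pair, v, ← add_smul]
  have e4 : seg unitSquare_convex (Φ.comp Γ) (v 1 0) (v 1 1) = 0 := by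
    refine seg_eq_zero _ fun p => congrArg Φ (Subtype.ext ?_)
    have hA' : A (comb unitSquare_convex ![v 1 0, v 1 1] p) = y := by
      apply Subtype.ext
      simp only [A, coe_comb_pair]
      simp [v]
    have hA'' : A (v 1 0) = y := Subtype.ext (by simp [A, v])
    simp only [Γ, ContinuousMap.coe_mk, hA', hA'']
    simp [B, coe_comb_pair, v, ← add_smul]
  rw [← e1, ← e2]
  rw [e4, add_zero] at h1
  rw [e3, zero_add] at h2
  rw [h1, h2]

end Segments
end GraphMfd
end

noncomputable section

namespace GraphMfd

/-! ### The fundamental cycle of the torus -/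

/-- The standard parametrization of the circle, of period one. -/
def circ (s : ℝ) : Circle := Circle.exp (2 * Real.pi * s)

@[fun_prop] theorem continuous_circ : Continuous circ := by
  unfold circ
  fun_prop

theorem circ_add (s t : ℝ) : circ (s + t) = circ s * circ t := by
  simp [circ, mul_add, Circle.exp_add]

@[simp] theorem circ_zero : circ 0 = 1 := by simp [circ]

@[simp] theorem circ_one : circ 1 = 1 := by simp [circ]

theorem circ_neg (s : ℝ) : circ (-s) = (circ s)⁻¹ := by simp [circ, Circle.exp_neg]

theorem circ_sub (s t : ℝ) : circ (s - t) = circ s * (circ t)⁻¹ := by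
  rw [sub_eq_add_neg, circ_add, circ_neg]

/-- `circ` as a homomorphism. -/
def circHom : Multiplicative ℝ →* Circle where
  toFun s := circ s.toAdd
  map_one' := circ_zero
  map_mul' _ _ := circ_add _ _

theorem circ_int_mul (n : ℤ) (s : ℝ) : circ (n * s) = circ s ^ n := by
  have := map_zpow circHom (Multiplicative.ofAdd s) n
  simpa [circHom, ← ofAdd_zsmul] using this

@[simp] theorem circ_int (n : ℤ) : circ n = 1 := by
  have := circ_int_mul n 1
  simpa using this

theorem circ_add_int (s : ℝ) (n : ℤ) : circ (s + n) = circ s := by simp [circ_add]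

theorem circ_eq_one_iff {s : ℝ} : circ s = 1 ↔ ∃ n : ℤ, s = n := by
  rw [circ, Circle.exp_eq_one]
  refine exists_congr fun n => ?_
  rw [mul_comm (n : ℝ), mul_right_inj' (by positivity)]

theorem circ_surjective : Function.Surjective circ := by
  intro z
  obtain ⟨t, rfl⟩ := Circle.exp_surjective z
  refine ⟨t / (2 * Real.pi), ?_⟩
  rw [circ]
  congr 1
  field_simp

/-- The plane as a convex set. -/
abbrev Plane : Type := ↥(Set.univ : Set (ℝ × ℝ))

/-- The universal covering of the torus. -/
def torusExp : C(Plane, Torus) :=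
  ⟨fun q => (circ q.1.1, circ q.1.2), by fun_prop⟩

/-- A lattice point. -/
def latticePt (x : ℤ × ℤ) : Plane := ⟨(x.1, x.2), trivial⟩

/-- The singular triangle in the torus with vertices `0`, `x`, `x + y`. -/
def torusTriangle (x y : ℤ × ℤ) : C(Simp 2, Torus) :=
  aff convex_univ torusExp ![latticePt 0, latticePt x, latticePt (x + y)]

/-- Translation by a lattice point is a deck transformation of the universal covering and is affine.
-/
theorem torusTriangle_translate (z x y : ℤ × ℤ) :
    aff convex_univ torusExp ![latticePt z, latticePt (z + x), latticePt (z + x + y)] =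
      torusTriangle x y := by
  let L : Plane → Plane :=
    fun q => ⟨q + (latticePt z : ℝ × ℝ), trivial⟩
  have hL : PreservesComb convex_univ convex_univ L :=
    .of_linearMap _ _ LinearMap.id (latticePt z : ℝ × ℝ) fun x => rfl
  symm
  rw [torusTriangle, aff_reparam convex_univ convex_univ hL (Φ := torusExp)]
  · congr 1
    ext i : 1
    apply Subtype.ext
    fin_cases i <;> simp [L, latticePt, add_comm, add_left_comm, Prod.mk_zero_zero]
  · intro x
    simp [torusExp, L, latticePt, circ_add_int]

/-- The class of the triangle `0`, `x`, `x + y` modulo boundaries. -/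
def bar (x y : ℤ × ℤ) : ChainMod 2 Torus := cls 2 Torus (Finsupp.single (torusTriangle x y) 1)

/-- This is the boundary of the tetrahedron 0, x, x + y, x + y + z. Thus `bar` is a two-cocycle of
the group ℤ² with values in chains modulo boundaries. -/
theorem bar_cocycle (x y z : ℤ × ℤ) :
    bar y z - bar (x + y) z + bar x (y + z) - bar x y = 0 := by
  have h := cls_simplexBdry (aff convex_univ torusExp
    ![latticePt 0, latticePt x, latticePt (x + y), latticePt (x + y + z)])
  rw [simplexBdry_aff_two, torusTriangle_translate] at h
  simpa only [map_add, map_sub, bar, torusTriangle, add_assoc] using h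

/-- The class of the parallelogram with sides `x` and `y`. -/
def parallelogram (x y : ℤ × ℤ) : ChainMod 2 Torus := bar x y - bar y x

/-- The antisymmetrization of a two-cocycle of an abelian group is bilinear: three instances of the
cocycle identity, for the three positions of z relative to x and y, combine to the claim. -/
theorem parallelogram_add_left (x y z : ℤ × ℤ) :
    parallelogram (x + y) z = parallelogram x z + parallelogram y z := by
  have h1 := bar_cocycle x y z
  have h2 := bar_cocycle x z y
  have h3 := bar_cocycle z x y
  rw [add_comm z y] at h2
  rw [add_comm z x] at h3
  simp only [parallelogram]
  rw [← sub_eq_zero]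
  have : bar y z - bar (x + y) z + bar x (y + z) - bar x y
      - (bar z y - bar (x + z) y + bar x (y + z) - bar x z)
      + (bar x y - bar (x + z) y + bar z (x + y) - bar z x) = 0 := by
    rw [h1, h2, h3]; simp
  rw [← neg_eq_zero, ← this]
  abel

theorem parallelogram_symm (x y : ℤ × ℤ) : parallelogram y x = -parallelogram x y := by
  simp [parallelogram]

theorem parallelogram_self (x : ℤ × ℤ) : parallelogram x x = 0 := by
  simp [parallelogram]

theorem parallelogram_left (p q : ℤ) (z : ℤ × ℤ) :
    parallelogram (p, q) z = p • parallelogram (1, 0) z + q • parallelogram (0, 1) z := by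
  let F : ℤ × ℤ →+ ChainMod 2 Torus :=
    AddMonoidHom.mk' (fun x => parallelogram x z) fun x y => parallelogram_add_left x y z
  have h : ((p, q) : ℤ × ℤ) = p • (1, 0) + q • (0, 1) := by simp
  change F (p, q) = p • F (1, 0) + q • F (0, 1)
  rw [h, map_add, map_zsmul, map_zsmul]

/-- An alternating bilinear map on ℤ² is its value on the basis times the determinant. -/
theorem parallelogram_eq (p q r s : ℤ) :
    parallelogram (p, q) (r, s) = (p * s - q * r) • parallelogram (1, 0) (0, 1) := by
  have h1 : parallelogram (1, 0) (r, s) = s • parallelogram (1, 0) (0, 1) := by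
    rw [parallelogram_symm (r, s), parallelogram_left, parallelogram_self,
      parallelogram_symm (1, 0) (0, 1)]
    module
  have h2 : parallelogram (0, 1) (r, s) = -(r • parallelogram (1, 0) (0, 1)) := by
    rw [parallelogram_symm (r, s), parallelogram_left, parallelogram_self (0, 1)]
    module
  rw [parallelogram_left, h1, h2]
  module

variable {Y : Type} [TopologicalSpace Y]

/-- The homotopy that runs once around the circle factor. -/
def crossCircle (Y : Type) [TopologicalSpace Y] : C(Y × ℝ, Y × Circle) :=
  ⟨fun q => (q.1, circ q.2), by fun_prop⟩

/-- The loop that runs once around the circle. -/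
def stdLoop : C(Simp 1, Circle) :=
  ⟨fun p => circ (p 1), continuous_circ.comp ((continuous_apply 1).comp continuous_subtype_val)⟩

/-- The fundamental cycle of the torus. -/
def torusChain : Chain 2 Torus := prismOne (crossCircle Circle) (Finsupp.single stdLoop 1)

theorem torusChain_eq : torusChain = Finsupp.single (torusTriangle (0, 1) (1, 0)) 1
    - Finsupp.single (torusTriangle (1, 0) (0, 1)) 1 := by
  rw [torusChain, prismOne, linearCombination_single_one]
  congr 2
  all_goals
    ext p : 1
    rw [prismSimplex_apply]
    refine Prod.ext ?_ ?_ <;>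
    simp [crossCircle, stdLoop, torusTriangle, aff_apply, torusExp, coe_comb, Fin.sum_univ_three,
      latticePt, FunOnFinite.linearMap_apply_apply, Finset.sum_filter]

theorem push_linearMap_torusTriangle (A : Matrix (Fin 2) (Fin 2) ℤ) (x y : ℤ × ℤ) :
    (linearMap A).comp (torusTriangle x y) = torusTriangle
      (A 0 0 * x.1 + A 0 1 * x.2, A 1 0 * x.1 + A 1 1 * x.2)
      (A 0 0 * y.1 + A 0 1 * y.2, A 1 0 * y.1 + A 1 1 * y.2) := by
  let l : ℝ × ℝ →ₗ[ℝ] ℝ × ℝ :=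
    ((A 0 0 : ℝ) • LinearMap.fst ℝ ℝ ℝ + (A 0 1 : ℝ) • LinearMap.snd ℝ ℝ ℝ).prod
      ((A 1 0 : ℝ) • LinearMap.fst ℝ ℝ ℝ + (A 1 1 : ℝ) • LinearMap.snd ℝ ℝ ℝ)
  let L : Plane → Plane := fun q => ⟨l q, trivial⟩
  have hL : PreservesComb convex_univ convex_univ L :=
    .of_linearMap _ _ l 0 fun x => (add_zero _).symm
  rw [torusTriangle, comp_aff, aff_reparam convex_univ convex_univ hL (Φ := torusExp)]
  · rw [torusTriangle]
    congr 1
    ext i : 1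
    apply Subtype.ext
    fin_cases i <;> (simp [L, l, latticePt] <;> constructor <;> ring)
  · intro x
    simp [torusExp, L, l, linearMap, circ_add, circ_int_mul]

theorem bdryOp_torusChain : bdryOp 1 Torus torusChain = 0 := by
  rw [torusChain_eq, map_sub, bdryOp_single, bdryOp_single, torusTriangle, torusTriangle,
    simplexBdry_aff_one, simplexBdry_aff_one]
  have h : ∀ z x : ℤ × ℤ, aff convex_univ torusExp ![latticePt z, latticePt (z + x)] =
      aff convex_univ torusExp ![latticePt 0, latticePt x] := by
    intro z x
    let L : Plane → Plane :=
      fun q => ⟨q + (latticePt z : ℝ × ℝ), trivial⟩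
    have hL : PreservesComb convex_univ convex_univ L :=
      .of_linearMap _ _ LinearMap.id (latticePt z : ℝ × ℝ) fun x => rfl
    symm
    rw [aff_reparam convex_univ convex_univ hL (Φ := torusExp)]
    · congr 1
      ext i : 1
      apply Subtype.ext
      fin_cases i <;> simp [L, latticePt, add_comm]
    · intro x
      simp [torusExp, L, latticePt, circ_add_int]
  rw [h, h, add_comm ((0, 1) : ℤ × ℤ)]
  abel

/-- Scaling the angles by s ∈ [0, 1] is a homotopy from the linear map to φ, and the prism over a
cycle bounds the difference of its ends. The linear map multiplies the class of a parallelogram by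
det A = -1. -/
theorem push_homeo_torusChain (φ : C(Torus, Torus)) (A : Matrix (Fin 2) (Fin 2) ℤ)
    (hA : A.det = -1) (η₁ η₂ : C(Torus, ℝ))
    (hφ : ∀ y, φ y = ((linearMap A y).1 * circ (η₁ y), (linearMap A y).2 * circ (η₂ y))) :
    ∃ b : Chain 3 Torus, bdryOp 2 Torus b = push 2 φ torusChain + torusChain := by
  rw [← cls_eq_zero_iff, map_add]
  let H : C(Torus × ℝ, Torus) := ⟨fun q => ((linearMap A q.1).1 * circ (q.2 * η₁ q.1),
    (linearMap A q.1).2 * circ (q.2 * η₂ q.1)), by fun_prop⟩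
  have h := bdryOp_prismTwo H torusChain
  rw [bdryOp_torusChain, map_zero, add_zero] at h
  have h1 : H.comp ⟨fun y => (y, 1), by fun_prop⟩ = φ := by
    ext y : 1
    simp [H, hφ]
  have h0 : H.comp ⟨fun y => (y, 0), by fun_prop⟩ = linearMap A := by
    ext y : 1
    simp [H]
  rw [h1, h0] at h
  have h2 : cls 2 Torus (push 2 φ torusChain) = cls 2 Torus (push 2 (linearMap A) torusChain) := by
    rw [← sub_eq_zero, ← map_sub, cls_eq_zero_iff]
    exact ⟨_, h⟩
  have h3 : cls 2 Torus torusChain = parallelogram (0, 1) (1, 0) := by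
    rw [torusChain_eq, map_sub]
    rfl
  rw [h2, h3, torusChain_eq, map_sub, push_single, push_single, push_linearMap_torusTriangle,
    push_linearMap_torusTriangle, map_sub]
  change parallelogram _ _ + _ = 0
  rw [Matrix.det_fin_two] at hA
  rw [parallelogram_eq, parallelogram_symm (1, 0) (0, 1)]
  simp only [mul_zero, mul_one, zero_add, add_zero]
  rw [show A 0 1 * A 1 0 - A 1 1 * A 0 0 = 1 by linarith]
  simp

end GraphMfd
end

noncomputable section

namespace GraphMfd

/-! ### The relative fundamental chain of a surface -/

/-- The real line as a convex set. -/
abbrev Line : Type := ↥(Set.univ : Set ℝ)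

/-- A real number as a point of the line. -/
abbrev linePt (x : ℝ) : Line := ⟨x, trivial⟩

/-- A pair of real numbers as a point of the plane. -/
abbrev planePt (x y : ℝ) : Plane := ⟨(x, y), trivial⟩

theorem comb_linePt (x y : ℝ) (p : Simp 1) :
    comb convex_univ ![linePt x, linePt y] p = linePt ((1 - p 1) * x + p 1 * y) :=
  Subtype.ext (coe_comb_pair _ _ _ _)

theorem comb_planePt (x y x' y' : ℝ) (p : Simp 1) :
    comb convex_univ ![planePt x y, planePt x' y'] p =
      planePt ((1 - p 1) * x + p 1 * x') ((1 - p 1) * y + p 1 * y') :=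
  Subtype.ext (coe_comb_pair _ _ _ _)

section

variable {Y : Type} [TopologicalSpace Y]

/-- The class of an arc of a curve. -/
def arc (γ : C(ℝ, Y)) (x y : ℝ) : ChainMod 1 Y :=
  seg convex_univ (γ.comp ⟨Subtype.val, continuous_subtype_val⟩ : C(Line, Y)) (linePt x) (linePt y)

theorem arc_add (γ : C(ℝ, Y)) (x y z : ℝ) : arc γ x y + arc γ y z = arc γ x z := seg_add _ _ _ _ _

theorem arc_symm (γ : C(ℝ, Y)) (x y : ℝ) : arc γ y x = -arc γ x y := seg_symm _ _ _ _

theorem arc_congr {γ γ' : C(ℝ, Y)} {x y x' y' : ℝ}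
    (h : ∀ t ∈ Set.Icc (0 : ℝ) 1, γ' ((1 - t) * x' + t * y') = γ ((1 - t) * x + t * y)) :
    arc γ' x' y' = arc γ x y := by
  refine seg_congr _ _ fun p => ?_
  rw [comb_linePt, comb_linePt]
  exact h _ (p.coord_mem_Icc 1)

/-- The class of an affine segment in a map on the plane. -/
def planeSeg (Φ : C(Plane, Y)) (x y x' y' : ℝ) : ChainMod 1 Y :=
  seg convex_univ Φ (planePt x y) (planePt x' y')

theorem arc_eq_planeSeg (γ : C(ℝ, Y)) (Φ : C(Plane, Y)) (α : C(ℝ, ℝ)) (s x y : ℝ)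
    (h : ∀ t ∈ Set.Icc (0 : ℝ) 1,
      γ ((1 - t) * x + t * y) = Φ (planePt (α ((1 - t) * x + t * y)) s)) :
    arc γ x y = planeSeg Φ (α x) s (α y) s := by
  let β : C(Line, Plane) := ⟨fun u => planePt (α u) s, by fun_prop⟩
  have := seg_curve convex_univ convex_univ Φ β (linePt x) (linePt y)
  refine Eq.trans ?_ this
  refine seg_congr _ _ fun p => ?_
  rw [comb_linePt]
  exact h _ (p.coord_mem_Icc 1)

end

/-- The real number that gives the centre of a hole. -/
def holeAbscissa (d : ℕ) (j : Fin d) : ℝ := (2 * (j : ℝ) + 1 - d) / (2 * d)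

theorem holeCenter_eq (d : ℕ) (j : Fin d) : holeCenter d j = (holeAbscissa d j : ℂ) := rfl

theorem abs_holeAbscissa_add_le (d : ℕ) (j : Fin d) : |holeAbscissa d j| + holeRadius d ≤ 1 / 2 := by
  have := norm_holeCenter_add_le d j
  rwa [holeCenter_eq, Complex.norm_real, Real.norm_eq_abs] at this

theorem dist_holeAbscissa (d : ℕ) {i j : Fin d} (h : i ≠ j) :
    4 * holeRadius d ≤ |holeAbscissa d i - holeAbscissa d j| := by
  have := dist_holeCenter d h
  rwa [holeCenter_eq, holeCenter_eq, ← Complex.ofReal_sub, Complex.norm_real,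
    Real.norm_eq_abs] at this

/-- The height of the upper half circles about the holes over the real axis. -/
def holeHeight (d : ℕ) (x : ℝ) : ℝ := ∑ j, √(holeRadius d ^ 2 - (x - holeAbscissa d j) ^ 2)

theorem continuous_holeHeight (d : ℕ) : Continuous (holeHeight d) := by
  unfold holeHeight
  fun_prop

theorem holeHeight_nonneg (d : ℕ) (x : ℝ) : 0 ≤ holeHeight d x :=
  Finset.sum_nonneg fun _ _ => Real.sqrt_nonneg _

theorem sqrt_le_holeHeight (d : ℕ) (x : ℝ) (j : Fin d) :
    √(holeRadius d ^ 2 - (x - holeAbscissa d j) ^ 2) ≤ holeHeight d x :=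
  Finset.single_le_sum (f := fun j => √(holeRadius d ^ 2 - (x - holeAbscissa d j) ^ 2))
    (fun _ _ => Real.sqrt_nonneg _) (Finset.mem_univ j)

theorem sqrt_hole_eq_zero {d : ℕ} {x : ℝ} {j : Fin d} (h : holeRadius d ≤ |x - holeAbscissa d j|) :
    √(holeRadius d ^ 2 - (x - holeAbscissa d j) ^ 2) = 0 := by
  rw [Real.sqrt_eq_zero_of_nonpos]
  have := pow_le_pow_left₀ (holeRadius_nonneg d) h 2
  rw [sq_abs] at this
  linarith

theorem holeHeight_eq_zero {d : ℕ} {x : ℝ} (h : ∀ j, holeRadius d ≤ |x - holeAbscissa d j|) :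
    holeHeight d x = 0 :=
  Finset.sum_eq_zero fun j _ => sqrt_hole_eq_zero (h j)

theorem le_abs_sub_of_ne {d : ℕ} {x : ℝ} {j : Fin d} (h : |x - holeAbscissa d j| ≤ 2 * holeRadius d)
    {i : Fin d} (hi : i ≠ j) : holeRadius d ≤ |x - holeAbscissa d i| := by
  have h1 := dist_holeAbscissa d hi
  have h2 := abs_sub_le (holeAbscissa d i) x (holeAbscissa d j)
  rw [abs_sub_comm (holeAbscissa d i) x] at h2
  have h3 := holeRadius_nonneg d
  linarith

/-- The holes are so far apart that at most one summand is nonzero over any point. -/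
theorem holeHeight_eq {d : ℕ} {x : ℝ} {j : Fin d} (h : |x - holeAbscissa d j| ≤ 2 * holeRadius d) :
    holeHeight d x = √(holeRadius d ^ 2 - (x - holeAbscissa d j) ^ 2) :=
  Finset.sum_eq_single j (fun _ _ hi => sqrt_hole_eq_zero (le_abs_sub_of_ne h hi)) (by simp)

theorem sq_add_holeHeight_sq_le (d : ℕ) {x : ℝ} (hx : x ^ 2 ≤ 1) : x ^ 2 + holeHeight d x ^ 2 ≤ 1 := by
  by_cases h : ∀ j, holeRadius d ≤ |x - holeAbscissa d j|
  · rw [holeHeight_eq_zero h]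
    simpa using hx
  · push Not at h
    obtain ⟨j, hj⟩ := h
    have h0 := holeRadius_nonneg d
    rw [holeHeight_eq (by linarith : |x - holeAbscissa d j| ≤ 2 * holeRadius d), Real.sq_sqrt]
    · have h1 := abs_holeAbscissa_add_le d j
      have h2 : holeAbscissa d j * (x - holeAbscissa d j) ≤ |holeAbscissa d j| * holeRadius d := by
        refine (le_abs_self _).trans ?_
        rw [abs_mul]
        gcongr
      have h3 := sq_abs (holeAbscissa d j)
      have h4 := abs_nonneg (holeAbscissa d j)
      nlinarith
    · have := pow_le_pow_left₀ (abs_nonneg _) hj.le 2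
      rw [sq_abs] at this
      linarith

/-- Truncation to the interval `[-1, 1]`. -/
def clampOne (x : ℝ) : ℝ := max (-1) (min 1 x)

theorem clampOne_sq_le (x : ℝ) : clampOne x ^ 2 ≤ 1 := by
  have h1 : -1 ≤ clampOne x := le_max_left _ _
  have h2 : clampOne x ≤ 1 := max_le (by norm_num) (min_le_left _ _)
  nlinarith

theorem clampOne_of_mem {x : ℝ} (h1 : -1 ≤ x) (h2 : x ≤ 1) : clampOne x = x := by
  rw [clampOne, min_eq_right h2, max_eq_right h1]

/-- The ordinate of the point with parameters `(x, s)` of the upper half of the holed disc. -/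
def halfOrdinate (d : ℕ) (q : ℝ × ℝ) : ℝ :=
  max (holeHeight d (clampOne q.1)) (clampOne q.2 * √(1 - clampOne q.1 ^ 2))

theorem sq_add_halfOrdinate_sq_le (d : ℕ) (q : ℝ × ℝ) :
    clampOne q.1 ^ 2 + halfOrdinate d q ^ 2 ≤ 1 := by
  have h := clampOne_sq_le q.1
  rcases max_choice (holeHeight d (clampOne q.1)) (clampOne q.2 * √(1 - clampOne q.1 ^ 2)) with h1 | h1
  · rw [halfOrdinate, h1]
    exact sq_add_holeHeight_sq_le d h
  · rw [halfOrdinate, h1, mul_pow, Real.sq_sqrt (by linarith)]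
    nlinarith [clampOne_sq_le q.2]

theorem continuous_halfOrdinate (d : ℕ) : Continuous (halfOrdinate d) := by
  have := continuous_holeHeight d
  have h : Continuous clampOne := by unfold clampOne; fun_prop
  unfold halfOrdinate
  fun_prop

/-- Parametrization of the upper (`ε = 1`) and lower (`ε = -1`) half of the holed disc. -/
def halfMap (d : ℕ) (ε : ℤˣ) : C(Plane, HoledDisc d) :=
  ⟨fun q => ⟨⟨clampOne q.1.1, ((ε : ℤ) : ℝ) * halfOrdinate d q.1⟩, by
    have hε : (((ε : ℤ) : ℝ)) ^ 2 = 1 := by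
      rcases Int.units_eq_one_or ε with rfl | rfl <;> norm_num
    have h := sq_add_halfOrdinate_sq_le d q.1
    constructor
    · rw [← sq_le_one_iff₀ (norm_nonneg _), Complex.sq_norm, Complex.normSq_mk]
      nlinarith
    · intro j
      rw [← sq_le_sq₀ (holeRadius_nonneg d) (norm_nonneg _), Complex.sq_norm, holeCenter_eq,
        Complex.normSq_apply]
      simp only [Complex.sub_re, Complex.sub_im, Complex.ofReal_re, Complex.ofReal_im, sub_zero]
      have h1 : √(holeRadius d ^ 2 - (clampOne q.1.1 - holeAbscissa d j) ^ 2) ≤ halfOrdinate d q.1 :=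
        (sqrt_le_holeHeight d _ j).trans (le_max_left _ _)
      have h2 : holeRadius d ^ 2 - (clampOne q.1.1 - holeAbscissa d j) ^ 2 ≤ halfOrdinate d q.1 ^ 2 :=
        (Real.sqrt_le_left ((holeHeight_nonneg d _).trans (le_max_left _ _))).1 h1
      rw [← sq, ← sq, mul_pow, hε]
      linarith⟩, by
    refine Continuous.subtype_mk ?_ _
    have := continuous_halfOrdinate d
    have h : Continuous clampOne := by unfold clampOne; fun_prop
    have h2 : Continuous fun q : Plane =>
      ((clampOne q.1.1 : ℝ) : ℂ) + (((ε : ℤ) : ℝ) * halfOrdinate d q.1 : ℝ) * Complex.I := by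
      fun_prop
    convert h2 using 2 with q
    apply Complex.ext <;> simp⟩

theorem coe_halfMap (d : ℕ) (ε : ℤˣ) (q : Plane) : (halfMap d ε q).1 =
    ⟨clampOne q.1.1, ((ε : ℤ) : ℝ) * halfOrdinate d q.1⟩ := rfl

theorem continuous_rim (d : ℕ) (j : Fin d) : Continuous (rim d j) := by
  refine Continuous.subtype_mk ?_ _
  fun_prop

/-- The boundary circle of a hole as a continuous map. -/
def rimMap (d : ℕ) (j : Fin d) : C(Circle, HoledDisc d) := ⟨rim d j, continuous_rim d j⟩

theorem continuous_outer (d n : ℕ) : Continuous (outer d n) := by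
  refine Continuous.subtype_mk ?_ _
  fun_prop

/-- The outer circle as a curve. -/
def outerMap (d n : ℕ) : C(ℝ, HoledDisc d) := ⟨outer d n, continuous_outer d n⟩

/-- The quotient map onto the surface. -/
def surfaceMk (g d : ℕ) : C(HoledDisc d, Surface g d) := ⟨Quot.mk _, continuous_quot_mk⟩

/-- The boundary circle of the surface as a continuous map. -/
def bdryMap (g d : ℕ) (j : Fin d) : C(Circle, Surface g d) := (surfaceMk g d).comp (rimMap d j)

theorem coe_circ (x : ℝ) : (circ x : ℂ) = ⟨Real.cos (2 * Real.pi * x), Real.sin (2 * Real.pi * x)⟩ := by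
  rw [circ, Circle.coe_exp]
  apply Complex.ext
  · rw [Complex.exp_ofReal_mul_I_re]
  · rw [Complex.exp_ofReal_mul_I_im]

theorem sin_two_pi_nonneg {x : ℝ} (h0 : 0 ≤ x) (h1 : x ≤ 1 / 2) : 0 ≤ Real.sin (2 * Real.pi * x) :=
  Real.sin_nonneg_of_nonneg_of_le_pi (by positivity) (by nlinarith [Real.pi_pos])

/-- The level s = 1 of a half is its outer semicircle, because the holes stay below it and the
maximum in `halfOrdinate` is √(1 - x²). -/
theorem outer_eq_halfMap (d : ℕ) (ε : ℤˣ) (x : ℝ) (h : 0 ≤ ((ε : ℤ) : ℝ) * Real.sin (2 * Real.pi * x)) :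
    outer d 1 x = halfMap d ε (planePt (Real.cos (2 * Real.pi * x)) 1) := by
  apply Subtype.ext
  have h1 : ((outer d 1 x).1 : ℂ) = circ x := by simp [outer, circ]
  have hε : (((ε : ℤ) : ℝ)) ^ 2 = 1 := by
    rcases Int.units_eq_one_or ε with rfl | rfl <;> norm_num
  have hc : clampOne (Real.cos (2 * Real.pi * x)) = Real.cos (2 * Real.pi * x) :=
    clampOne_of_mem (Real.neg_one_le_cos _) (Real.cos_le_one _)
  have h3 : √(1 - Real.cos (2 * Real.pi * x) ^ 2) = ((ε : ℤ) : ℝ) * Real.sin (2 * Real.pi * x) := by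
    rw [← Real.sin_sq, ← Real.sqrt_sq h, mul_pow, hε, one_mul]
  rw [h1, coe_circ, coe_halfMap]
  apply Complex.ext
  · exact hc.symm
  · simp only [halfOrdinate, hc, clampOne_of_mem (by norm_num : (-1 : ℝ) ≤ 1) le_rfl, one_mul, h3]
    rw [max_eq_right]
    · rw [← mul_assoc, ← sq, hε, one_mul]
    · rw [← h3]
      apply Real.le_sqrt_of_sq_le
      linarith [sq_add_holeHeight_sq_le d (Real.cos_sq_le_one (2 * Real.pi * x))]

/-- The level s = 0 follows the real axis and passes around each hole along a semicircle. The rim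
runs clockwise, so the parameters with nonpositive sine belong to the upper half. -/
theorem rim_eq_halfMap (d : ℕ) (ε : ℤˣ) (j : Fin d) (x : ℝ)
    (h : 0 ≤ -(((ε : ℤ) : ℝ) * Real.sin (2 * Real.pi * x))) :
    rim d j (circ x) = halfMap d ε
      (planePt (holeAbscissa d j + holeRadius d * Real.cos (2 * Real.pi * x)) 0) := by
  apply Subtype.ext
  have hr := holeRadius_nonneg d
  have hε : (((ε : ℤ) : ℝ)) ^ 2 = 1 := by
    rcases Int.units_eq_one_or ε with rfl | rfl <;> norm_num
  have h1 : ((rim d j (circ x)).1 : ℂ) = holeAbscissa d j + holeRadius d * (circ (-x) : ℂ) := by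
    simp [rim, circ_neg, holeCenter_eq]
  set c := Real.cos (2 * Real.pi * x) with hcdef
  have hc1 : |c| ≤ 1 := Real.abs_cos_le_one _
  have hc2 : |holeRadius d * c| ≤ holeRadius d := by
    rw [abs_mul, abs_of_nonneg hr]
    exact mul_le_of_le_one_right hr hc1
  have hb := abs_holeAbscissa_add_le d j
  have hc : clampOne (holeAbscissa d j + holeRadius d * c) = holeAbscissa d j + holeRadius d * c := by
    have := abs_le.1 ((abs_add_le (holeAbscissa d j) (holeRadius d * c)).trans (by linarith) :
      |holeAbscissa d j + holeRadius d * c| ≤ 1)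
    exact clampOne_of_mem this.1 this.2
  have h3 : √(holeRadius d ^ 2 - (holeRadius d * c) ^ 2) =
      holeRadius d * -(((ε : ℤ) : ℝ) * Real.sin (2 * Real.pi * x)) := by
    rw [← Real.sqrt_sq (mul_nonneg hr h)]
    congr 1
    have := Real.sin_sq_add_cos_sq (2 * Real.pi * x)
    rw [← hcdef] at this
    rw [mul_pow, mul_pow, neg_sq, mul_pow, hε]
    linear_combination (-holeRadius d ^ 2) * this
  rw [h1, coe_circ, coe_halfMap]
  apply Complex.ext
  · simpa using hc.symm
  · simp only [halfOrdinate, hc, clampOne_of_mem (by norm_num : (-1 : ℝ) ≤ 0) zero_le_one, zero_mul]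
    rw [max_eq_left (holeHeight_nonneg d _), holeHeight_eq (j := j), add_sub_cancel_left, h3]
    · simp only [Complex.add_im, Complex.ofReal_im, Complex.mul_im, Complex.ofReal_re, mul_neg,
        Real.sin_neg]
      linear_combination (holeRadius d * Real.sin (2 * Real.pi * x)) * hε
    · rw [add_sub_cancel_left]
      linarith

theorem planeSeg_add {Y : Type} [TopologicalSpace Y] (Φ : C(Plane, Y)) (x y x' y' x'' y'' : ℝ) :
    planeSeg Φ x y x' y' + planeSeg Φ x' y' x'' y'' = planeSeg Φ x y x'' y'' := seg_add _ _ _ _ _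

theorem planeSeg_symm {Y : Type} [TopologicalSpace Y] (Φ : C(Plane, Y)) (x y x' y' : ℝ) :
    planeSeg Φ x' y' x y = -planeSeg Φ x y x' y' := seg_symm _ _ _ _

section

variable {Y : Type} [TopologicalSpace Y] {d : ℕ} (f : C(HoledDisc d, Y))

theorem arc_outer_upper : arc (f.comp (outerMap d 1)) 0 (1 / 2) =
    planeSeg (f.comp (halfMap d 1)) 1 1 (-1) 1 := by
  rw [arc_eq_planeSeg _ (f.comp (halfMap d 1)) ⟨fun x => Real.cos (2 * Real.pi * x), by fun_prop⟩ 1]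
  · congr 1
    · simp
    · simp [show 2 * Real.pi * 2⁻¹ = Real.pi by ring]
  · intro t ht
    refine congrArg f (outer_eq_halfMap d 1 _ ?_)
    have := sin_two_pi_nonneg (x := (1 - t) * 0 + t * (1 / 2)) (by linarith [ht.1]) (by linarith [ht.2])
    simpa using this

theorem arc_outer_lower : arc (f.comp (outerMap d 1)) (-(1 / 2)) 0 =
    planeSeg (f.comp (halfMap d (-1))) (-1) 1 1 1 := by
  rw [arc_eq_planeSeg _ (f.comp (halfMap d (-1)))
    ⟨fun x => Real.cos (2 * Real.pi * x), by fun_prop⟩ 1]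
  · congr 1
    · simp [show 2 * Real.pi * 2⁻¹ = Real.pi by ring]
    · simp
  · intro t ht
    refine congrArg f (outer_eq_halfMap d (-1) _ ?_)
    have := sin_two_pi_nonneg (x := -((1 - t) * -(1 / 2) + t * 0)) (by linarith [ht.2])
      (by linarith [ht.1])
    rw [mul_neg, Real.sin_neg] at this
    simpa using this

/-- The boundary circle of a hole as a curve. -/
def rimCurve (d : ℕ) (j : Fin d) : C(ℝ, HoledDisc d) := (rimMap d j).comp ⟨circ, continuous_circ⟩

theorem arc_rim_upper (j : Fin d) : arc (f.comp (rimCurve d j)) (-(1 / 2)) 0 =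
    planeSeg (f.comp (halfMap d 1)) (holeAbscissa d j - holeRadius d) 0
      (holeAbscissa d j + holeRadius d) 0 := by
  rw [arc_eq_planeSeg _ (f.comp (halfMap d 1))
    ⟨fun x => holeAbscissa d j + holeRadius d * Real.cos (2 * Real.pi * x), by fun_prop⟩ 0]
  · congr 1
    · simp [show 2 * Real.pi * 2⁻¹ = Real.pi by ring, sub_eq_add_neg]
    · simp
  · intro t ht
    refine congrArg f (rim_eq_halfMap d 1 j _ ?_)
    have := sin_two_pi_nonneg (x := -((1 - t) * -(1 / 2) + t * 0)) (by linarith [ht.2])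
      (by linarith [ht.1])
    rw [mul_neg, Real.sin_neg] at this
    simpa using this

theorem arc_rim_lower (j : Fin d) : arc (f.comp (rimCurve d j)) 0 (1 / 2) =
    planeSeg (f.comp (halfMap d (-1))) (holeAbscissa d j + holeRadius d) 0
      (holeAbscissa d j - holeRadius d) 0 := by
  rw [arc_eq_planeSeg _ (f.comp (halfMap d (-1)))
    ⟨fun x => holeAbscissa d j + holeRadius d * Real.cos (2 * Real.pi * x), by fun_prop⟩ 0]
  · congr 1
    · simp
    · simp [show 2 * Real.pi * 2⁻¹ = Real.pi by ring, sub_eq_add_neg]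
  · intro t ht
    refine congrArg f (rim_eq_halfMap d (-1) j _ ?_)
    have := sin_two_pi_nonneg (x := (1 - t) * 0 + t * (1 / 2)) (by linarith [ht.1]) (by linarith [ht.2])
    simpa using this

theorem arc_period {γ : C(ℝ, Y)} (h : ∀ x, γ (x + 1) = γ x) :
    arc γ 0 1 = arc γ (-(1 / 2)) 0 + arc γ 0 (1 / 2) := by
  rw [← arc_add γ 0 (1 / 2) 1, add_comm (arc γ (-(1 / 2)) 0)]
  congr 1
  refine arc_congr fun t _ => ?_
  rw [← h ((1 - t) * -(1 / 2) + t * 0)]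
  congr 1
  ring

/-- The difference of the two sides of a segment of the real axis. -/
def axisDiff (x y : ℝ) : ChainMod 1 Y :=
  planeSeg (f.comp (halfMap d 1)) x 0 y 0 - planeSeg (f.comp (halfMap d (-1))) x 0 y 0

theorem axisDiff_add (x y z : ℝ) : axisDiff f x y + axisDiff f y z = axisDiff f x z := by
  simp only [axisDiff, ← planeSeg_add _ x 0 y 0 z 0]
  abel

theorem arc_rim (j : Fin d) : arc (f.comp (rimCurve d j)) 0 1 =
    axisDiff f (holeAbscissa d j - holeRadius d) (holeAbscissa d j + holeRadius d) := by
  rw [arc_period, arc_rim_upper, arc_rim_lower,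
    planeSeg_symm (f.comp (halfMap d (-1))) (holeAbscissa d j - holeRadius d), axisDiff, ← sub_eq_add_neg]
  intro x
  simp [rimCurve, circ_add]

/-- Off the holes the level s = 0 of both halves is the real axis itself, so the two paths coincide.
-/
theorem axisDiff_eq_zero {x y : ℝ} (h : ∀ t ∈ Set.Icc (0 : ℝ) 1, -1 ≤ (1 - t) * x + t * y ∧
    (1 - t) * x + t * y ≤ 1 ∧ ∀ j, holeRadius d ≤ |(1 - t) * x + t * y - holeAbscissa d j|) :
    axisDiff f x y = 0 := by
  rw [axisDiff, sub_eq_zero]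
  refine seg_congr _ _ fun p => congrArg f (Subtype.ext ?_)
  obtain ⟨h1, h2, h3⟩ := h (p 1) (p.coord_mem_Icc 1)
  rw [comb_planePt, coe_halfMap, coe_halfMap]
  have : halfOrdinate d ((1 - p 1) * x + p 1 * y, 0) = 0 := by
    simp only [halfOrdinate, clampOne_of_mem h1 h2, holeHeight_eq_zero h3,
      clampOne_of_mem (by norm_num : (-1 : ℝ) ≤ 0) zero_le_one, zero_mul, max_self]
  simp [this]

theorem planeSeg_vertical (ε : ℤˣ) {x : ℝ} (hx : x ^ 2 = 1) :
    planeSeg (f.comp (halfMap d ε)) x 0 x 1 = 0 := by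
  refine seg_eq_zero _ fun p => congrArg f (Subtype.ext ?_)
  have h1 : clampOne x = x := by
    rcases mul_self_eq_one_iff.1 ((sq x).symm.trans hx) with rfl | rfl <;> norm_num [clampOne]
  rw [comb_planePt, coe_halfMap, coe_halfMap]
  have e : (1 - p 1) * x + p 1 * x = x := by ring
  simp [halfOrdinate, h1, hx, e]

/-- Each half is parametrized by a convex set, so its level s = 0 is homologous to its level s = 1;
the vertical sides at x = ±1 are collapsed to points. The difference of the two outer semicircles is
the outer circle run through clockwise. -/
theorem axisDiff_total : axisDiff f (-1) 1 = -arc (f.comp (outerMap d 1)) 0 1 := by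
  have h : ∀ ε : ℤˣ, planeSeg (f.comp (halfMap d ε)) (-1) 0 1 0 =
      planeSeg (f.comp (halfMap d ε)) (-1) 1 1 1 := by
    intro ε
    have h1 := planeSeg_add (f.comp (halfMap d ε)) (-1) 0 (-1) 1 1 1
    have h2 := planeSeg_add (f.comp (halfMap d ε)) (-1) 0 1 0 1 1
    rw [planeSeg_vertical f ε (by norm_num), zero_add] at h1
    rw [planeSeg_vertical f ε (by norm_num), add_zero] at h2
    rw [h1, h2]
  rw [arc_period, arc_outer_upper, arc_outer_lower, axisDiff, h, h, planeSeg_symm _ (-1) 1 1 1]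
  · abel
  · intro x
    refine congrArg f (Subtype.ext ?_)
    simp [outerMap, outer, mul_add, Circle.exp_add]

/-- Cut the holed disc along the real axis. The difference of the two sides of the axis is additive
in the interval, is the rim of the hole over an interval about one hole, and vanishes off the holes.
Over [-1, 1] it is minus the outer circle. -/
theorem sum_arc_rim (hd : 0 < d) :
    ∑ j, arc (f.comp (rimCurve d j)) 0 1 = -arc (f.comp (outerMap d 1)) 0 1 := by
  have hd' : (0 : ℝ) < d := by exact_mod_cast hd
  have hr : holeRadius d = 1 / (4 * d) := rfl
  have hr0 := holeRadius_nonneg d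
  -- The points `y j` and `y (j + 1)` lie at distance 2r to the left and right of the centre of hole
  -- `j`, as 4r = 1/d; so they separate neighbouring holes.
  let y : ℕ → ℝ := fun k => k / d - 1 / 2
  have hc : ∀ j : Fin d, holeAbscissa d j = y j + 2 * holeRadius d := by
    intro j
    simp only [holeAbscissa, y, hr]
    field_simp
    ring
  have hc' : ∀ j : Fin d, holeAbscissa d j = y (j + 1) - 2 * holeRadius d := by
    intro j
    simp only [holeAbscissa, y, hr]
    push_cast
    field_simp
    ring
  have hstep : ∀ j : Fin d, arc (f.comp (rimCurve d j)) 0 1 = axisDiff f (y j) (y (j + 1)) := by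
    intro j
    have hb := abs_holeAbscissa_add_le d j
    have hgap : ∀ u, holeRadius d ≤ |u - holeAbscissa d j| →
        |u - holeAbscissa d j| ≤ 2 * holeRadius d →
        -1 ≤ u ∧ u ≤ 1 ∧ ∀ i, holeRadius d ≤ |u - holeAbscissa d i| := by
      intro u h1 h2
      have h3 := abs_le.1 h2
      have h4 := abs_le.1 (show |holeAbscissa d j| ≤ 1 / 2 - holeRadius d by linarith)
      refine ⟨by linarith, by linarith, fun i => ?_⟩
      by_cases hi : i = j
      · rwa [hi]
      · exact le_abs_sub_of_ne h2 hi
    rw [arc_rim, ← axisDiff_add f (y j) (holeAbscissa d j + holeRadius d) (y (j + 1)),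
      ← axisDiff_add f (y j) (holeAbscissa d j - holeRadius d) (holeAbscissa d j + holeRadius d),
      axisDiff_eq_zero f (x := y j), axisDiff_eq_zero f (y := y (j + 1)), zero_add, add_zero]
    · intro t ht
      have e : (1 - t) * (holeAbscissa d j + holeRadius d) + t * y (j + 1) - holeAbscissa d j =
          (1 + t) * holeRadius d := by rw [hc']; ring
      apply hgap <;> rw [e, abs_of_nonneg (mul_nonneg (by linarith [ht.1]) hr0)] <;>
        nlinarith [ht.1, ht.2]
    · intro t ht
      have e : (1 - t) * y j + t * (holeAbscissa d j - holeRadius d) - holeAbscissa d j =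
          -((2 - t) * holeRadius d) := by rw [hc]; ring
      apply hgap <;> rw [e, abs_neg, abs_of_nonneg (mul_nonneg (by linarith [ht.2]) hr0)] <;>
        nlinarith [ht.1, ht.2]
  have hend : ∀ u, -1 ≤ u → u ≤ 1 → 1 / 2 ≤ |u| →
      -1 ≤ u ∧ u ≤ 1 ∧ ∀ i : Fin d, holeRadius d ≤ |u - holeAbscissa d i| := by
    intro u h1 h2 h3
    refine ⟨h1, h2, fun i => ?_⟩
    have := abs_holeAbscissa_add_le d i
    have := abs_sub_abs_le_abs_sub u (holeAbscissa d i)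
    linarith
  have htel : ∀ m : ℕ, ∑ k ∈ Finset.range m, axisDiff f (y k) (y (k + 1)) = axisDiff f (y 0) (y m) := by
    intro m
    induction m with
    | zero => simp [axisDiff, planeSeg]
    | succ m ih => rw [Finset.sum_range_succ, ih, axisDiff_add]
  rw [Finset.sum_congr rfl fun j _ => hstep j,
    Fin.sum_univ_eq_sum_range (fun k => axisDiff f (y k) (y (k + 1))) d, htel, ← axisDiff_total,
    ← axisDiff_add f (-1) (y d) 1, ← axisDiff_add f (-1) (y 0) (y d),
    axisDiff_eq_zero f (x := -1), axisDiff_eq_zero f (y := 1), zero_add, add_zero]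
  · intro t ht
    have e : (1 - t) * y d + t * 1 = (1 + t) / 2 := by
      simp only [y]; field_simp; ring
    rw [e]
    refine hend _ (by linarith [ht.1]) (by linarith [ht.2]) ?_
    rw [abs_of_nonneg] <;> linarith [ht.1]
  · intro t ht
    have e : (1 - t) * -1 + t * y 0 = -((2 - t) / 2) := by
      simp only [y]; push_cast; ring
    rw [e]
    refine hend _ (by linarith [ht.1]) (by linarith [ht.2]) ?_
    rw [abs_neg, abs_of_nonneg] <;> linarith [ht.2]

end

theorem surfaceMk_outer_eq {g d : ℕ} {x y : ℝ} {ε : Bool} (h : SidePair (.orientable g) x y ε) :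
    surfaceMk g d (outer d (SurfaceType.orientable g).sides x) =
      surfaceMk g d (outer d (SurfaceType.orientable g).sides y) :=
  Quot.sound ⟨x, y, ε, h, rfl, rfl⟩

/-- In the surface every side of the polygon coincides with its partner run through backwards, so
the sides cancel within each commutator and in the final pair. -/
theorem arc_outer_surface (g d : ℕ) :
    arc ((surfaceMk g d).comp (outerMap d 1)) 0 1 = 0 := by
  set n := (SurfaceType.orientable g).sides with hn
  have hn' : (n : ℝ) = 4 * g + 2 := by simp [hn, SurfaceType.sides]
  let γ := (surfaceMk g d).comp (outerMap d n)
  have hγ : ∀ {x y : ℝ} {ε : Bool}, SidePair (.orientable g) x y ε → γ x = γ y :=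
    fun h => surfaceMk_outer_eq h
  have h1 : arc ((surfaceMk g d).comp (outerMap d 1)) 0 1 = arc γ 0 n := by
    refine arc_congr fun t _ => congrArg (surfaceMk g d) (Subtype.ext ?_)
    have : (n : ℝ) ≠ 0 := by rw [hn']; positivity
    simp only [outerMap, outer, ContinuousMap.coe_mk]
    congr 2
    push_cast
    field_simp
    ring
  have hblock : ∀ m : Fin g, arc γ (4 * m) (4 * m + 4) = 0 := by
    intro m
    have ha : arc γ (4 * m) (4 * m + 1) = arc γ (4 * m + 3) (4 * m + 2) := by
      refine arc_congr fun t ht => ?_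
      have := hγ (.a g m t ht.1 ht.2)
      convert this using 2 <;> ring
    have hb : arc γ (4 * m + 1) (4 * m + 2) = arc γ (4 * m + 4) (4 * m + 3) := by
      refine arc_congr fun t ht => ?_
      have := hγ (.b g m t ht.1 ht.2)
      convert this using 2 <;> ring
    rw [← arc_add γ _ (4 * m + 1), ← arc_add γ (4 * m + 1) (4 * m + 2),
      ← arc_add γ (4 * m + 2) (4 * m + 3), ha, hb, arc_symm γ (4 * m + 2) (4 * m + 3),
      arc_symm γ (4 * m + 3) (4 * m + 4)]
    abel
  have hm : ∀ m : ℕ, m ≤ g → arc γ 0 (4 * m) = 0 := by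
    intro m
    induction m with
    | zero => intro _; simp [arc]
    | succ m ih =>
      intro h
      rw [← arc_add γ 0 (4 * m), ih (by omega), zero_add]
      have := hblock ⟨m, by omega⟩
      rw [show (4 : ℝ) * ((m + 1 : ℕ) : ℝ) = 4 * m + 4 by push_cast; ring]
      exact this
  have hc : arc γ (4 * g) (4 * g + 1) = arc γ (4 * g + 2) (4 * g + 1) := by
    refine arc_congr fun t ht => ?_
    have := hγ (.c g t ht.1 ht.2)
    convert this using 2 <;> ring
  rw [h1, hn', ← arc_add γ 0 (4 * g), hm g le_rfl, ← arc_add γ (4 * g) (4 * g + 1), hc,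
    arc_symm γ (4 * g + 1)]
  simp

/-- The boundary circles of a surface bound the surface. -/
theorem exists_surface_chain (g : ℕ) {d : ℕ} (hd : 0 < d) : ∃ c : Chain 2 (Surface g d),
    bdryOp 1 _ c = ∑ j, Finsupp.single ((bdryMap g d j).comp stdLoop) 1 := by
  rw [← cls_eq_zero_iff, map_sum]
  have h := sum_arc_rim (surfaceMk g d) hd
  rw [arc_outer_surface, neg_zero] at h
  rw [← h]
  refine Finset.sum_congr rfl fun j _ => ?_
  rw [arc, seg]
  congr 2
  ext p
  rw [aff_apply, comb_linePt]
  simp [bdryMap, stdLoop, rimCurve]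

end GraphMfd
end

noncomputable section

namespace GraphMfd

open Topology

/-! ### The Heisenberg nilmanifold -/

/-- The real Heisenberg group. -/
def Heis : Type := ℝ × ℝ × ℝ

namespace Heis

instance : TopologicalSpace Heis := inferInstanceAs (TopologicalSpace (ℝ × ℝ × ℝ))

/-- The element with given coordinates. -/
def mk (a b c : ℝ) : Heis := (a, b, c)

/-- First coordinate. -/
def a (h : Heis) : ℝ := h.1

/-- Second coordinate. -/
def b (h : Heis) : ℝ := h.2.1

/-- Third coordinate. -/
def c (h : Heis) : ℝ := h.2.2

@[simp] theorem a_mk (x y z : ℝ) : (mk x y z).a = x := rfl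
@[simp] theorem b_mk (x y z : ℝ) : (mk x y z).b = y := rfl
@[simp] theorem c_mk (x y z : ℝ) : (mk x y z).c = z := rfl

@[ext] theorem ext {g h : Heis} (ha : g.a = h.a) (hb : g.b = h.b) (hc : g.c = h.c) : g = h :=
  Prod.ext ha (Prod.ext hb hc)

@[fun_prop] theorem continuous_a : Continuous a := continuous_fst
@[fun_prop] theorem continuous_b : Continuous b := continuous_fst.comp continuous_snd
@[fun_prop] theorem continuous_c : Continuous c := continuous_snd.comp continuous_snd

@[fun_prop] theorem continuous_mk {Y : Type*} [TopologicalSpace Y] {f g k : Y → ℝ}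
    (hf : Continuous f) (hg : Continuous g) (hk : Continuous k) :
    Continuous fun y => mk (f y) (g y) (k y) :=
  hf.prodMk (hg.prodMk hk)

instance : One Heis := ⟨mk 0 0 0⟩
instance : Mul Heis := ⟨fun g h => mk (g.a + h.a) (g.b + h.b) (g.c + h.c + g.a * h.b)⟩
instance : Inv Heis := ⟨fun g => mk (-g.a) (-g.b) (-g.c + g.a * g.b)⟩

@[simp] theorem one_a : (1 : Heis).a = 0 := rfl
@[simp] theorem one_b : (1 : Heis).b = 0 := rfl
@[simp] theorem one_c : (1 : Heis).c = 0 := rfl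
@[simp] theorem mul_a (g h : Heis) : (g * h).a = g.a + h.a := rfl
@[simp] theorem mul_b (g h : Heis) : (g * h).b = g.b + h.b := rfl
@[simp] theorem mul_c (g h : Heis) : (g * h).c = g.c + h.c + g.a * h.b := rfl
@[simp] theorem inv_a (g : Heis) : (g⁻¹).a = -g.a := rfl
@[simp] theorem inv_b (g : Heis) : (g⁻¹).b = -g.b := rfl
@[simp] theorem inv_c (g : Heis) : (g⁻¹).c = -g.c + g.a * g.b := rfl

instance : Group Heis where
  mul_assoc x y z := by ext <;> simp <;> ring
  one_mul x := by ext <;> simp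
  mul_one x := by ext <;> simp
  inv_mul_cancel x := by ext <;> simp

instance : IsTopologicalGroup Heis where
  continuous_mul := by
    change Continuous fun p : Heis × Heis =>
      mk (p.1.a + p.2.a) (p.1.b + p.2.b) (p.1.c + p.2.c + p.1.a * p.2.b)
    fun_prop
  continuous_inv := by
    change Continuous fun g : Heis => mk (-g.a) (-g.b) (-g.c + g.a * g.b)
    fun_prop

/-- The integral lattice. -/
def lattice : Subgroup Heis where
  carrier := {h | ∃ m n k : ℤ, h = mk m n k}
  one_mem' := ⟨0, 0, 0, by ext <;> simp⟩
  mul_mem' := by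
    rintro _ _ ⟨m, n, k, rfl⟩ ⟨m', n', k', rfl⟩
    exact ⟨m + m', n + n', k + k' + m * n', by ext <;> simp⟩
  inv_mem' := by
    rintro _ ⟨m, n, k, rfl⟩
    exact ⟨-m, -n, -k + m * n, by ext <;> simp⟩

theorem lattice_isDiscrete : IsDiscrete (lattice : Set Heis) := by
  have h := Int.isClosedEmbedding_coe_real.isInducing
  have h2 := (IsDiscrete.univ (X := ℤ × ℤ × ℤ)).image (h.prodMap (h.prodMap h))
  have e : (lattice : Set Heis) =
      (fun q : ℤ × ℤ × ℤ => Heis.mk q.1 q.2.1 q.2.2) '' Set.univ := by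
    apply Set.ext
    intro x
    constructor
    · rintro ⟨m, n, k, rfl⟩
      exact ⟨(m, n, k), trivial, rfl⟩
    · rintro ⟨⟨m, n, k⟩, -, rfl⟩
      exact ⟨m, n, k, rfl⟩
  rw [e]
  exact h2

/-- A central element. -/
def central (s : ℝ) : Heis := mk 0 0 s

@[fun_prop] theorem continuous_central : Continuous central := by
  unfold central
  fun_prop

@[simp] theorem central_a (s : ℝ) : (central s).a = 0 := rfl
@[simp] theorem central_b (s : ℝ) : (central s).b = 0 := rfl
@[simp] theorem central_c (s : ℝ) : (central s).c = s := rfl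

theorem central_add (s t : ℝ) : central (s + t) = central s * central t := by ext <;> simp

@[simp] theorem central_zero : central 0 = 1 := rfl

theorem central_comm (s : ℝ) (h : Heis) : central s * h = h * central s := by
  ext <;> simp [add_comm]

theorem central_int_mem (n : ℤ) : central n ∈ lattice := ⟨0, 0, n, by ext <;> simp⟩

end Heis

open Heis

/-- The Heisenberg nilmanifold. -/
abbrev Nil : Type := Heis ⧸ Heis.lattice

/-- The universal covering of the nilmanifold. -/
def nilMk : C(Heis, Nil) := ⟨QuotientGroup.mk, continuous_quot_mk⟩

theorem nilMk_eq_iff {g h : Heis} : nilMk g = nilMk h ↔ ∃ k ∈ Heis.lattice, h = g * k := by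
  refine (QuotientGroup.eq (s := Heis.lattice)).trans ?_
  constructor
  · intro hk
    exact ⟨_, hk, by group⟩
  · rintro ⟨k, hk, rfl⟩
    simpa using hk

theorem nilMk_surjective : Function.Surjective nilMk := QuotientGroup.mk_surjective

theorem nilMk_mul (g h : Heis) : nilMk (g * h) = g • nilMk h := rfl

theorem isCoveringMap_nilMk : IsCoveringMap nilMk :=
  (Subgroup.isQuotientCoveringMap _ lattice_isDiscrete).isCoveringMap

theorem isOpenQuotientMap_circ : IsOpenQuotientMap circ := by
  refine ⟨circ_surjective, continuous_circ, ?_⟩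
  have h : IsOpenMap (fun s : ℝ => 2 * Real.pi * s) :=
    (Homeomorph.mulLeft₀ (2 * Real.pi) (by positivity)).isOpenMap
  exact Circle.isCoveringMap_exp.isOpenMap.comp h

theorem circ_eq_iff {s t : ℝ} : circ s = circ t ↔ ∃ n : ℤ, s = t + n := by
  rw [← mul_inv_eq_one, ← circ_sub, circ_eq_one_iff]
  exact exists_congr fun n => sub_eq_iff_eq_add'

/-- The action of the central circle, on the level of the universal covering. -/
def centralMap : C(Heis × Circle, Nil) where
  toFun q := nilMk (q.1 * central (circ_surjective q.2).choose)
  continuous_toFun := by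
    rw [← (IsOpenQuotientMap.id.prodMap isOpenQuotientMap_circ).isQuotientMap.continuous_iff.symm.eq]
    have : (fun q : Heis × Circle => nilMk (q.1 * central (circ_surjective q.2).choose)) ∘
        Prod.map id circ = fun q : Heis × ℝ => nilMk (q.1 * central q.2) := by
      funext q
      obtain ⟨n, hn⟩ := circ_eq_iff.1 (circ_surjective (circ q.2)).choose_spec
      simp only [Function.comp, Prod.map_fst, Prod.map_snd, id]
      rw [hn, central_add, ← mul_assoc]
      exact (nilMk_eq_iff.2 ⟨_, central_int_mem n, rfl⟩).symm
    rw [this]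
    fun_prop

theorem centralMap_circ (h : Heis) (s : ℝ) : centralMap (h, circ s) = nilMk (h * central s) := by
  obtain ⟨n, hn⟩ := circ_eq_iff.1 (circ_surjective (circ s)).choose_spec
  change nilMk (h * central (circ_surjective (circ s)).choose) = _
  rw [hn, central_add, ← mul_assoc]
  exact (nilMk_eq_iff.2 ⟨_, central_int_mem n, rfl⟩).symm

theorem centralMap_mul_circ (h : Heis) (w : Circle) (s : ℝ) :
    centralMap (h, w * circ s) = central s • centralMap (h, w) := by
  obtain ⟨t, rfl⟩ := circ_surjective w
  rw [← circ_add, centralMap_circ, centralMap_circ, ← nilMk_mul, central_comm, central_add, mul_assoc]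

/-! ### Lifts to the Heisenberg group and cochains -/

section Lifts

variable {E : Type} [NormedAddCommGroup E] [NormedSpace ℝ E] {K : Set E}

theorem exists_lift (hK : Convex ℝ K) (hne : K.Nonempty) (f : C(K, Nil)) :
    ∃ L : C(K, Heis), ∀ x, nilMk (L x) = f x := by
  have := hK.contractibleSpace hne
  have := hK.locallyPathConnectedSpace
  obtain ⟨x₀⟩ := hne.to_subtype
  obtain ⟨h₀, hh₀⟩ := nilMk_surjective (f x₀)
  obtain ⟨L, ⟨-, hL⟩, -⟩ :=
    isCoveringMap_nilMk.existsUnique_continuousMap_lifts f x₀ h₀ hh₀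
  exact ⟨L, congrFun hL⟩

theorem exists_simplex_lift {n : ℕ} (σ : C(Simp n, Nil)) :
    ∃ L : C(Simp n, Heis), ∀ p, nilMk (L p) = σ p :=
  exists_lift (convex_stdSimplex ℝ _) ⟨_, (stdSimplex.vertex (S := ℝ) (0 : Fin (n + 1))).2⟩ σ

end Lifts

/-- The nilmanifold consists of left cosets, so lifts are unique up to right translation.
Right-invariant functions of the vertices of a lift are therefore well-defined cochains, and left
translation by the centre still acts. -/
theorem lift_unique {A : Type*} [TopologicalSpace A] [PreconnectedSpace A] [Nonempty A]
    {L L' : A → Heis} (hL : Continuous L) (hL' : Continuous L')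
    (h : ∀ x, nilMk (L x) = nilMk (L' x)) : ∃ g : Heis, ∀ x, L' x = L x * g := by
  obtain ⟨x₀⟩ := ‹Nonempty A›
  obtain ⟨g, hg, hx⟩ := nilMk_eq_iff.1 (h x₀)
  refine ⟨g, fun x => ?_⟩
  have := isCoveringMap_nilMk.eq_of_comp_eq hL' (hL.mul continuous_const) (g₂ := fun x => L x * g)
    (funext fun x => by
      rw [Function.comp, Function.comp, ← h]
      exact nilMk_eq_iff.2 ⟨g, hg, rfl⟩) x₀ hx
  exact congrFun this x

/-- A vertex of the standard simplex. -/
abbrev vtx {n : ℕ} (i : Fin (n + 1)) : Simp n := stdSimplex.vertex i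

/-- The homogeneous group cocycle that represents the volume form. -/
def volPoly (h₀ h₁ h₂ h₃ : Heis) : ℝ :=
  (h₁.b - h₀.b) * (h₂.c - h₁.c - (h₂.a - h₁.a) * h₁.b) * (h₃.a - h₂.a)
    + (h₁.b - h₀.b) ^ 2 / 2 * (h₂.a - h₁.a) * (h₃.a - h₂.a)

/-- The homogeneous group cochain given by the third coordinate. -/
def heightPoly (h₀ h₁ : Heis) : ℝ := h₁.c - h₀.c - (h₁.a - h₀.a) * h₀.b

/-- Everything depends on the quotients hᵢ₊₁hᵢ⁻¹ only. With a, b, c denoting the coordinates of a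
quotient as group cochains, `heightPoly` is c and `volPoly` is b ∪ c ∪ a + (b²/2) ∪ a ∪ a. -/
theorem volPoly_mul_right (h₀ h₁ h₂ h₃ g : Heis) :
    volPoly (h₀ * g) (h₁ * g) (h₂ * g) (h₃ * g) = volPoly h₀ h₁ h₂ h₃ := by
  simp only [volPoly, mul_a, mul_b, mul_c]
  ring

theorem heightPoly_mul_right (h₀ h₁ g : Heis) :
    heightPoly (h₀ * g) (h₁ * g) = heightPoly h₀ h₁ := by
  simp only [heightPoly, mul_a, mul_b, mul_c]
  ring

/-- The volume cocycle of the nilmanifold. -/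
def volCochain : Cochain 3 Nil := fun σ =>
  volPoly ((exists_simplex_lift σ).choose (vtx 0)) ((exists_simplex_lift σ).choose (vtx 1))
    ((exists_simplex_lift σ).choose (vtx 2)) ((exists_simplex_lift σ).choose (vtx 3))

/-- The height cochain of the nilmanifold. -/
def heightCochain : Cochain 1 Nil := fun σ =>
  heightPoly ((exists_simplex_lift σ).choose (vtx 0)) ((exists_simplex_lift σ).choose (vtx 1))

theorem volCochain_eq {σ : C(Simp 3, Nil)} (L : C(Simp 3, Heis)) (hL : ∀ p, nilMk (L p) = σ p) :
    volCochain σ = volPoly (L (vtx 0)) (L (vtx 1)) (L (vtx 2)) (L (vtx 3)) := by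
  obtain ⟨g, hg⟩ := lift_unique L.continuous (exists_simplex_lift σ).choose.continuous
    fun p => (hL p).trans ((exists_simplex_lift σ).choose_spec p).symm
  rw [volCochain, hg, hg, hg, hg, volPoly_mul_right]

theorem heightCochain_eq {σ : C(Simp 1, Nil)} (L : C(Simp 1, Heis))
    (hL : ∀ p, nilMk (L p) = σ p) : heightCochain σ = heightPoly (L (vtx 0)) (L (vtx 1)) := by
  obtain ⟨g, hg⟩ := lift_unique L.continuous (exists_simplex_lift σ).choose.continuous
    fun p => (hL p).trans ((exists_simplex_lift σ).choose_spec p).symm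
  rw [heightCochain, hg, hg, heightPoly_mul_right]

theorem faceIncl_vtx (n : ℕ) (i : Fin (n + 2)) (j : Fin (n + 1)) :
    faceIncl n i (vtx j) = vtx (i.succAbove j) :=
  stdSimplex.map_vertex _ _

/-- The cochains a and b are cocycles, δc = -b ∪ a by the multiplication law, and δ(b²/2) = -b ∪ b.
So the coboundaries of b ∪ c ∪ a and (b²/2) ∪ a ∪ a are ± b ∪ b ∪ a ∪ a and cancel. -/
theorem volCochain_cocycle (τ : C(Simp 4, Nil)) : evalCochain volCochain (simplexBdry 3 τ) = 0 := by
  obtain ⟨L, hL⟩ := exists_simplex_lift τ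
  have h : ∀ i, volCochain (τ.comp (faceIncl 3 i)) = volPoly (L (vtx (i.succAbove 0)))
      (L (vtx (i.succAbove 1))) (L (vtx (i.succAbove 2))) (L (vtx (i.succAbove 3))) := by
    intro i
    rw [volCochain_eq (L.comp (faceIncl 3 i)) fun p => hL _]
    simp only [ContinuousMap.comp_apply, faceIncl_vtx]
  simp only [simplexBdry, map_sum, map_zsmul, evalCochain_single, h]
  refine (Fin.sum_univ_five _).trans ?_
  have e : ∀ i j, (i : Fin 5).succAbove (j : Fin 4) = if (j : ℕ) < i then j.castSucc else j.succ := by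
    intro i j; rfl
  simp [e, volPoly]
  ring

end GraphMfd
end

noncomputable section

namespace GraphMfd

open Topology Heis

/-! ### The volume cocycle on products with a circle -/

variable {Y : Type} [TopologicalSpace Y]

theorem push_prismTwo {Z W : Type} [TopologicalSpace Z] [TopologicalSpace W] (H : C(Y × ℝ, Z))
    (g : C(Z, W)) (c : Chain 2 Y) : push 3 g (prismTwo H c) = prismTwo (g.comp H) c := by
  have : (push 3 g).comp (prismTwo H) = prismTwo (g.comp H) := by
    refine chain_ext fun σ => ?_
    have : ∀ (f' : Fin 4 → Fin 3) t, g.comp (prismSimplex H σ f' t) =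
        prismSimplex (g.comp H) σ f' t := by
      intro f' t
      ext p
      simp [prismSimplex_apply]
    simp only [LinearMap.comp_apply, push_single, prismTwo, linearCombination_single_one, map_sub,
      map_add, this]
  exact LinearMap.congr_fun this c

theorem comb_vtx {E : Type} [NormedAddCommGroup E] [NormedSpace ℝ E] {K : Set E}
    (hK : Convex ℝ K) {n : ℕ} (v : Fin (n + 1) → K) (i : Fin (n + 1)) :
    comb hK v (vtx i) = v i := by
  apply Subtype.ext
  rw [coe_comb]
  simp [Pi.single_apply]

/-- Over a triangle only the middle tetrahedron of the prism has nonzero volume: the first has zero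
b-step and the third zero a-step. The middle one gives m times -b ∪ a, the coboundary of the height.
Hence the volume depends on the boundary of the chain alone. -/
theorem eval_prismTwo (H : C(Y × ℝ, Nil)) (m : ℝ)
    (hH : ∀ y, ∃ ν : C(ℝ, ℝ), ν 0 = 0 ∧ ν 1 = m ∧ ∀ s, H (y, s) = central (ν s) • H (y, 0))
    (c : Chain 2 Y) :
    evalCochain volCochain (prismTwo H c) = m * evalCochain heightCochain
      (bdryOp 1 Nil (push 2 (H.comp ⟨fun y => (y, 0), by fun_prop⟩) c)) := by
  induction c using Finsupp.induction_linear with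
  | zero => simp
  | add f g hf hg => simp only [map_add, hf, hg, mul_add]
  | single σ n =>
    rw [← mul_one n, ← smul_eq_mul, ← Finsupp.smul_single]
    simp only [map_zsmul]
    rw [mul_smul_comm]
    congr 1
    obtain ⟨Λ, hΛ⟩ := exists_lift (prismSet_convex 2) ⟨_, (prismVertex (0 : Fin 3) 0).2⟩
      (prismMap H σ)
    have hc : ∀ p : Simp 2, Continuous (fun s => prismPt p s) := fun p =>
      Continuous.subtype_mk (by fun_prop) _
    have hc' : ∀ s : ℝ, Continuous (fun p : Simp 2 => prismPt p s) := fun s =>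
      Continuous.subtype_mk (by fun_prop) _
    -- By uniqueness of path lifting, moving up the prism by one unit translates the lift by
    -- `central m`, whatever the intermediate values of ν are.
    have hone : ∀ p : Simp 2, Λ (prismPt p 1) = central m * Λ (prismPt p 0) := by
      intro p
      obtain ⟨ν, h0, h1, h2⟩ := hH (σ p)
      have := isCoveringMap_nilMk.eq_of_comp_eq (g₁ := fun s => Λ (prismPt p s))
        (g₂ := fun s => central (ν s) * Λ (prismPt p 0)) (Λ.continuous.comp (hc p))
        (by fun_prop) (funext fun s => by
          rw [Function.comp, Function.comp, nilMk_mul, hΛ, hΛ, prismMap_pt, prismMap_pt, h2]) 0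
          (by simp [h0])
      rw [← h1]
      exact congrFun this 1
    have hv : ∀ (f : Fin 4 → Fin 3) (t : Fin 4 → ℝ), volCochain (prismSimplex H σ f t) =
        volPoly (Λ (prismVertex (f 0) (t 0))) (Λ (prismVertex (f 1) (t 1)))
          (Λ (prismVertex (f 2) (t 2))) (Λ (prismVertex (f 3) (t 3))) := by
      intro f t
      rw [volCochain_eq (Λ.comp ⟨_, continuous_comb (prismSet_convex 2)
        fun i => prismVertex (f i) (t i)⟩) fun p => hΛ _]
      simp only [ContinuousMap.comp_apply, ContinuousMap.coe_mk, comb_vtx]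
    have hh : ∀ i, heightCochain (((H.comp ⟨fun y => (y, 0), by fun_prop⟩).comp σ).comp
        (faceIncl 1 i)) = heightPoly (Λ (prismVertex (i.succAbove 0) 0))
          (Λ (prismVertex (i.succAbove 1) 0)) := by
      intro i
      rw [heightCochain_eq ((Λ.comp ⟨_, hc' 0⟩).comp (faceIncl 1 i)) fun p => hΛ _]
      simp only [ContinuousMap.comp_apply, ContinuousMap.coe_mk, faceIncl_vtx]
      rfl
    rw [prismTwo, linearCombination_single_one, push_single, bdryOp_single, simplexBdry_one]
    simp only [map_add, map_sub, evalCochain_single, hv, hh]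
    have e : ∀ i, Λ (prismVertex (i : Fin 3) 1) = central m * Λ (prismVertex i 0) :=
      fun i => hone _
    have s00 : (0 : Fin 3).succAbove (0 : Fin 2) = 1 := rfl
    have s01 : (0 : Fin 3).succAbove (1 : Fin 2) = 2 := rfl
    have s10 : (1 : Fin 3).succAbove (0 : Fin 2) = 0 := rfl
    have s11 : (1 : Fin 3).succAbove (1 : Fin 2) = 2 := rfl
    have s20 : (2 : Fin 3).succAbove (0 : Fin 2) = 0 := rfl
    have s21 : (2 : Fin 3).succAbove (1 : Fin 2) = 1 := rfl
    simp [s00, s01, s10, s11, s20, s21, e, volPoly, heightPoly]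
    ring

theorem heightCochain_loop (σ : C(Simp 1, Nil)) (x₀ : Nil) (ν : C(ℝ, ℝ))
    (h : ∀ p, σ p = central (ν (p 1)) • x₀) : heightCochain σ = ν 1 - ν 0 := by
  obtain ⟨g, rfl⟩ := nilMk_surjective x₀
  have hp : Continuous fun p : Simp 1 => p 1 := (continuous_apply 1).comp continuous_subtype_val
  rw [heightCochain_eq ⟨fun p => central (ν (p 1)) * g,
      (continuous_central.comp (ν.continuous.comp hp)).mul continuous_const⟩ fun p => by
    rw [h]; rfl]
  simp [heightPoly]

/-- A lift of such a simplex has integral first coordinate, which is constant by connectedness, and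
every term of `volPoly` contains the last increment of that coordinate. -/
theorem volCochain_fibre (σ : C(Simp 3, Nil)) (h : ∀ p, ∃ s, σ p = nilMk (central s)) :
    volCochain σ = 0 := by
  obtain ⟨L, hL⟩ := exists_simplex_lift σ
  have : PreconnectedSpace (Simp 3) :=
    isPreconnected_iff_preconnectedSpace.1 (convex_stdSimplex ℝ (Fin 4)).isPreconnected
  have ha : ∀ p q, (L p).a = (L q).a := by
    intro p q
    have hint : ∀ p, ∃ n : ℤ, (n : ℝ) = (L p).a := by
      intro p
      obtain ⟨s, hs⟩ := h p
      obtain ⟨k, ⟨i, j, l, rfl⟩, e⟩ := nilMk_eq_iff.1 (hs.symm.trans (hL p).symm)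
      exact ⟨i, by rw [e]; simp⟩
    choose n hn using hint
    have hcont : Continuous n := by
      rw [Int.isClosedEmbedding_coe_real.isInducing.continuous_iff]
      have : ((↑) : ℤ → ℝ) ∘ n = fun p => (L p).a := funext hn
      rw [this]
      fun_prop
    rw [← hn, ← hn, PreconnectedSpace.constant ‹_› hcont]
  rw [volCochain_eq L hL]
  simp [volPoly, ha (vtx 3) (vtx 2)]

end GraphMfd
end

noncomputable section

namespace GraphMfd

open Topology

/-! ### Phases -/

/-- The argument of a complex number, in turns. -/
def turn (z : ℂ) : ℝ := z.arg / (2 * Real.pi)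

/-- The phase of a complex number. -/
def phase (z : ℂ) : Circle := circ (turn z)

theorem continuousAt_turn {z : ℂ} (hz : z ∈ Complex.slitPlane) : ContinuousAt turn z :=
  (Complex.continuousAt_arg hz).div_const _

theorem phase_eq (z : ℂ) : phase z = Circle.exp z.arg := by
  rw [phase, circ, turn, mul_div_cancel₀ _ (by positivity)]

theorem norm_mul_phase (z : ℂ) : (‖z‖ : ℂ) * phase z = z := by
  rw [phase_eq, Circle.coe_exp, Complex.norm_mul_exp_arg_mul_I]

theorem phase_eq_of_eq {z : ℂ} {r : ℝ} (hr : 0 < r) {u : Circle} (h : z = r * u) :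
    phase z = u := by
  have hz : ‖z‖ = r := by rw [h, norm_mul, Circle.norm_coe, mul_one, Complex.norm_real, Real.norm_of_nonneg hr.le]
  have h1 := norm_mul_phase z
  rw [hz, h] at h1
  exact Circle.ext (mul_left_cancel₀ (Complex.ofReal_ne_zero.2 hr.ne') (h ▸ h1))

theorem phase_coe (u : Circle) : phase u = u := phase_eq_of_eq one_pos (by simp)

theorem phase_mul {z w : ℂ} (hz : z ≠ 0) (hw : w ≠ 0) : phase (z * w) = phase z * phase w := by
  refine phase_eq_of_eq (r := ‖z‖ * ‖w‖) (by positivity) ?_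
  conv_lhs => rw [← norm_mul_phase z, ← norm_mul_phase w]
  push_cast
  ring

theorem continuousAt_phase {z : ℂ} (hz : z ≠ 0) : ContinuousAt phase z := by
  refine IsInducing.subtypeVal.continuousAt_iff.2 ?_
  have h : ContinuousAt (fun w : ℂ => w / ‖w‖) z :=
    continuousAt_id.div (by fun_prop) (by simpa using hz)
  refine h.congr ?_
  filter_upwards [isOpen_ne.mem_nhds hz] with w hw
  rw [div_eq_iff (by simpa using hw), mul_comm]
  exact (norm_mul_phase w).symm

theorem continuous_phase_comp {Y : Type*} [TopologicalSpace Y] {f : Y → ℂ} (hf : Continuous f)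
    (h : ∀ y, f y ≠ 0) : Continuous fun y => phase (f y) :=
  continuous_iff_continuousAt.2 fun y =>
    ContinuousAt.comp (g := phase) (continuousAt_phase (h y)) hf.continuousAt

theorem continuous_turn_comp {Y : Type*} [TopologicalSpace Y] {f : Y → ℂ} (hf : Continuous f)
    (h : ∀ y, 0 < (f y).re) : Continuous fun y => turn (f y) :=
  continuous_iff_continuousAt.2 fun y =>
    ContinuousAt.comp (g := turn) (continuousAt_turn (Or.inl (h y))) hf.continuousAt

/-! ### Maps on the circle and on the torus -/

theorem exists_circleMap {B : Type*} [TopologicalSpace B] {f : ℝ → B} (hf : Continuous f) {n : ℝ}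
    (hn : 0 < n) (h : f 0 = f n) :
    ∃ F : C(Circle, B), ∀ x, 0 ≤ x → x ≤ n → F (circ (x / n)) = f x := by
  have : Fact (0 < n) := ⟨hn⟩
  have hc : Continuous (AddCircle.liftIco n 0 f) :=
    AddCircle.liftIco_continuous (by simpa using h) hf.continuousOn
  have he : ∀ x : ℝ, circ (x / n) = AddCircle.homeomorphCircle hn.ne' (x : AddCircle n) := by
    intro x
    rw [AddCircle.homeomorphCircle_apply, AddCircle.toCircle_apply_mk, circ]
    congr 1
    ring
  refine ⟨⟨fun u => AddCircle.liftIco n 0 f ((AddCircle.homeomorphCircle hn.ne').symm u),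
    hc.comp (Homeomorph.continuous _)⟩, fun x h0 h1 => ?_⟩
  simp only [ContinuousMap.coe_mk, he, Homeomorph.symm_apply_apply]
  rcases h1.lt_or_eq with h1 | rfl
  · exact AddCircle.liftIco_coe_apply ⟨h0, by simpa using h1⟩
  · rw [AddCircle.coe_period, ← AddCircle.coe_zero, AddCircle.liftIco_coe_apply (by simpa using hn), h]

theorem exists_angle_of_homotopic {A : Type*} [TopologicalSpace A] {f g : C(A, Circle)}
    (h : f.Homotopic g) : ∃ η : C(A, ℝ), ∀ a, f a = g a * circ (η a) := by
  obtain ⟨H⟩ := h.symm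
  let K : C(unitInterval × A, Circle) := ⟨fun q => H q * (g q.2)⁻¹, by fun_prop⟩
  have hK : ∀ a, K (0, a) = Circle.exp (ContinuousMap.const A (0 : ℝ) a) := by
    intro a
    rw [ContinuousMap.const_apply, Circle.exp_zero]
    simp [K]
  let Λ := Circle.isCoveringMap_exp.liftHomotopy K (ContinuousMap.const A 0) hK
  have hΛ : ∀ q, Circle.exp (Λ q) = K q := congrFun
    (Circle.isCoveringMap_exp.liftHomotopy_lifts K (ContinuousMap.const A 0) hK)
  refine ⟨⟨fun a => Λ (1, a) / (2 * Real.pi), by fun_prop⟩, fun a => ?_⟩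
  have e : circ (Λ (1, a) / (2 * Real.pi)) = f a * (g a)⁻¹ := by
    rw [circ, mul_div_cancel₀ _ (by positivity), hΛ]
    simp [K]
  exact (by rw [e, mul_comm, inv_mul_cancel_right] : f a = g a * circ (Λ (1, a) / (2 * Real.pi)))

theorem exists_int_of_circ_eq {A : Type*} [TopologicalSpace A] [PreconnectedSpace A] [Nonempty A]
    {f g : A → ℝ} (hf : Continuous f) (hg : Continuous g) (h : ∀ a, circ (f a) = circ (g a)) :
    ∃ n : ℤ, ∀ a, f a = g a + n := by
  choose n hn using fun a => circ_eq_iff.1 (h a)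
  have hc : Continuous n := by
    rw [Int.isClosedEmbedding_coe_real.isInducing.continuous_iff]
    have : ((↑) : ℤ → ℝ) ∘ n = fun a => f a - g a := funext fun a => by simp [hn]
    rw [this]
    exact hf.sub hg
  obtain ⟨a₀⟩ := ‹Nonempty A›
  exact ⟨n a₀, fun a => by rw [hn a, PreconnectedSpace.constant ‹_› hc]⟩

/-- The map lifts to ℝ on the universal covering of the torus. Each generator of the lattice shifts
the lift by a constant integer, which is seen on a coordinate circle, where a periodic lift is
given; so it is zero. -/
theorem exists_angle_torus (f : C(Torus, Circle)) (η₁ η₂ : C(Circle, ℝ))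
    (h₁ : ∀ u, f (u, 1) = circ (η₁ u)) (h₂ : ∀ v, f (1, v) = circ (η₂ v)) :
    ∃ η : C(Torus, ℝ), ∀ y, f y = circ (η y) := by
  obtain ⟨L', hL'⟩ : ∃ L' : C(ℝ × ℝ, ℝ), ∀ q, Circle.exp (L' q) = f (circ q.1, circ q.2) := by
    obtain ⟨L', ⟨-, hL'⟩, -⟩ := Circle.isCoveringMap_exp.existsUnique_continuousMap_lifts
      (⟨fun q => f (circ q.1, circ q.2), by fun_prop⟩ : C(ℝ × ℝ, Circle)) (0, 0)
      (f (circ 0, circ 0) : ℂ).arg (Circle.exp_arg _)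
    exact ⟨L', congrFun hL'⟩
  let L : ℝ × ℝ → ℝ := fun q => L' q / (2 * Real.pi)
  have hLc : Continuous L := by fun_prop
  have hL : ∀ q, circ (L q) = f (circ q.1, circ q.2) := by
    intro q
    rw [circ, mul_div_cancel₀ _ (by positivity), hL']
  -- The shift n is constant on the plane. Along the axis the lift differs from the periodic
  -- function η₁ ∘ circ by a constant, whence n = 0.
  have p1 : ∀ q : ℝ × ℝ, L (q.1 + 1, q.2) = L q := by
    obtain ⟨n, hn⟩ := exists_int_of_circ_eq (f := fun q : ℝ × ℝ => L (q.1 + 1, q.2)) (g := L)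
      (by fun_prop) hLc fun q => by rw [hL, hL, circ_add, circ_one, mul_one]
    obtain ⟨m, hm⟩ := exists_int_of_circ_eq (f := fun s : ℝ => L (s, 0))
      (g := fun s => η₁ (circ s)) (by fun_prop) (by fun_prop) fun s => by
        rw [hL, ← h₁, circ_zero]
    have e := hn (0, 0)
    have e0 := hm 0
    have e1 := hm (0 + 1)
    simp only [zero_add, circ_one, circ_zero] at e e0 e1
    intro q
    have := hn q
    linarith
  have p2 : ∀ q : ℝ × ℝ, L (q.1, q.2 + 1) = L q := by
    obtain ⟨n, hn⟩ := exists_int_of_circ_eq (f := fun q : ℝ × ℝ => L (q.1, q.2 + 1)) (g := L)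
      (by fun_prop) hLc fun q => by rw [hL, hL, circ_add, circ_one, mul_one]
    obtain ⟨m, hm⟩ := exists_int_of_circ_eq (f := fun s : ℝ => L (0, s))
      (g := fun s => η₂ (circ s)) (by fun_prop) (by fun_prop) fun s => by
        rw [hL, ← h₂, circ_zero]
    have e := hn (0, 0)
    have e0 := hm 0
    have e1 := hm (0 + 1)
    simp only [zero_add, circ_one, circ_zero] at e e0 e1
    intro q
    have := hn q
    linarith
  have z1 : ∀ (s t : ℝ) (n : ℤ), L (s + n, t) = L (s, t) := by
    intro s t n
    have : Function.Periodic (fun s => L (s, t)) 1 := fun s => p1 (s, t)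
    simpa using this.int_mul n s
  have z2 : ∀ (s t : ℝ) (n : ℤ), L (s, t + n) = L (s, t) := by
    intro s t n
    have : Function.Periodic (fun t => L (s, t)) 1 := fun t => p2 (s, t)
    simpa using this.int_mul n t
  have hq : IsQuotientMap (Prod.map circ circ) :=
    (isOpenQuotientMap_circ.prodMap isOpenQuotientMap_circ).isQuotientMap
  let η : Torus → ℝ := fun y => L ((circ_surjective y.1).choose, (circ_surjective y.2).choose)
  have hη : ∀ q : ℝ × ℝ, η (circ q.1, circ q.2) = L q := by
    intro q
    obtain ⟨n, hn⟩ := circ_eq_iff.1 (circ_surjective (circ q.1)).choose_spec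
    obtain ⟨m, hm⟩ := circ_eq_iff.1 (circ_surjective (circ q.2)).choose_spec
    simp only [η]
    rw [hn, hm, z1, z2]
  refine ⟨⟨η, hq.continuous_iff.2 (by
    rw [show η ∘ Prod.map circ circ = L from funext hη]; exact hLc)⟩, fun y => ?_⟩
  obtain ⟨q, rfl⟩ := hq.surjective y
  exact ((congrArg circ (hη q)).trans (hL q)).symm

/-- Homotopies on the two coordinate circles suffice: the ratio of φ to the linear map, coordinate
by coordinate, has an angle on each of them and hence on the torus. -/
theorem HasGluingMatrix.exists_angles {φ : Torus ≃ₜ Torus} {A : Matrix (Fin 2) (Fin 2) ℤ}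
    (h : HasGluingMatrix φ A) : ∃ η₁ η₂ : C(Torus, ℝ), ∀ y,
      φ y = ((linearMap A y).1 * circ (η₁ y), (linearMap A y).2 * circ (η₂ y)) := by
  have key : ∀ p : C(Torus, Circle), ∃ η : C(Torus, ℝ), ∀ y,
      p (φ y) = p (linearMap A y) * circ (η y) := by
    intro p
    obtain ⟨η₁, h₁⟩ := exists_angle_of_homotopic (.comp (.refl p) h.1)
    obtain ⟨η₂, h₂⟩ := exists_angle_of_homotopic (.comp (.refl p) h.2)
    obtain ⟨η, hη⟩ := exists_angle_torus ⟨fun y => p (φ y) * (p (linearMap A y))⁻¹, by fun_prop⟩ η₁ η₂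
      (fun u => mul_inv_eq_iff_eq_mul.2 ((h₁ u).trans (mul_comm _ _)))
      (fun u => mul_inv_eq_iff_eq_mul.2 ((h₂ u).trans (mul_comm _ _)))
    refine ⟨η, fun y => ?_⟩
    exact (mul_inv_eq_iff_eq_mul.1 (hη y)).trans (mul_comm _ _)
  obtain ⟨η₁, h₁⟩ := key ContinuousMap.fst
  obtain ⟨η₂, h₂⟩ := key ContinuousMap.snd
  exact ⟨η₁, η₂, fun y => Prod.ext (h₁ y) (h₂ y)⟩

end GraphMfd
end

noncomputable section

namespace GraphMfd

open Topology Heis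

/-! ### The target manifold -/

/-- The Seifert invariants of the circle bundle of Euler number `-β` over the surface of
genus two. -/
def bundleData (β : ℤ) : SeifertData where
  base := .orientable 2
  n := 1
  B _ := ⟨!![1, 0; β, 1], by simp⟩
  pos _ := by simp

theorem eulerNumber_bundleData (β : ℤ) : (bundleData β).eulerNumber = -β := by
  simp only [SeifertData.eulerNumber, SeifertData.α, SeifertData.β, bundleData, neg_inj]
  exact (Fin.sum_univ_one _).trans (by simp)

theorem baseEuler_bundleData (β : ℤ) : (bundleData β).baseEuler = -2 := by
  simp [SeifertData.baseEuler, SeifertData.α, bundleData, SurfaceType.euler]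

/-- The circle bundle of Euler number `-β` over the surface of genus two. -/
abbrev Bundle (β : ℤ) : Type := SeifertManifold (bundleData β)

/-- The bundle over the complement of a disc in the base. -/
def bundleBase (β : ℤ) : C(HoledDisc 1 × Circle, Bundle β) :=
  ⟨fun q => Quot.mk _ (Sum.inl q), continuous_quot_mk.comp continuous_inl⟩

/-- The solid torus over the remaining disc. -/
def bundleSolid (β : ℤ) : C(Disc × Circle, Bundle β) :=
  ⟨fun q => Quot.mk _ (Sum.inr ((0 : Fin 1), q)),
    continuous_quot_mk.comp (continuous_inr.comp (by fun_prop))⟩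

theorem SidePair.orientable {g : ℕ} {x y : ℝ} {ε : Bool} (h : SidePair (.orientable g) x y ε) :
    ε = false := by
  cases h <;> rfl

theorem SidePair.mem {g : ℕ} {x y : ℝ} {ε : Bool} (h : SidePair (.orientable g) x y ε) :
    (0 ≤ x ∧ x ≤ (4 * g + 2 : ℝ)) ∧ 0 ≤ y ∧ y ≤ (4 * g + 2 : ℝ) := by
  cases h with
  | a _ m t h0 h1 =>
    have hm : ((m : ℕ) : ℝ) + 1 ≤ g := by exact_mod_cast m.isLt
    have hm0 : (0 : ℝ) ≤ (m : ℕ) := Nat.cast_nonneg _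
    refine ⟨⟨?_, ?_⟩, ?_, ?_⟩ <;> linarith
  | b _ m t h0 h1 =>
    have hm : ((m : ℕ) : ℝ) + 1 ≤ g := by exact_mod_cast m.isLt
    have hm0 : (0 : ℝ) ≤ (m : ℕ) := Nat.cast_nonneg _
    refine ⟨⟨?_, ?_⟩, ?_, ?_⟩ <;> linarith
  | c _ t h0 h1 =>
    have hm0 : (0 : ℝ) ≤ (g : ℕ) := Nat.cast_nonneg _
    refine ⟨⟨?_, ?_⟩, ?_, ?_⟩ <;> linarith

theorem bundleBase_side (β : ℤ) {x y : ℝ} {ε : Bool} (h : SidePair (.orientable 2) x y ε)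
    (v : Circle) : bundleBase β (outer 1 10 x, v) = bundleBase β (outer 1 10 y, v) := by
  obtain rfl := h.orientable
  exact Quot.sound (SeifertRel.side (D := bundleData β) x y false h v)

theorem bundleSolid_bdry (β : ℤ) (u v : Circle) :
    bundleSolid β (Disc.bdry u, v) = bundleBase β (rim 1 0 u, u ^ β * v) := by
  have := Quot.sound (SeifertRel.fill (D := bundleData β) (0 : Fin 1) (u, v))
  have e : linearMap ((bundleData β).B (0 : Fin 1)).1 (u, v) = (u, u ^ β * v) := by
    simp [bundleData, linearMap]
  rw [e] at this
  exact this

/-- The point of the annulus with given phase, and with given modulus as far as possible. -/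
def annulusPt (s : ℝ) (u : Circle) : HoledDisc 1 :=
  ⟨(max (1 / 4) (min 1 s) : ℝ) * u, by
    rw [norm_mul, Circle.norm_coe, mul_one, Complex.norm_real, Real.norm_of_nonneg (by positivity)]
    refine ⟨by simp; norm_num, fun j => ?_⟩
    rw [Subsingleton.elim j 0, show holeCenter 1 0 = 0 by simp [holeCenter], sub_zero, norm_mul,
      Circle.norm_coe, mul_one, Complex.norm_real, Real.norm_of_nonneg (by positivity)]
    simp [holeRadius]⟩

theorem continuous_annulusPt {Y : Type*} [TopologicalSpace Y] {s : Y → ℝ} {u : Y → Circle}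
    (hs : Continuous s) (hu : Continuous u) : Continuous fun y => annulusPt (s y) (u y) :=
  Continuous.subtype_mk (by fun_prop) _

theorem annulusPt_one (x : ℝ) : annulusPt 1 (circ (x / 10)) = outer 1 10 x := by
  apply Subtype.ext
  simp only [annulusPt, outer, circ, min_self, Nat.cast_ofNat]
  rw [max_eq_right (by norm_num), mul_div_assoc]
  simp

theorem annulusPt_quarter (u : Circle) : annulusPt (1 / 4) u = rim 1 0 u⁻¹ := by
  apply Subtype.ext
  simp only [annulusPt, rim]
  rw [min_eq_right (by norm_num)]
  simp [holeCenter, holeRadius]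

/-- The radial retraction of the plane to the closed unit disc. -/
def discPt (z : ℂ) : Disc :=
  ⟨z / (max 1 ‖z‖ : ℝ), by
    rw [norm_div, Complex.norm_real, Real.norm_of_nonneg (by positivity)]
    exact div_le_one_of_le₀ (le_max_right _ _) (by positivity)⟩

theorem continuous_discPt : Continuous discPt :=
  Continuous.subtype_mk (continuous_id.div (by fun_prop) fun z => by
    rw [Complex.ofReal_ne_zero]; positivity) _

theorem discPt_coe (u : Circle) : discPt u = Disc.bdry u := by
  apply Subtype.ext
  simp only [discPt, Disc.bdry, Circle.norm_coe, max_self, Complex.ofReal_one, div_one]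

theorem phase_conj {z : ℂ} (hz : z ≠ 0) : phase (starRingEnd ℂ z) = (phase z)⁻¹ := by
  refine phase_eq_of_eq (norm_pos_iff.2 hz) ?_
  conv_lhs => rw [← norm_mul_phase z]
  rw [map_mul, Complex.conj_ofReal, Circle.coe_inv_eq_conj]

/-- The trivialization of the bundle over the disc that results from cutting the base open; it is
extended to the plane. -/
def bundleChart (β : ℤ) : C(ℂ × Circle, Bundle β) where
  -- The solid torus fills |ζ| ≤ 1/2 and the annulus is stretched over the rest. Conjugation is
  -- needed because the rim is clockwise; the twist by the power -β undoes the gluing of the solid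
  -- torus.
  toFun q := if ‖q.1‖ ≤ 1 / 2 then bundleSolid β (discPt (2 * starRingEnd ℂ q.1), q.2)
    else bundleBase β (annulusPt ((3 * ‖q.1‖ - 1) / 2) (phase q.1), q.2 * phase q.1 ^ (-β))
  continuous_toFun := by
    refine continuous_if_le (by fun_prop) continuous_const ?_ ?_ ?_
    · have h := continuous_discPt.comp
        (continuous_const.mul (Complex.continuous_conj.comp continuous_fst) :
          Continuous fun q : ℂ × Circle => 2 * starRingEnd ℂ q.1)
      exact ((bundleSolid β).continuous.comp (h.prodMk continuous_snd)).continuousOn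
    · rw [continuousOn_iff_continuous_domRestrict]
      have hp : Continuous fun q : {q : ℂ × Circle | (1 / 2 : ℝ) ≤ ‖q.1‖} => phase q.1.1 :=
        continuous_phase_comp (by fun_prop) fun q h => by
          have := q.2
          simp [h] at this
          norm_num at this
      exact (bundleBase β).continuous.comp
        ((continuous_annulusPt (by fun_prop) hp).prodMk (by fun_prop))
    · rintro ⟨ζ, w⟩ h
      simp only at h ⊢
      have h0 : ζ ≠ 0 := by
        rintro rfl
        norm_num at h
      have e : 2 * starRingEnd ℂ ζ = ((phase ζ)⁻¹ : Circle) := by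
        rw [← phase_conj h0]
        conv_lhs => rw [← norm_mul_phase (starRingEnd ℂ ζ)]
        rw [Complex.norm_conj, h]
        simp
      rw [e, discPt_coe, bundleSolid_bdry, h, ← inv_inv (phase ζ), ← annulusPt_quarter, inv_inv,
        inv_zpow, zpow_neg, mul_comm w]
      norm_num

/-- On the boundary of the disc the chart and the trivialization over the holed base differ by u^β:
this is the clutching function that carries the Euler number. -/
theorem bundleChart_coe (β : ℤ) (u w : Circle) :
    bundleChart β (u, u ^ β * w) = bundleBase β (annulusPt 1 u, w) := by
  have : ¬ (1 : ℝ) ≤ 1 / 2 := by norm_num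
  simp only [bundleChart, ContinuousMap.coe_mk, Circle.norm_coe, this, if_false, phase_coe]
  norm_num

/-! ### The map from the bundle to the nilmanifold -/

/-- The piecewise linear function that rises from `0` to `1` on `[k, k + 1]`. -/
def ramp (k x : ℝ) : ℝ := max 0 (min 1 (x - k))

@[fun_prop] theorem continuous_ramp (k : ℝ) : Continuous (ramp k) := by
  unfold ramp
  fun_prop

theorem ramp_of_le {k x : ℝ} (h : x ≤ k) : ramp k x = 0 := by
  rw [ramp, min_eq_right (by linarith), max_eq_left (by linarith)]

theorem ramp_of_ge {k x : ℝ} (h : k + 1 ≤ x) : ramp k x = 1 := by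
  rw [ramp, min_eq_left (by linarith), max_eq_right (by linarith)]

theorem ramp_of_mem {k x : ℝ} (h0 : k ≤ x) (h1 : x ≤ k + 1) : ramp k x = x - k := by
  rw [ramp, min_eq_right (by linarith), max_eq_right (by linarith)]

/-- The path in the Heisenberg group that develops the boundary of the polygon. -/
def polygonPath (β x : ℝ) : Heis :=
  mk (β * (ramp 2 x - ramp 0 x)) (ramp 1 x - ramp 3 x) (β * ramp 2 x)

theorem polygonPath_of_ge (β : ℝ) {x : ℝ} (h : 4 ≤ x) : polygonPath β x = mk 0 0 β := by
  rw [polygonPath, ramp_of_ge (by linarith), ramp_of_ge (by linarith), ramp_of_ge (by linarith),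
    ramp_of_ge (by linarith)]
  simp

/-- The first four sides develop a commutator of lattice elements with base coordinates (0, 1) and
(β, 0), whose value is central of height β. The second handle and the last pair of sides stay at its
endpoint. -/
theorem polygonPath_side (β : ℤ) {x y : ℝ} {ε : Bool} (h : SidePair (.orientable 2) x y ε) :
    ∃ k ∈ lattice, polygonPath β y = polygonPath β x * k := by
  cases h with
  | a _ m t h0 h1 =>
    fin_cases m
    · refine ⟨mk (0 : ℤ) (1 : ℤ) β, ⟨_, _, _, rfl⟩, ?_⟩
      simp only [Nat.cast_zero, mul_zero, zero_add, polygonPath]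
      rw [ramp_of_le (k := 2) (x := t) (by linarith), ramp_of_mem (k := 0) (x := t) (by linarith) (by linarith),
        ramp_of_le (k := 1) (x := t) (by linarith), ramp_of_le (k := 3) (x := t) (by linarith),
        ramp_of_mem (k := 2) (x := 3 - t) (by linarith) (by linarith),
        ramp_of_ge (k := 0) (x := 3 - t) (by linarith),
        ramp_of_ge (k := 1) (x := 3 - t) (by linarith),
        ramp_of_le (k := 3) (x := 3 - t) (by linarith)]
      ext <;> simp <;> ring
    · refine ⟨1, one_mem _, ?_⟩
      rw [polygonPath_of_ge, polygonPath_of_ge, mul_one] <;> norm_num <;> linarith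
  | b _ m t h0 h1 =>
    fin_cases m
    · refine ⟨mk β (0 : ℤ) β, ⟨_, _, _, rfl⟩, ?_⟩
      simp only [Nat.cast_zero, mul_zero, zero_add, polygonPath]
      rw [ramp_of_le (k := 2) (x := 1 + t) (by linarith), ramp_of_ge (k := 0) (x := 1 + t) (by linarith),
        ramp_of_mem (k := 1) (x := 1 + t) (by linarith) (by linarith), ramp_of_le (k := 3) (x := 1 + t) (by linarith),
        ramp_of_ge (k := 2) (x := 4 - t) (by linarith),
        ramp_of_ge (k := 0) (x := 4 - t) (by linarith),
        ramp_of_ge (k := 1) (x := 4 - t) (by linarith),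
        ramp_of_mem (k := 3) (x := 4 - t) (by linarith) (by linarith)]
      ext <;> simp <;> ring
    · refine ⟨1, one_mem _, ?_⟩
      rw [polygonPath_of_ge, polygonPath_of_ge, mul_one] <;> norm_num <;> linarith
  | c _ t h0 h1 =>
    refine ⟨1, one_mem _, ?_⟩
    rw [polygonPath_of_ge, polygonPath_of_ge, mul_one] <;> (norm_num; linarith)

/-- The path ends at the central element of height β; descending at constant speed in the central
direction closes it up. -/
theorem exists_polygonLoop (β : ℝ) : ∃ F : C(Circle, Heis), ∀ x, 0 ≤ x → x ≤ 10 →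
    F (circ (x / 10)) = polygonPath β x * central (-(β * (x / 10))) := by
  refine exists_circleMap (f := fun x => polygonPath β x * central (-(β * (x / 10)))) ?_
    (by norm_num) ?_
  · unfold polygonPath
    fun_prop
  · rw [polygonPath_of_ge (x := 10) _ (by norm_num), polygonPath, ramp_of_le (by norm_num),
      ramp_of_le (by norm_num), ramp_of_le (by norm_num), ramp_of_le (by norm_num)]
    ext <;> simp

/-- The linear dilatation of the coordinates of the Heisenberg group. -/
def dilate (t : ℝ) (h : Heis) : Heis := mk (t * h.a) (t * h.b) (t * h.c)

theorem dilate_zero (h : Heis) : dilate 0 h = 1 := by ext <;> simp [dilate]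

theorem dilate_one (h : Heis) : dilate 1 h = h := by ext <;> simp [dilate]

theorem HoledDisc.quarter_le_norm (z : HoledDisc 1) : 1 / 4 ≤ ‖z.1‖ := by
  have h : holeRadius 1 ≤ ‖z.1 - holeCenter 1 0‖ := z.2.2 0
  rw [show holeCenter 1 0 = 0 by simp [holeCenter], sub_zero] at h
  exact (by simp [holeRadius] : (1 / 4 : ℝ) = holeRadius 1).trans_le h

theorem HoledDisc.one_ne_zero (z : HoledDisc 1) : z.1 ≠ 0 := by
  have := z.quarter_le_norm
  intro h
  rw [h, norm_zero] at this
  norm_num at this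

/-- Over the holed base, contract the loop of `exists_polygonLoop` radially to the identity and
twist the fibre by u^β. On the outer circle the twist cancels the descent, so paired sides differ by
lattice elements; on the rim it cancels the gluing of the solid torus, so the map extends there by
the fibre alone. -/
theorem exists_bundle_nil (β : ℤ) : ∃ (r : C(Bundle β, Nil)) (G : ℂ → Heis), G 0 = 1 ∧
    ∀ ζ w, r (bundleChart β (ζ, w)) = centralMap (G ζ, w) := by
  obtain ⟨F, hF⟩ := exists_polygonLoop β
  let r₀ : HoledDisc 1 × Circle → Nil := fun q =>
    centralMap (dilate ((4 * ‖q.1.1‖ - 1) / 3) (F (phase q.1.1)), q.2 * phase q.1.1 ^ β)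
  have hr₀ : Continuous r₀ := by
    have hp : Continuous fun q : HoledDisc 1 × Circle => phase q.1.1 :=
      continuous_phase_comp (continuous_subtype_val.comp continuous_fst) fun q => q.1.one_ne_zero
    have hn : Continuous fun q : HoledDisc 1 × Circle => ‖q.1.1‖ :=
      continuous_norm.comp (continuous_subtype_val.comp continuous_fst)
    have hd : Continuous fun q : HoledDisc 1 × Circle =>
        dilate ((4 * ‖q.1.1‖ - 1) / 3) (F (phase q.1.1)) := by
      unfold dilate
      fun_prop
    exact centralMap.continuous.comp (hd.prodMk (by fun_prop))
  have hann : ∀ s u v, r₀ (annulusPt s u, v) =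
      centralMap (dilate ((4 * max (1 / 4) (min 1 s) - 1) / 3) (F u), v * u ^ β) := by
    intro s u v
    have hpos : (0 : ℝ) < max (1 / 4) (min 1 s) := by positivity
    have h1 : phase (annulusPt s u).1 = u := phase_eq_of_eq hpos rfl
    have h2 : ‖(annulusPt s u).1‖ = max (1 / 4) (min 1 s) := by
      rw [annulusPt, norm_mul, Circle.norm_coe, mul_one, Complex.norm_real,
        Real.norm_of_nonneg hpos.le]
    simp only [r₀, h1, h2]
  have houter : ∀ x v, 0 ≤ x → x ≤ 10 → r₀ (outer 1 10 x, v) =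
      centralMap (polygonPath β x, v) := by
    intro x v h0 h1
    have e : dilate ((4 * max (1 / 4) (min 1 1) - 1) / 3) (F (circ (x / 10))) =
        F (circ (x / 10)) := by
      rw [min_self, max_eq_right (by norm_num)]
      norm_num
      exact dilate_one _
    obtain ⟨s, rfl⟩ := circ_surjective v
    rw [← annulusPt_one, hann, e, hF x h0 h1, ← circ_int_mul, ← circ_add, centralMap_circ,
      centralMap_circ, mul_assoc, ← central_add]
    congr 3
    ring
  let r₁ : (HoledDisc 1 × Circle) ⊕ (Fin 1 × Disc × Circle) → Nil :=
    Sum.elim r₀ fun q => centralMap (1, q.2.2)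
  have hr₁ : Continuous r₁ := hr₀.sumElim (by fun_prop)
  have hrel : ∀ p q, SeifertRel (bundleData β) p q → r₁ p = r₁ q := by
    intro p q h
    cases h with
    | side x y ε h v =>
      obtain rfl := h.orientable
      have hm := h.mem
      norm_num at hm
      change r₀ (outer 1 10 x, v) = r₀ (outer 1 10 y, v)
      rw [houter x v hm.1.1 hm.1.2, houter y v hm.2.1 hm.2.2]
      obtain ⟨k, hk, e⟩ := polygonPath_side β h
      obtain ⟨s, rfl⟩ := circ_surjective v
      rw [centralMap_circ, centralMap_circ, e, ← central_comm, ← central_comm, ← mul_assoc]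
      exact nilMk_eq_iff.2 ⟨k, hk, rfl⟩
    | fill k x =>
      obtain ⟨u, v⟩ := x
      have hk : k = (0 : Fin 1) := Subsingleton.elim (α := Fin 1) _ _
      subst hk
      have : r₀ (rim 1 0 u, u ^ β * v) = centralMap (1, v) := by
        have := annulusPt_quarter u⁻¹
        rw [inv_inv] at this
        rw [← this, hann]
        norm_num
        rw [dilate_zero]
      symm
      have e : linearMap ((bundleData β).B (0 : Fin 1)).1 (u, v) = (u, u ^ β * v) := by
        simp [bundleData, linearMap]
      rw [e]
      exact this
  refine ⟨⟨Quot.lift r₁ hrel, continuous_quot_lift _ hr₁⟩, fun ζ => if ‖ζ‖ ≤ 1 / 2 then 1 else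
    dilate ((4 * max (1 / 4) (min 1 ((3 * ‖ζ‖ - 1) / 2)) - 1) / 3) (F (phase ζ)), by simp, ?_⟩
  intro ζ w
  by_cases h : ‖ζ‖ ≤ 1 / 2
  · simp only [bundleChart, ContinuousMap.coe_mk, h, if_true]
    rfl
  · simp only [bundleChart, ContinuousMap.coe_mk, h, if_false]
    refine (hann _ _ _).trans ?_
    rw [mul_assoc, ← zpow_add, neg_add_cancel, zpow_zero, mul_one]

end GraphMfd
end

noncomputable section

namespace GraphMfd

open Topology

/-! ### Pinching a surface to the surface of genus two -/

/-- The map of polygons that collapses all handles but the first two. -/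
def pinch (g : ℕ) (x : ℝ) : ℝ := min x 8 + max 0 (x - 4 * g)

theorem pinch_of_le {g : ℕ} (hg : 2 ≤ g) {x : ℝ} (h : x ≤ 8) : pinch g x = x := by
  have : (2 : ℝ) ≤ g := by exact_mod_cast hg
  rw [pinch, min_eq_left h, max_eq_left (by linarith), add_zero]

theorem pinch_of_mem {g : ℕ} {x : ℝ} (h : 8 ≤ x) (h' : x ≤ 4 * g) : pinch g x = 8 := by
  rw [pinch, min_eq_right h, max_eq_left (by linarith), add_zero]

theorem pinch_of_ge {g : ℕ} (hg : 2 ≤ g) {x : ℝ} (h : 4 * (g : ℝ) ≤ x) :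
    pinch g x = 8 + (x - 4 * g) := by
  have : (2 : ℝ) ≤ g := by exact_mod_cast hg
  rw [pinch, min_eq_right (by linarith), max_eq_right (by linarith)]

/-- The first two handles are kept, the sides of the others go to the vertex 8, and the final pair
of sides is moved to the final pair of the decagon. -/
theorem pinch_side {g : ℕ} (hg : 2 ≤ g) {x y : ℝ} {ε : Bool}
    (h : SidePair (.orientable g) x y ε) :
    pinch g x = pinch g y ∨ SidePair (.orientable 2) (pinch g x) (pinch g y) false := by
  cases h with
  | a _ m t h0 h1 =>
    by_cases hm : (m : ℕ) < 2
    · right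
      have hm' : ((m : ℕ) : ℝ) + 1 ≤ 2 := by exact_mod_cast hm
      rw [pinch_of_le hg (by linarith), pinch_of_le hg (by linarith)]
      exact SidePair.a 2 ⟨m, hm⟩ t h0 h1
    · left
      have hm' : (2 : ℝ) ≤ ((m : ℕ) : ℝ) := by exact_mod_cast not_lt.1 hm
      have hm'' : ((m : ℕ) : ℝ) + 1 ≤ g := by exact_mod_cast m.isLt
      rw [pinch_of_mem (by linarith) (by linarith), pinch_of_mem (by linarith) (by linarith)]
  | b _ m t h0 h1 =>
    by_cases hm : (m : ℕ) < 2
    · right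
      have hm' : ((m : ℕ) : ℝ) + 1 ≤ 2 := by exact_mod_cast hm
      rw [pinch_of_le hg (by linarith), pinch_of_le hg (by linarith)]
      exact SidePair.b 2 ⟨m, hm⟩ t h0 h1
    · left
      have hm' : (2 : ℝ) ≤ ((m : ℕ) : ℝ) := by exact_mod_cast not_lt.1 hm
      have hm'' : ((m : ℕ) : ℝ) + 1 ≤ g := by exact_mod_cast m.isLt
      rw [pinch_of_mem (by linarith) (by linarith), pinch_of_mem (by linarith) (by linarith)]
  | c _ t h0 h1 =>
    right
    rw [pinch_of_ge hg (by linarith), pinch_of_ge hg (by linarith)]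
    have := SidePair.c 2 t h0 h1
    convert this using 1 <;> norm_num <;> ring

/-- The reflection x ↦ 8 - x reverses the word: it exchanges the two handles and the letters a and b
within them. The final pair is carried to negative parameters, which the period 10 brings back. -/
theorem SidePair.reflect {x y : ℝ} {ε : Bool} (h : SidePair (.orientable 2) x y ε) :
    SidePair (.orientable 2) (8 - y) (8 - x) false ∨
      SidePair (.orientable 2) (18 - y) (18 - x) false := by
  cases h with
  | a _ m t h0 h1 =>
    left
    have := SidePair.b 2 m.rev t h0 h1
    fin_cases m <;> convert this using 1 <;> norm_num <;> ring
  | b _ m t h0 h1 =>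
    left
    have := SidePair.a 2 m.rev t h0 h1
    fin_cases m <;> convert this using 1 <;> norm_num <;> ring
  | c _ t h0 h1 =>
    right
    have := SidePair.c 2 t h0 h1
    convert this using 1 <;> norm_num <;> ring

theorem outer_add_ten (x : ℝ) : outer 1 10 (x + 10) = outer 1 10 x := by
  rw [← annulusPt_one, ← annulusPt_one, add_div, div_self (by norm_num), circ_add, circ_one, mul_one]

/-- The boundary map is constant for δ = 0, the pinching for δ = 1, and the pinching followed by the
reflection for δ = -1. It is written as u^δ times an angle, in the form needed for extending the
fibre coordinate. -/
theorem exists_boundary_pinch (β : ℤ) {g : ℕ} (hg : 2 ≤ g) {δ : ℤ}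
    (hδ : δ = 0 ∨ δ = 1 ∨ δ = -1) : ∃ η : C(Circle, ℝ), ∀ x y ε,
      SidePair (.orientable g) x y ε → ∀ v, bundleBase β (annulusPt 1
        (circ (x / (4 * g + 2)) ^ δ * circ (η (circ (x / (4 * g + 2))))), v) =
      bundleBase β (annulusPt 1
        (circ (y / (4 * g + 2)) ^ δ * circ (η (circ (y / (4 * g + 2))))), v) := by
  have hn : (0 : ℝ) < 4 * g + 2 := by positivity
  obtain ⟨η, hη⟩ := exists_circleMap (f := fun x => pinch g x / 10 - x / (4 * g + 2))
    (by unfold pinch; fun_prop) hn (by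
      rw [pinch_of_le hg (by norm_num), pinch_of_ge hg (by linarith), div_self hn.ne']
      norm_num)
  rcases hδ with rfl | rfl | rfl
  · exact ⟨0, fun x y ε h v => by simp⟩
  · refine ⟨η, fun x y ε h v => ?_⟩
    have e : ∀ x, 0 ≤ x → x ≤ (4 * g + 2 : ℝ) → annulusPt 1
        (circ (x / (4 * g + 2)) ^ (1 : ℤ) * circ (η (circ (x / (4 * g + 2))))) =
        outer 1 10 (pinch g x) := by
      intro x h0 h1
      rw [← annulusPt_one, hη x h0 h1, zpow_one, ← circ_add]
      congr 2
      ring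
    rw [e x h.mem.1.1 h.mem.1.2, e y h.mem.2.1 h.mem.2.2]
    rcases pinch_side hg h with h | h
    · rw [h]
    · exact bundleBase_side β h v
  · refine ⟨ContinuousMap.const _ (8 / 10) - η, fun x y ε h v => ?_⟩
    have e : ∀ x, 0 ≤ x → x ≤ (4 * g + 2 : ℝ) → annulusPt 1
        (circ (x / (4 * g + 2)) ^ (-1 : ℤ) * circ ((ContinuousMap.const Circle (8 / 10 : ℝ) - η : C(Circle, ℝ))
          (circ (x / (4 * g + 2))))) = outer 1 10 (8 - pinch g x) := by
      intro x h0 h1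
      rw [← annulusPt_one, ContinuousMap.sub_apply, hη x h0 h1, ← circ_int_mul, ← circ_add]
      congr 2
      simp only [ContinuousMap.const_apply]
      push_cast
      ring
    rw [e x h.mem.1.1 h.mem.1.2, e y h.mem.2.1 h.mem.2.2]
    rcases pinch_side hg h with h | h
    · rw [h]
    · rcases h.reflect with h | h
      · exact (bundleBase_side β h v).symm
      · have := (bundleBase_side β h v).symm
        rw [show 18 - pinch g x = 8 - pinch g x + 10 by ring,
          show 18 - pinch g y = 8 - pinch g y + 10 by ring, outer_add_ten, outer_add_ten] at this
        exact this

/-! ### Maps to the circle with prescribed winding numbers -/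

theorem circ_sum {ι : Type*} (s : Finset ι) (f : ι → ℝ) : circ (∑ i ∈ s, f i) = ∏ i ∈ s, circ (f i) := by
  classical
  induction s using Finset.induction_on with
  | empty => simp
  | insert a s ha ih => rw [Finset.sum_insert ha, Finset.prod_insert ha, circ_add, ih]

theorem holeRadius_pos {d : ℕ} (j : Fin d) : 0 < holeRadius d := by
  have : (0 : ℝ) < d := by exact_mod_cast j.pos
  unfold holeRadius
  positivity

theorem HoledDisc.sub_ne_zero {d : ℕ} (z : HoledDisc d) (j : Fin d) : z.1 - holeCenter d j ≠ 0 := by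
  have h := z.2.2 j
  intro h0
  rw [h0, norm_zero] at h
  exact absurd (holeRadius_pos j) (not_lt.2 h)

theorem continuous_holedDisc_coe (d : ℕ) : Continuous fun z : HoledDisc d => z.1 :=
  continuous_subtype_val

theorem re_one_add_pos {z : ℂ} (h : ‖z‖ < 1) : 0 < (1 + z).re := by
  have := Complex.abs_re_le_norm z
  rw [Complex.add_re, Complex.one_re]
  linarith [(abs_le.1 this).1]

theorem continuous_radial {V : Type*} [NormedAddCommGroup V] [NormedSpace ℝ V]
    {E : Circle → V} (hE : Continuous E) :
    Continuous fun z : ℂ => max 0 (2 * ‖z‖ - 1) • E (phase z) := by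
  refine continuous_iff_continuousAt.2 fun z => ?_
  by_cases hz : z = 0
  · have : (fun _ : ℂ => (0 : V)) =ᶠ[𝓝 z] fun z =>
        max 0 (2 * ‖z‖ - 1) • E (phase z) := by
      have : Metric.ball (0 : ℂ) (1 / 2) ∈ 𝓝 z := by
        rw [hz]
        exact Metric.ball_mem_nhds _ (by norm_num)
      filter_upwards [this] with w hw
      rw [mem_ball_zero_iff] at hw
      rw [max_eq_left (by linarith), zero_smul]
    exact continuousAt_const.congr this
  · exact ContinuousAt.smul (by fun_prop)
      (hE.continuousAt.comp (continuousAt_phase hz))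

/-- The product of the phases of z - cⱼ to the power -k has winding k along every clockwise rim and
-dk along the outer circle. As -dk = βδ, it differs from the prescribed boundary values by real
angles only, and these can be cut off. -/
theorem exists_windingMap (d : ℕ) {k m β δ : ℤ} (h : -(d * k) = β * δ) (η : C(Circle, ℝ))
    (θ : Fin d → C(Torus, ℝ)) : ∃ W : C(HoledDisc d × Circle, Circle),
      (∀ (z : HoledDisc d) (u v : Circle), z.1 = u → W (z, v) = (u ^ δ * circ (η u)) ^ β * v ^ m) ∧
      (∀ j u v, W (rim d j u, v) = u ^ k * v ^ m * circ (θ j (u, v))) ∧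
      ∀ z, ∃ μ : C(Circle, ℝ), μ 1 = 0 ∧ ∀ v, W (z, v) = W (z, 1) * v ^ m * circ (μ v) := by
  set c := holeCenter d with hc
  set r := holeRadius d with hr
  have hcr : ∀ j, ‖c j‖ + r ≤ 1 / 2 := norm_holeCenter_add_le d
  have hr0 : ∀ j : Fin d, 0 < r := holeRadius_pos
  have hcoe := continuous_holedDisc_coe d
  have hinv : Continuous fun u : Circle => ((u⁻¹ : Circle) : ℂ) := by fun_prop
  have hC : ∀ j (u : Circle), 0 < (1 + -c j * ((u⁻¹ : Circle) : ℂ)).re := by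
    intro j u
    refine re_one_add_pos ?_
    rw [norm_mul, norm_neg, Circle.norm_coe, mul_one]
    linarith [hcr j, hr0 j]
  have hD : ∀ j i (u : Circle), 0 < (1 + r / (c j - c i) * ((u⁻¹ : Circle) : ℂ)).re := by
    intro j i u
    refine re_one_add_pos ?_
    rw [norm_mul, Circle.norm_coe, mul_one, norm_div, Complex.norm_real,
      Real.norm_of_nonneg (hr0 j).le]
    by_cases hij : j = i
    · simp [hij]
    · have := dist_holeCenter d hij
      have hp := hr0 j
      rw [div_lt_one (by linarith)]
      linarith
  -- On the outer circle the phase of z - cⱼ is u times the phase of 1 - cⱼu⁻¹. The latter number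
  -- has positive real part, so its angle is continuous.
  let E : C(Circle, ℝ) := ⟨fun u => β * η u + k * ∑ j, turn (1 + -c j * ((u⁻¹ : Circle) : ℂ)), by
    have : ∀ j, Continuous fun u : Circle => turn (1 + -c j * ((u⁻¹ : Circle) : ℂ)) :=
      fun j => continuous_turn_comp (by fun_prop) (hC j)
    fun_prop⟩
  -- On rim j the phases about the other holes have continuous angles, because r < |cⱼ - cᵢ|; these
  -- are removed together with imposing θ j.
  let θ' : Fin d → C(Torus, ℝ) := fun j => ⟨fun y => θ j y + k * ∑ i ∈ Finset.univ.erase j,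
      (turn (c j - c i) + turn (1 + r / (c j - c i) * ((y.1⁻¹ : Circle) : ℂ))), by
    have : ∀ i, Continuous fun y : Torus => turn (1 + r / (c j - c i) * ((y.1⁻¹ : Circle) : ℂ)) :=
      fun i => continuous_turn_comp (by fun_prop) fun y => hD j i y.1
    fun_prop⟩
  -- The cutoff t is 1 on the outer circle and 0 on the disc of radius 1/2; χⱼ is 1 on rim j and 0
  -- at distance 2r or more from cⱼ, hence on the other rims and on the outer circle.
  let t : HoledDisc d → ℝ := fun z => max 0 (2 * ‖z.1‖ - 1)
  let χ : Fin d → HoledDisc d → ℝ := fun j z => max 0 (2 - ‖z.1 - c j‖ / r)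
  let p : Fin d → HoledDisc d → Circle := fun j z => phase (z.1 - c j)
  have hp : ∀ j, Continuous (p j) := fun j =>
    continuous_phase_comp (by fun_prop) fun z => z.sub_ne_zero j
  have hχ : ∀ j, Continuous (χ j) := fun j => by fun_prop
  have htE : Continuous fun z : HoledDisc d => t z * E (phase z.1) := (continuous_radial E.continuous).comp hcoe
  refine ⟨⟨fun q => (∏ j, p j q.1 ^ (-k)) * q.2 ^ m *
    circ (t q.1 * E (phase q.1.1) + ∑ j, χ j q.1 * θ' j ((p j q.1)⁻¹, q.2)), ?_⟩, ?_, ?_, ?_⟩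
  · have : Continuous fun q : HoledDisc d × Circle => t q.1 * E (phase q.1.1) :=
      htE.comp continuous_fst
    fun_prop
  · intro z u v hz
    have ht : t z = 1 := by simp only [t, hz, Circle.norm_coe]; norm_num
    have hχ0 : ∀ j, χ j z = 0 := by
      intro j
      have h1 := norm_sub_norm_le (z.1) (c j)
      rw [hz, Circle.norm_coe] at h1
      have h2 := hcr j
      have h3 := norm_nonneg (c j)
      refine max_eq_left ?_
      rw [hz, sub_nonpos, le_div_iff₀ (hr0 j)]
      linarith
    have hpj : ∀ j, p j z = u * circ (turn (1 + -c j * ((u⁻¹ : Circle) : ℂ))) := by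
      intro j
      have e : z.1 - c j = u * (1 + -c j * ((u⁻¹ : Circle) : ℂ)) := by
        rw [hz, mul_add, mul_one, mul_left_comm, ← Circle.coe_mul, mul_inv_cancel]
        simp [sub_eq_add_neg]
      have hne : (1 + -c j * ((u⁻¹ : Circle) : ℂ)) ≠ 0 := by
        intro h0
        have := hC j u
        rw [h0] at this
        simp at this
      simp only [p]
      rw [e, phase_mul (Circle.coe_ne_zero u) hne, phase_coe]
      rfl
    simp only [ContinuousMap.coe_mk, ht, hχ0, hpj, zero_mul, Finset.sum_const_zero, add_zero,
      one_mul, hz, phase_coe, mul_zpow, Finset.prod_mul_distrib, Finset.prod_const,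
      Finset.card_univ, Fintype.card_fin, E]
    rw [circ_add, circ_int_mul, circ_int_mul, circ_sum, Finset.prod_zpow]
    generalize (∏ i, circ (turn (1 + -c i * ((u⁻¹ : Circle) : ℂ)))) = P
    rw [zpow_neg P k, ← zpow_natCast, ← zpow_mul, ← zpow_mul, mul_comm δ, ← h,
      show -k * (d : ℤ) = -(d * k) by ring]
    generalize P ^ k = x
    generalize u ^ (-(d * k : ℤ)) = y
    generalize circ (η u) ^ β = w
    rw [mul_assoc, mul_assoc, mul_assoc, mul_comm w (v ^ m)]
    congr 1
    rw [mul_left_comm]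
    congr 1
    rw [mul_comm w, inv_mul_cancel_left]
  · intro j u v
    have hz : (rim d j u).1 = c j + r * ((u⁻¹ : Circle) : ℂ) := rfl
    have hn : ‖(r : ℂ) * ((u⁻¹ : Circle) : ℂ)‖ = r := by
      rw [norm_mul, Circle.norm_coe, mul_one, Complex.norm_real, Real.norm_of_nonneg (hr0 j).le]
    have ht : t (rim d j u) = 0 := by
      have := norm_add_le (c j) (r * ((u⁻¹ : Circle) : ℂ))
      refine max_eq_left ?_
      rw [hz]
      linarith [hcr j]
    have hχj : χ j (rim d j u) = 1 := by
      simp only [χ, hz, add_sub_cancel_left, hn, div_self (hr0 j).ne']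
      norm_num
    have hχi : ∀ i, i ≠ j → χ i (rim d j u) = 0 := by
      intro i hij
      have h1 := dist_holeCenter d hij.symm
      have h2 := norm_sub_norm_le (c j - c i) (-(r * ((u⁻¹ : Circle) : ℂ)))
      rw [norm_neg, hn] at h2
      refine max_eq_left ?_
      rw [hz, sub_nonpos, le_div_iff₀ (hr0 j), show c j + r * ((u⁻¹ : Circle) : ℂ) - c i =
        c j - c i - -(r * ((u⁻¹ : Circle) : ℂ)) by ring]
      linarith [hr0 j]
    have hpj : p j (rim d j u) = u⁻¹ := by
      simp only [p, hz, add_sub_cancel_left]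
      exact phase_eq_of_eq (hr0 j) rfl
    have hpi : ∀ i, i ≠ j → p i (rim d j u) =
        circ (turn (c j - c i) + turn (1 + r / (c j - c i) * ((u⁻¹ : Circle) : ℂ))) := by
      intro i hij
      have h1 : c j - c i ≠ 0 := by
        have := dist_holeCenter d hij.symm
        rw [← norm_pos_iff]
        linarith [hr0 j]
      have hne : (1 + r / (c j - c i) * ((u⁻¹ : Circle) : ℂ)) ≠ 0 := by
        intro h0
        have := hD j i u
        rw [h0] at this
        simp at this
      rw [circ_add]
      change _ = phase _ * phase _
      rw [← phase_mul h1 hne]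
      simp only [p, hz]
      congr 1
      field_simp
      ring
    have hsum : ∑ i, χ i (rim d j u) * θ' i ((p i (rim d j u))⁻¹, v) = θ' j (u, v) := by
      rw [Finset.sum_eq_single j (fun i _ hij => by rw [hχi i hij, zero_mul]) (by simp), hχj,
        one_mul, hpj, inv_inv]
    simp only [ContinuousMap.coe_mk, ht, zero_mul, zero_add]
    rw [hsum, ← Finset.mul_prod_erase _ _ (Finset.mem_univ j), hpj,
      Finset.prod_congr rfl fun i hi => by rw [hpi i (Finset.ne_of_mem_erase hi)]]
    simp only [θ', ContinuousMap.coe_mk]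
    rw [circ_add, circ_int_mul, circ_sum, Finset.prod_zpow, zpow_neg _ k, inv_zpow, zpow_neg, inv_inv]
    generalize (∏ i ∈ Finset.univ.erase j, circ (turn (c j - c i) +
      turn (1 + r / (c j - c i) * ((u⁻¹ : Circle) : ℂ)))) ^ k = x
    rw [mul_assoc, mul_assoc, mul_assoc]
    congr 1
    rw [mul_left_comm]
    congr 1
    rw [mul_comm (circ _), inv_mul_cancel_left]
  · intro z
    refine ⟨⟨fun v => ∑ j, χ j z * (θ' j ((p j z)⁻¹, v) - θ' j ((p j z)⁻¹, 1)), by fun_prop⟩,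
      by simp, fun v => ?_⟩
    simp only [ContinuousMap.coe_mk, one_zpow, mul_one, mul_sub, Finset.sum_sub_distrib]
    rw [mul_right_comm _ (circ _), mul_assoc _ (circ _), ← circ_add]
    congr 2
    ring

end GraphMfd
end

noncomputable section

namespace GraphMfd

open Topology Heis

/-! ### The map on one piece -/

/-- In the chart of the bundle, the base coordinate is the radial extension of the boundary
pinching, zero on |z| ≤ 1/2 and so on all rims, and the fibre coordinate is the winding map. On the
outer circle its factor with exponent β is the clutching function, so only v^m remains and paired
sides agree. -/
theorem exists_pieceMap {g d : ℕ} (hg : 2 ≤ g) {k m β δ : ℤ} (hδ : δ = 0 ∨ δ = 1 ∨ δ = -1)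
    (h : -(d * k) = β * δ) (θ : Fin d → C(Torus, ℝ)) :
    ∃ Φ : C(Surface g d × Circle, Bundle β),
      (∀ j u v, Φ (Surface.bdry g d j u, v) =
        bundleChart β (0, u ^ k * v ^ m * circ (θ j (u, v)))) ∧
      ∀ y, ∃ (ζ : ℂ) (w : Circle) (μ : C(Circle, ℝ)), μ 1 = 0 ∧
        ∀ v, Φ (y, v) = bundleChart β (ζ, w * v ^ m * circ (μ v)) := by
  obtain ⟨η, hη⟩ := exists_boundary_pinch β hg hδ
  obtain ⟨W, hW₁, hW₂, hW₃⟩ := exists_windingMap d (m := m) h η θ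
  let q : Circle → ℂ := fun u => ((u ^ δ * circ (η u) : Circle) : ℂ)
  have hq : Continuous q := continuous_subtype_val.comp
    (by fun_prop : Continuous fun u : Circle => u ^ δ * circ (η u))
  let ζ : HoledDisc d → ℂ := fun z => max 0 (2 * ‖z.1‖ - 1) • q (phase z.1)
  have hζ : Continuous ζ := (continuous_radial hq).comp (continuous_holedDisc_coe d)
  let Φ₀ : C(HoledDisc d × Circle, Bundle β) :=
    ⟨fun y => bundleChart β (ζ y.1, W y), by fun_prop⟩
  have hΦ₀ : ∀ (z : HoledDisc d) (u v : Circle), z.1 = u →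
      Φ₀ (z, v) = bundleBase β (annulusPt 1 (u ^ δ * circ (η u)), v ^ m) := by
    intro z u v hz
    have e : ζ z = ((u ^ δ * circ (η u) : Circle) : ℂ) := by
      simp only [ζ, q]
      rw [hz, Circle.norm_coe, phase_coe, max_eq_right (by norm_num)]
      norm_num
    rw [← bundleChart_coe, ← e, ← hW₁ z u v hz]
    rfl
  have hrel : ∀ z w : HoledDisc d, (∃ x y : ℝ, ∃ ε : Bool, SidePair (.orientable g) x y ε ∧
      z = outer d (SurfaceType.orientable g).sides x ∧
      w = outer d (SurfaceType.orientable g).sides y) → Φ₀.curry z = Φ₀.curry w := by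
    rintro _ _ ⟨x, y, ε, hxy, rfl, rfl⟩
    ext v
    have e : ∀ x, (outer d (SurfaceType.orientable g).sides x).1 = circ (x / (4 * g + 2)) := by
      intro x
      simp [outer, circ, SurfaceType.sides, mul_div_assoc]
    simp only [ContinuousMap.curry_apply]
    rw [hΦ₀ _ _ v (e x), hΦ₀ _ _ v (e y)]
    exact hη x y ε hxy _
  -- Passing to the quotient is done for the curried map, since a product of a quotient map with the
  -- circle need not be handled then.
  let Φ₁ : C(Surface g d, C(Circle, Bundle β)) :=
    ⟨Quot.lift Φ₀.curry hrel, continuous_quot_lift _ Φ₀.curry.continuous⟩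
  refine ⟨Φ₁.uncurry, fun j u v => ?_, fun y => ?_⟩
  · have e : ζ (rim d j u) = 0 := by
      have h1 := norm_add_le (holeCenter d j) (holeRadius d * ((u⁻¹ : Circle) : ℂ))
      have h2 := norm_holeCenter_add_le d j
      rw [norm_mul, Circle.norm_coe, mul_one, Complex.norm_real,
        Real.norm_of_nonneg (holeRadius_nonneg d)] at h1
      simp only [ζ, rim]
      rw [max_eq_left (by linarith), zero_smul]
    rw [← hW₂, ← e]
    rfl
  · obtain ⟨z, rfl⟩ := Quot.exists_rep y
    obtain ⟨μ, h0, h1⟩ := hW₃ z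
    refine ⟨ζ z, W (z, 1), μ, h0, fun v => ?_⟩
    rw [← h1]
    rfl

/-- Going round the circle factor translates by the central path of total height m, so the volume is
m times the height of the boundary; each of the d boundary circles is a central loop of height k. -/
theorem eval_piece {g d : ℕ} {k m : ℤ} {θ : Fin d → C(Torus, ℝ)} (h : C(Surface g d × Circle, Nil))
    (h₁ : ∀ j u v, h (Surface.bdry g d j u, v) =
      centralMap (1, u ^ k * v ^ m * circ (θ j (u, v))))
    (h₂ : ∀ y, ∃ (x : Heis) (w : Circle) (μ : C(Circle, ℝ)), μ 1 = 0 ∧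
      ∀ v, h (y, v) = centralMap (x, w * v ^ m * circ (μ v)))
    {c : Chain 2 (Surface g d)}
    (hc : bdryOp 1 _ c = ∑ j, Finsupp.single ((bdryMap g d j).comp stdLoop) 1) :
    evalCochain volCochain (push 3 h (prismTwo (crossCircle _) c)) = m * (d * k) := by
  rw [push_prismTwo, eval_prismTwo _ (m : ℝ), bdryOp_push, hc, map_sum, map_sum]
  · have : ∀ j, heightCochain (((h.comp (crossCircle _)).comp ⟨fun y => (y, 0), by fun_prop⟩).comp
        ((bdryMap g d j).comp stdLoop)) = k := by
      intro j
      rw [heightCochain_loop _ (centralMap (1, 1))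
        ⟨fun s => k * s + θ j (circ s, 1), by fun_prop⟩]
      · simp
      · intro p
        refine (h₁ j (circ (p 1)) (circ 0)).trans ?_
        have e : (1 : Circle) * circ (k * p 1 + θ j (circ (p 1), 1)) =
            circ (p 1) ^ k * circ 0 ^ m * circ (θ j (circ (p 1), circ 0)) := by
          simp [circ_add, circ_int_mul]
        rw [← e, centralMap_mul_circ]
        rfl
    simp only [push_single, evalCochain_single, this]
    simp
  · intro y
    obtain ⟨x, w, μ, h0, h1⟩ := h₂ y
    refine ⟨⟨fun s => m * s + μ (circ s), by fun_prop⟩, by simp [h0], by simp [h0], fun s => ?_⟩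
    have e : h.comp (crossCircle _) (y, 0) = centralMap (x, w) := by
      refine (h1 (circ 0)).trans ?_
      simp [h0]
    have e' : w * circ (m * s + μ (circ s)) = w * circ s ^ m * circ (μ (circ s)) := by
      rw [circ_add, circ_int_mul, mul_assoc]
    rw [e]
    refine (h1 (circ s)).trans ?_
    rw [← e', centralMap_mul_circ]
    rfl

/-! ### The fundamental cycle -/

section Cycle

variable {g₁ g₂ d : ℕ} (σ : Equiv.Perm (Fin d)) (φ : Fin d → (Torus ≃ₜ Torus))

/-- The inclusion of the first piece. -/
def inclOne : C(Surface g₁ d × Circle, Glued g₁ g₂ d σ φ) :=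
  ⟨fun y => Quot.mk _ (Sum.inl y), continuous_quot_mk.comp continuous_inl⟩

/-- The inclusion of the second piece. -/
def inclTwo : C(Surface g₂ d × Circle, Glued g₁ g₂ d σ φ) :=
  ⟨fun y => Quot.mk _ (Sum.inr y), continuous_quot_mk.comp continuous_inr⟩

/-- A boundary torus of a product piece. -/
def bdryTorus (g d : ℕ) (j : Fin d) : C(Torus, Surface g d × Circle) :=
  (bdryMap g d j).prodMap (ContinuousMap.id Circle)

theorem inclOne_bdryTorus (j : Fin d) :
    (inclOne (g₁ := g₁) (g₂ := g₂) σ φ).comp (bdryTorus g₁ d j) =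
      ((inclTwo σ φ).comp (bdryTorus g₂ d (σ j))).comp (φ j : C(Torus, Torus)) := by
  ext x
  exact Quot.sound ⟨j, x, rfl, rfl⟩

/-- The prism runs once around the circle, so its top and bottom cancel and only the lateral tori
remain. -/
theorem bdryOp_prismTwo_crossCircle {g : ℕ} {c : Chain 2 (Surface g d)}
    (hc : bdryOp 1 _ c = ∑ j, Finsupp.single ((bdryMap g d j).comp stdLoop) 1) :
    bdryOp 2 _ (prismTwo (crossCircle _) c) = -∑ j, push 2 (bdryTorus g d j) torusChain := by
  have h := bdryOp_prismTwo (crossCircle (Surface g d)) c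
  have e : (crossCircle (Surface g d)).comp ⟨fun y => (y, 1), by fun_prop⟩ =
      (crossCircle (Surface g d)).comp ⟨fun y => (y, 0), by fun_prop⟩ := by
    ext y
    · rfl
    · simp [crossCircle]
  rw [e, sub_self, hc, map_sum] at h
  rw [eq_neg_of_add_eq_zero_left h]
  congr 1
  refine Finset.sum_congr rfl fun j _ => ?_
  rw [← push_single, push_prismOne (crossCircle (Surface g d)) (crossCircle Circle) (bdryMap g d j)
    (bdryTorus g d j) fun x s => rfl]
  rfl

/-- A torus of the first piece is identified with one of the second via φ j. The two torus cycles do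
not cancel as chains, and `b j` makes up for the difference; the permutation σ only reorders the
sum. -/
theorem bdryOp_cycle {c₁ : Chain 2 (Surface g₁ d)} {c₂ : Chain 2 (Surface g₂ d)} {b : Fin d → Chain 3 Torus}
    (h₁ : bdryOp 1 _ c₁ = ∑ j, Finsupp.single ((bdryMap g₁ d j).comp stdLoop) 1)
    (h₂ : bdryOp 1 _ c₂ = ∑ j, Finsupp.single ((bdryMap g₂ d j).comp stdLoop) 1)
    (hb : ∀ j, bdryOp 2 _ (b j) = push 2 (φ j : C(Torus, Torus)) torusChain + torusChain) :
    bdryOp 2 (Glued g₁ g₂ d σ φ) (push 3 (inclOne σ φ) (prismTwo (crossCircle _) c₁)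
      + push 3 (inclTwo σ φ) (prismTwo (crossCircle _) c₂)
      + ∑ j, push 3 ((inclTwo σ φ).comp (bdryTorus g₂ d (σ j))) (b j)) = 0 := by
  simp only [map_add, map_sum, bdryOp_push, bdryOp_prismTwo_crossCircle h₁,
    bdryOp_prismTwo_crossCircle h₂, hb, map_neg, push_push, inclOne_bdryTorus,
    Finset.sum_add_distrib]
  rw [← Equiv.sum_comp σ fun j => push 2 ((inclTwo (g₁ := g₁) σ φ).comp (bdryTorus g₂ d j)) torusChain]
  abel

end Cycle

/-! ### Arithmetic -/

/-- If A₀₁ = 0, then det A = -1 makes A₁₁ = ±1, and the fibre goes to the fibre or its reverse. -/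
theorem MultipleEdges.entry_ne_zero {N : Type} [TopologicalSpace N] {d g₁ g₂ : ℕ}
    (G : MultipleEdges N d g₁ g₂) (j : Fin d) : G.A j 0 1 ≠ 0 := by
  intro h0
  have hdet := G.det j
  rw [Matrix.det_fin_two, h0, zero_mul, sub_zero] at hdet
  have h := (G.hasMatrix j).2
  refine G.not_match j ?_
  rcases Int.eq_one_or_neg_one_of_mul_eq_neg_one ((mul_comm _ _).trans hdet) with h1 | h1
  · left
    have : (linearMap (G.A j)).comp hCurve = hCurve := by
      ext v <;> simp [linearMap, hCurve, h0, h1]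
    rwa [this] at h
  · right
    have : (linearMap (G.A j)).comp hCurve = hCurveRev := by
      ext v <;> simp [linearMap, hCurve, hCurveRev, h0, h1]
    rwa [this] at h

/-- The conditions are those of extension over each piece and of agreement on the tori; the last
expression, times d, is the volume of the image of the fundamental cycle. -/
theorem exists_windings {d : ℕ} (hd : 0 < d) {A : Matrix (Fin 2) (Fin 2) ℤ} (hA : A.det = -1)
    (h01 : A 0 1 ≠ 0) : ∃ β δ₁ δ₂ k₁ k₂ m₁ m₂ : ℤ, β ≠ 0 ∧
      (δ₁ = 0 ∨ δ₁ = 1 ∨ δ₁ = -1) ∧ (δ₂ = 0 ∨ δ₂ = 1 ∨ δ₂ = -1) ∧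
      -(d * k₁) = β * δ₁ ∧ -(d * k₂) = β * δ₂ ∧
      k₁ = k₂ * A 0 0 + m₂ * A 1 0 ∧ m₁ = k₂ * A 0 1 + m₂ * A 1 1 ∧ m₁ * k₁ + m₂ * k₂ ≠ 0 := by
  rw [Matrix.det_fin_two] at hA
  have hd' : (d : ℤ) ≠ 0 := by exact_mod_cast hd.ne'
  by_cases h10 : A 1 0 = 0
  · rw [h10, mul_zero, sub_zero] at hA
    have h00 := Int.eq_one_or_neg_one_of_mul_eq_neg_one hA
    -- With A₁₀ = 0 the agreement forces k₁ = k₂A₀₀ = ±k₂. Taking k₂ = 1 and m₂ = 0 leaves m₁k₁ =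
    -- A₀₁A₀₀.
    refine ⟨-d, A 0 0, 1, A 0 0, 1, A 0 1, 0, by simpa using hd', Or.inr h00, by simp, by ring,
      by ring, by ring, by ring, ?_⟩
    rcases h00 with h | h <;> simpa [h] using h01
  · have key : ∀ δ₁ δ₂ : ℤ, (δ₁ = 0 ∨ δ₁ = 1 ∨ δ₁ = -1) → (δ₂ = 0 ∨ δ₂ = 1 ∨ δ₂ = -1) →
        A 1 1 * δ₁ ^ 2 + 2 * δ₁ * δ₂ - A 0 0 * δ₂ ^ 2 ≠ 0 →
        ∃ β δ₁ δ₂ k₁ k₂ m₁ m₂ : ℤ, β ≠ 0 ∧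
          (δ₁ = 0 ∨ δ₁ = 1 ∨ δ₁ = -1) ∧ (δ₂ = 0 ∨ δ₂ = 1 ∨ δ₂ = -1) ∧
          -(d * k₁) = β * δ₁ ∧ -(d * k₂) = β * δ₂ ∧ k₁ = k₂ * A 0 0 + m₂ * A 1 0 ∧
          m₁ = k₂ * A 0 1 + m₂ * A 1 1 ∧ m₁ * k₁ + m₂ * k₂ ≠ 0 := fun δ₁ δ₂ e₁ e₂ hQ =>
      -- The factor A₁₀ in kᵢ = A₁₀δᵢ makes k₁ = k₂A₀₀ + m₂A₁₀ solvable for an integral m₂; then m₁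
      -- follows from det A = -1.
      ⟨-d * A 1 0, δ₁, δ₂, A 1 0 * δ₁, A 1 0 * δ₂, δ₂ + A 1 1 * δ₁, δ₁ - δ₂ * A 0 0,
        mul_ne_zero (neg_ne_zero.2 hd') h10, e₁, e₂, by ring, by ring, by ring,
        by linear_combination δ₂ * hA, by
          have := mul_ne_zero h10 hQ
          intro h
          exact this (by linear_combination h)⟩
    by_cases h11 : A 1 1 = 0
    · by_cases h00 : A 0 0 = 0
      · exact key 1 1 (by simp) (by simp) (by simp [h11, h00])
      · exact key 0 1 (by simp) (by simp) (by simpa using h00)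
    · exact key 1 0 (by simp) (by simp) (by simpa using h11)

/-! ### Domination -/

theorem supportsPSLTilde_bundle {β : ℤ} (hβ : β ≠ 0) : SupportsPSLTilde (Bundle β) := by
  refine ⟨bundleData β, ⟨Homeomorph.refl _⟩, ?_, ?_⟩
  · rw [eulerNumber_bundleData]
    simpa using hβ
  · rw [baseEuler_bundleData]
    norm_num

theorem MultipleEdges.exists_dominating {N : Type} [TopologicalSpace N] {d g₁ g₂ : ℕ}
    (G : MultipleEdges N d g₁ g₂) (hI : G.PropertyI) :
    ∃ (M : Type) (_ : TopologicalSpace M) (f : C(N, M)), SupportsPSLTilde M ∧ NonzeroDegree f := by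
  have hd := G.pos
  set A := G.A ⟨0, hd⟩ with hA
  have hAj : ∀ j, G.A j = A := fun j => hI j _
  obtain ⟨β, δ₁, δ₂, k₁, k₂, m₁, m₂, hβ, hδ₁, hδ₂, hk₁, hk₂, ek, em, hQ⟩ :=
    exists_windings hd (G.det ⟨0, hd⟩) (G.entry_ne_zero ⟨0, hd⟩)
  have hangle : ∀ j, ∃ η₁ η₂ : C(Torus, ℝ), ∀ y, G.φ j y =
      ((linearMap A y).1 * circ (η₁ y), (linearMap A y).2 * circ (η₂ y)) := by
    intro j
    have := G.hasMatrix j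
    rw [hAj] at this
    exact this.exists_angles
  choose η₁ η₂ hη using hangle
  obtain ⟨Φ₁, p₁, p₁'⟩ := exists_pieceMap (m := m₁) G.genus_one hδ₁ hk₁
    fun j => (k₂ : ℝ) • η₁ j + (m₂ : ℝ) • η₂ j
  obtain ⟨Φ₂, p₂, p₂'⟩ := exists_pieceMap (m := m₂) G.genus_two hδ₂ hk₂ fun _ => 0
  -- The angles k₂η₁ + m₂η₂ prescribed on the first piece are what the second map picks up from the
  -- deviation of φ j from the linear map; the rest is (k₁, m₁) = (k₂, m₂)A.
  let f : C(Glued g₁ g₂ d G.σ G.φ, Bundle β) := ⟨Quot.lift (Sum.elim Φ₁ Φ₂) (by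
    rintro _ _ ⟨j, ⟨u, v⟩, rfl, rfl⟩
    simp only [Sum.elim_inl, Sum.elim_inr]
    rw [p₁, p₂, hη j (u, v)]
    congr 2
    simp only [linearMap, ContinuousMap.coe_mk, ContinuousMap.add_apply, ContinuousMap.smul_apply,
      ContinuousMap.zero_apply, smul_eq_mul, circ_add, circ_int_mul, circ_zero, mul_one, mul_zpow]
    rw [ek, em, zpow_add, zpow_add, zpow_mul, zpow_mul, zpow_mul, zpow_mul]
    simp only [← zpow_mul]
    rw [mul_comm k₂, mul_comm k₂, mul_comm m₂, mul_comm m₂]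
    ac_rfl), continuous_quot_lift _ (Φ₁.continuous.sumElim Φ₂.continuous)⟩
  obtain ⟨r, H, hH, hr⟩ := exists_bundle_nil β
  obtain ⟨c₁, hc₁⟩ := exists_surface_chain g₁ hd
  obtain ⟨c₂, hc₂⟩ := exists_surface_chain g₂ hd
  have hb : ∀ j, ∃ b, bdryOp 2 Torus b = push 2 (G.φ j : C(Torus, Torus)) torusChain + torusChain :=
    fun j => push_homeo_torusChain _ A (G.det _) (η₁ j) (η₂ j) (hη j)
  choose b hb using hb
  set z := push 3 (inclOne G.σ G.φ) (prismTwo (crossCircle _) c₁)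
      + push 3 (inclTwo G.σ G.φ) (prismTwo (crossCircle _) c₂)
      + ∑ j, push 3 ((inclTwo G.σ G.φ).comp (bdryTorus g₂ d (G.σ j))) (b j) with hz
  have hcycle : bdryOp 2 _ z = 0 := bdryOp_cycle G.σ G.φ hc₁ hc₂ hb
  refine ⟨Bundle β, inferInstance, f.comp (G.homeo : C(N, _)), supportsPSLTilde_bundle hβ,
    nonzeroDegree_of_cocycle _ (push 3 (G.homeo.symm : C(_, N)) z) (by
      rw [bdryOp_push, hcycle, map_zero]) (fun τ => volCochain (r.comp τ)) (fun τ => ?_) ?_⟩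
  · rw [← evalCochain_push, ← bdryOp_single, ← bdryOp_push, push_single, bdryOp_single]
    exact volCochain_cocycle _
  · have e : (f.comp (G.homeo : C(N, _))).comp (G.homeo.symm : C(_, N)) = f := by
      ext y
      simp
    rw [push_push, e, ← evalCochain_push, push_push, hz]
    simp only [map_add, map_sum, push_push]
    have e₁ := eval_piece (k := k₁) (m := m₁) ((r.comp f).comp (inclOne G.σ G.φ))
      (fun j u v => (congrArg r (p₁ j u v)).trans (by rw [hr, hH]))
      (fun y => by
        obtain ⟨ζ, w, μ, h0, h1⟩ := p₁' y
        exact ⟨H ζ, w, μ, h0, fun v => (congrArg r (h1 v)).trans (hr _ _)⟩) hc₁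
    have e₂ := eval_piece (k := k₂) (m := m₂) ((r.comp f).comp (inclTwo G.σ G.φ))
      (fun j u v => (congrArg r (p₂ j u v)).trans (by rw [hr, hH]))
      (fun y => by
        obtain ⟨ζ, w, μ, h0, h1⟩ := p₂' y
        exact ⟨H ζ, w, μ, h0, fun v => (congrArg r (h1 v)).trans (hr _ _)⟩) hc₂
    -- All boundary tori lie over the centre of the chart, so the correcting chains are mapped into
    -- one central fibre of the nilmanifold.
    have e₃ : ∀ j, evalCochain volCochain (push 3 ((r.comp f).comp
        ((inclTwo G.σ G.φ).comp (bdryTorus g₂ d (G.σ j)))) (b j)) = 0 := by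
      intro j
      rw [evalCochain_push]
      have : (fun τ : C(Simp 3, Torus) => volCochain (((r.comp f).comp
          ((inclTwo G.σ G.φ).comp (bdryTorus g₂ d (G.σ j)))).comp τ)) = 0 := by
        funext τ
        refine volCochain_fibre _ fun p => ?_
        obtain ⟨s, hs⟩ := circ_surjective ((τ p).1 ^ k₂ * (τ p).2 ^ m₂ * circ 0)
        refine ⟨s, (congrArg r (p₂ (G.σ j) (τ p).1 (τ p).2)).trans ?_⟩
        rw [hr, hH]
        refine (congrArg (fun w => centralMap (1, w)) hs.symm).trans ?_
        rw [centralMap_circ, one_mul]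
      rw [this]
      exact Finsupp.linearCombination_zero_apply ..
    rw [e₁, e₂, Finset.sum_eq_zero fun j _ => e₃ j, add_zero]
    have : (m₁ : ℝ) * (d * k₁) + m₂ * (d * k₂) = ((d * (m₁ * k₁ + m₂ * k₂) : ℤ) : ℝ) := by
      push_cast
      ring
    rw [this, Int.cast_ne_zero]
    exact mul_ne_zero (by exact_mod_cast hd.ne') hQ

end GraphMfd
end

theorem lemma4p5 (N : Type) [TopologicalSpace N] (d g₁ g₂ : ℕ)
    (G : GraphMfd.MultipleEdges N d g₁ g₂) (hI : G.PropertyI)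
    (a₁ b₁ a₂ b₂ : ℕ) (ha₁ : 0 < a₁) (hb₁ : 0 < b₁) (ha₂ : 0 < a₂) (hb₂ : 0 < b₂)
    (hg₁ : g₁ = a₁ * d + b₁) (hg₂ : g₂ = a₂ * d + b₂) :
    ∃ (M : Type) (_ : TopologicalSpace M) (f : C(N, M)),
      GraphMfd.SupportsPSLTilde M ∧ GraphMfd.NonzeroDegree f :=
  G.exists_dominating hI
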